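/- Let $R$ be a commutative ring with unit. All modules are $\mathbb Z$-graded $R$-modules with homological grading. A dg coalgebra $(K,d_K,\nabla)$ is coassociative (not necessarily counital), with $\deg d_K=-1$ and $d_K$ a coderivation of square zero; write $\nabla^i:K\to K^{\otimes i}$ for the iterated comultiplication, $\nabla^1=\mathrm{id}$, $\nabla^{i}=(\nabla^{i-1}\otimes \mathrm{id})\nabla$. An $A_\infty$-algebra $(M,\{m_i\}_{i\ge 1})$ has operations $m_i:M^{\otimes i}\to M$ of degree $i-2$ with $$\sum_{k,j}(-1)^{\sum_{l\le k}(|a_l|+1)}\,m_{n-j+1}(a_1,\dots,a_k,m_j(a_{k+1},\dots,a_{k+j}),a_{k+j+1},\dots,a_n)=0\qquad(n\ge 1),$$ and a morphism $f=\{f_i\}:M\to M'$ has components $f_i:M^{\otimes i}\to M'$ of degree $i-1$ with $$\sum_{k,j}(-1)^{\sum_{l\le k}(|a_l|+1)}f_{n-j+1}(a_1,\dots,a_k,m_j(a_{k+1},\dots,a_{k+j}),\dots,a_n)=\sum_{k_1+\dots+k_t=n}m'_t\bigl(f_{k_1}(a_1,\dots,a_{k_1}),\dots,f_{k_t}(a_{n-k_t+1},\dots,a_n)\bigr).$$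 The bar construction $B(M)$ is the tensor coalgebra on the suspension of $M$ with the differential induced by the $m_i$, and $B(f):B(M)\to B(M')$ is the dg coalgebra map induced by $f$. $M$ is connected if $M_n=0$ for all $n\le 0$. For connected $M$, an $A_\infty$-twisting cochain is a map $\phi:K\to M$ of degree $-1$ with $$\phi\, d_K=\sum_{i\ge 1}m_i(\phi\otimes\cdots\otimes\phi)\nabla^i .$$ Two $A_\infty$-twisting cochains $\phi,\psi:K\to M$ are equivalent, $\phi\sim\psi$, if there is a map $c:K\to M$ of degree $0$ with $$\phi-\psi=c\,d_K+\sum_{k,l\ge 0}m_{k+1+l}(\phi^{\otimes k}\otimes c\otimes\psi^{\otimes l})\nabla^{k+1+l},$$ where $(\phi^{\otimes k}\otimes c\otimes\psi^{\otimes l})(x_1\otimes\cdots\otimes x_{k+1+l})$ carries the Koszul sign $(-1)^{|x_1|+\dots+|x_k|}$. (All these sums are finite on each element, by connectedness.) For a morphism $f:M\to M'$ and a twisting cochain $\psi:K\to M$ put $f\circ\psi=\sum_{i\ge 1}f_i(\psi\otimes\cdots\otimes\psi)\nabla^i:K\to M'$. **Theorem.** Let $K$ be a dg coalgebra such that every component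 $K_n$ is a free $R$-module, and let $f:M\to M'$ be a morphism of connected $A_\infty$-algebras which is a weak equivalence, in either of the following senses: (i) $f_1:(M,m_1)\to(M',m'_1)$ is a homology isomorphism; or (ii) all $M_n$ and $M'_n$ are flat $R$-modules and $B(f):B(M)\to B(M')$ is a homology isomorphism. Then for every $A_\infty$-twisting cochain $\phi:K\to M'$ there is an $A_\infty$-twisting cochain $\psi:K\to M$ such that $f\circ\psi$ is an $A_\infty$-twisting cochain and $\phi\sim f\circ\psi$. -/

import Mathlib

open scoped TensorProduct DirectSum

namespace AInf

/-! Graded modules are modules `M` with an internal `ℤ`-grading `𝓜` (homological degrees). -/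

section Grading

variable {R M : Type*} [CommRing R] [AddCommGroup M] [Module R M]

/-- The grading involution: multiplication by `(-1) ^ n` in degree `n`. -/
def gradeInvol (𝓜 : ℤ → Submodule R M) [DirectSum.Decomposition 𝓜] : M →ₗ[R] M :=
  (DirectSum.toModule R ℤ M fun n => ((n.negOnePow : ℤˣ) : ℤ) • (𝓜 n).subtype) ∘ₗ
    (DirectSum.decomposeLinearEquiv 𝓜).toLinearMap

theorem gradeInvol_of_mem (𝓜 : ℤ → Submodule R M) [DirectSum.Decomposition 𝓜] {n : ℤ} {x : M}
    (hx : x ∈ 𝓜 n) : gradeInvol 𝓜 x = ((n.negOnePow : ℤˣ) : ℤ) • x := by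
  have h : DirectSum.decompose 𝓜 x = DirectSum.lof R ℤ (fun i => 𝓜 i) n ⟨x, hx⟩ :=
    DirectSum.decompose_of_mem 𝓜 hx
  simp only [gradeInvol, LinearMap.comp_apply, LinearEquiv.coe_coe,
    DirectSum.decomposeLinearEquiv_apply, h, DirectSum.toModule_lof]
  rfl

/-- The Koszul sign of moving an operation of odd degree past an element of the suspension
`s M`: multiplication by `(-1) ^ (n + 1)` on elements of degree `n` in `M`. -/
def suspSign (𝓜 : ℤ → Submodule R M) [DirectSum.Decomposition 𝓜] : M →ₗ[R] M :=
  -gradeInvol 𝓜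

/-- `f : A → A'` induces a bijection `ker d / im d → ker d' / im d'`. -/
def IsHomologyIso {A A' : Type*} [AddCommGroup A] [Module R A] [AddCommGroup A'] [Module R A']
    (d : A →ₗ[R] A) (d' : A' →ₗ[R] A') (f : A →ₗ[R] A') : Prop :=
  (∀ z, d z = 0 → f z ∈ LinearMap.range d' → z ∈ LinearMap.range d) ∧
    ∀ z', d' z' = 0 → ∃ z, d z = 0 ∧ f z - z' ∈ LinearMap.range d'

end Grading

section Coalgebra

variable {R K : Type*} [CommRing R] [AddCommGroup K] [Module R K]

/-- A differential graded coalgebra (coassociative, not assumed counital), with differential of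
degree `-1`. The differential is a coderivation with the Koszul sign:
`Δ (d x) = ∑ d x' ⊗ x'' + (-1) ^ |x'| x' ⊗ d x''`. -/
structure DGCoalgebra (𝒦 : ℤ → Submodule R K) [DirectSum.Decomposition 𝒦] where
  d : K →ₗ[R] K
  comul : K →ₗ[R] K ⊗[R] K
  d_mem : ∀ n x, x ∈ 𝒦 n → d x ∈ 𝒦 (n - 1)
  d_d : ∀ x, d (d x) = 0
  comul_mem : ∀ n x, x ∈ 𝒦 n →
    comul x ∈ ⨆ p : ℤ, LinearMap.range (TensorProduct.map (𝒦 p).subtype (𝒦 (n - p)).subtype)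
  coassoc : (TensorProduct.assoc R K K K).toLinearMap ∘ₗ comul.rTensor K ∘ₗ comul =
    comul.lTensor K ∘ₗ comul
  comul_d : comul ∘ₗ d = (d.rTensor K + TensorProduct.map (gradeInvol 𝒦) d) ∘ₗ comul

variable {𝒦 : ℤ → Submodule R K} [DirectSum.Decomposition 𝒦]

/-- The iterated comultiplication `K → K^{⊗ (n + 1)}`: the identity for `n = 0`, and
`(∇^{n + 1} ⊗ id) ∘ ∇` in the next step. -/
noncomputable def DGCoalgebra.iterComul (C : DGCoalgebra 𝒦) : (n : ℕ) → K →ₗ[R] ⨂[R]^(n + 1) K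
  | 0 => (PiTensorProduct.subsingletonEquiv (R := R) (s := fun _ : Fin 1 => K) 0).symm.toLinearMap
  | n + 1 => (TensorPower.mulEquiv (R := R) (M := K) (n := n + 1) (m := 1)).toLinearMap ∘ₗ
      TensorProduct.map (C.iterComul n)
        (PiTensorProduct.subsingletonEquiv (R := R) (s := fun _ : Fin 1 => K) 0).symm.toLinearMap ∘ₗ
      C.comul

/-- `μ ∘ (g₀ ⊗ ⋯ ⊗ gₙ) ∘ ∇^{n + 1} : K → N`. -/
noncomputable def DGCoalgebra.conv (C : DGCoalgebra 𝒦) {M N : Type*}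
    [AddCommGroup M] [Module R M] [AddCommGroup N] [Module R N] {n : ℕ}
    (μ : MultilinearMap R (fun _ : Fin (n + 1) => M) N) (g : Fin (n + 1) → K →ₗ[R] M) :
    K →ₗ[R] N :=
  PiTensorProduct.lift μ ∘ₗ PiTensorProduct.map g ∘ₗ C.iterComul n

end Coalgebra

section Contraction

variable {R M : Type*} [CommRing R] [AddCommGroup M] [Module R M]

/-- `(s a₁, …, s aₖ, m (aₖ₊₁, …, aₖ₊ⱼ₊₁), aₖ₊ⱼ₊₂, …, aₙ)`, a sequence of length `n - j`, where `m`
is the operation with `j + 1` arguments. -/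
def contractArgs (s : M →ₗ[R] M) (m : (n : ℕ) → MultilinearMap R (fun _ : Fin n => M) M)
    {n : ℕ} (k : Fin n) (j : Fin (n - k)) (a : Fin n → M) (i : Fin (n - j)) : M :=
  if i.val < k.val then s (a ⟨i, by omega⟩)
  else if i.val = k.val then m (j + 1) fun t => a ⟨k + t, by omega⟩
  else a ⟨i + j, by omega⟩

theorem contractArgs_update (s : M →ₗ[R] M)
    (m : (n : ℕ) → MultilinearMap R (fun _ : Fin n => M) M)
    {n : ℕ} (k : Fin n) (j : Fin (n - k)) (a : Fin n → M) (p : Fin n) :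
    ∃ (q : Fin (n - j)) (L : M →ₗ[R] M), ∀ x,
      contractArgs s m k j (Function.update a p x) =
        Function.update (contractArgs s m k j a) q (L x) := by
  by_cases h1 : p.val < k.val
  · refine ⟨⟨p, by omega⟩, s, fun x => ?_⟩
    funext i
    by_cases hi : i = ⟨p, by omega⟩
    · subst hi
      simp [contractArgs, h1]
    · have hi' : i.val ≠ p.val := fun h => hi (Fin.ext h)
      rw [Function.update_of_ne hi]
      unfold contractArgs
      split_ifs with c1 c2
      · rw [Function.update_of_ne (fun h => hi' (congrArg Fin.val h))]
      · congr 1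
        funext t
        rw [Function.update_of_ne]
        intro h
        have := congrArg Fin.val h
        simp at this
        omega
      · rw [Function.update_of_ne]
        intro h
        have := congrArg Fin.val h
        simp at this
        omega
  · by_cases h2 : p.val ≤ k.val + j.val
    · refine ⟨⟨k, by omega⟩, (m (j + 1)).toLinearMap (fun t => a ⟨k + t, by omega⟩)
        ⟨p - k, by omega⟩, fun x => ?_⟩
      funext i
      by_cases hi : i = ⟨k, by omega⟩
      · subst hi
        simp only [contractArgs, lt_self_iff_false, if_false, if_true, Function.update_self,
          MultilinearMap.toLinearMap_apply]
        congr 1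
        funext t
        by_cases ht : t = ⟨p - k, by omega⟩
        · subst ht
          rw [Function.update_self]
          have : (⟨k.val + (p.val - k.val), by omega⟩ : Fin n) = p := Fin.ext (by simp; omega)
          simp [this]
        · rw [Function.update_of_ne ht, Function.update_of_ne]
          intro h
          have := congrArg Fin.val h
          simp at this
          exact ht (Fin.ext (by simp; omega))
      · have hi' : i.val ≠ k.val := fun h => hi (Fin.ext h)
        rw [Function.update_of_ne hi]
        unfold contractArgs
        split_ifs with c1
        · rw [Function.update_of_ne]
          intro h
          have := congrArg Fin.val h
          simp at this
          omega
        · rw [Function.update_of_ne]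
          intro h
          have := congrArg Fin.val h
          simp at this
          omega
    · refine ⟨⟨p - j, by omega⟩, LinearMap.id, fun x => ?_⟩
      funext i
      by_cases hi : i = ⟨p - j, by omega⟩
      · subst hi
        have e : (⟨p.val - j.val + j.val, by omega⟩ : Fin n) = p := Fin.ext (by simp; omega)
        have c1 : ¬ (p.val - j.val < k.val) := by omega
        have c2 : ¬ (p.val - j.val = k.val) := by omega
        simp [contractArgs, c1, c2, e]
      · have hi' : i.val ≠ p.val - j.val := fun h => hi (Fin.ext h)
        rw [Function.update_of_ne hi]
        unfold contractArgs
        split_ifs with c1 c2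
        · rw [Function.update_of_ne]
          intro h
          have := congrArg Fin.val h
          simp at this
          omega
        · congr 1
          funext t
          rw [Function.update_of_ne]
          intro h
          have := congrArg Fin.val h
          simp at this
          omega
        · rw [Function.update_of_ne]
          intro h
          have := congrArg Fin.val h
          simp at this
          omega

/-- The multilinear map `a ↦ G (contractArgs s m k j a)`. -/
def contract (s : M →ₗ[R] M) (m : (n : ℕ) → MultilinearMap R (fun _ : Fin n => M) M)
    {N : Type*} [AddCommGroup N] [Module R N] {n : ℕ} (k : Fin n) (j : Fin (n - k))
    (G : MultilinearMap R (fun _ : Fin (n - j) => M) N) :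
    MultilinearMap R (fun _ : Fin n => M) N where
  toFun a := G (contractArgs s m k j a)
  map_update_add' {hd} a p x y := by
    obtain rfl : hd = instDecidableEqFin n := Subsingleton.elim _ _
    obtain ⟨q, L, h⟩ := contractArgs_update s m k j a p
    simp only [h, map_add, MultilinearMap.map_update_add]
  map_update_smul' {hd} a p r x := by
    obtain rfl : hd = instDecidableEqFin n := Subsingleton.elim _ _
    obtain ⟨q, L, h⟩ := contractArgs_update s m k j a p
    simp only [h, map_smul, MultilinearMap.map_update_smul]

end Contraction

section Blocks

variable {R M M' : Type*} [CommRing R] [AddCommGroup M] [Module R M]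
  [AddCommGroup M'] [Module R M']

/-- For a composition `n = k₁ + ⋯ + k_t`, the multilinear map
`a ↦ G (f (a₁, …, a_{k₁}), …, f (a_{n - k_t + 1}, …, aₙ))`. -/
def substBlocks (f : (n : ℕ) → MultilinearMap R (fun _ : Fin n => M) M')
    {N : Type*} [AddCommGroup N] [Module R N] {n : ℕ} (c : Composition n)
    (G : MultilinearMap R (fun _ : Fin c.length => M') N) :
    MultilinearMap R (fun _ : Fin n => M) N :=
  (G.compMultilinearMap fun i => f (c.blocksFun i)).domDomCongr c.blocksFinEquiv

theorem substBlocks_apply (f : (n : ℕ) → MultilinearMap R (fun _ : Fin n => M) M')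
    {N : Type*} [AddCommGroup N] [Module R N] {n : ℕ} (c : Composition n)
    (G : MultilinearMap R (fun _ : Fin c.length => M') N) (a : Fin n → M) :
    substBlocks f c G a = G fun i => f (c.blocksFun i) (a ∘ c.embedding i) := rfl

end Blocks

/-- An `A∞`-algebra: operations `m n` with `n ≥ 1` arguments, of degree `n - 2` (homological
grading), subject to
`∑ m (a₁, …, aₖ, m (aₖ₊₁, …, aₖ₊ⱼ), …, aₙ) = 0` with the Koszul signs of the suspension
`(-1) ^ (∑_{i ≤ k} (|aᵢ| + 1))`. -/
structure AInfAlgebra {R M : Type*} [CommRing R] [AddCommGroup M] [Module R M]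
    (𝓜 : ℤ → Submodule R M) [DirectSum.Decomposition 𝓜] where
  m : (n : ℕ) → MultilinearMap R (fun _ : Fin n => M) M
  m_zero : m 0 = 0
  m_mem : ∀ (n : ℕ) (deg : Fin n → ℤ) (a : Fin n → M), (∀ i, a i ∈ 𝓜 (deg i)) →
    m n a ∈ 𝓜 ((∑ i, deg i) + n - 2)
  relation : ∀ (n : ℕ) (a : Fin n → M),
    ∑ k : Fin n, ∑ j : Fin (n - k), contract (suspSign 𝓜) m k j (m (n - j)) a = 0

section Algebra

variable {R M M' : Type*} [CommRing R] [AddCommGroup M] [Module R M]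
  [AddCommGroup M'] [Module R M'] {𝓜 : ℤ → Submodule R M} [DirectSum.Decomposition 𝓜]
  {𝓜' : ℤ → Submodule R M'} [DirectSum.Decomposition 𝓜']

/-- The first operation, as a linear map. -/
def AInfAlgebra.m₁ (A : AInfAlgebra 𝓜) : M →ₗ[R] M :=
  (MultilinearMap.ofSubsingleton R M M (0 : Fin 1)).symm (A.m 1)

/-- The differential of the bar construction `B A = T^c(s M)`:
`[a₁, …, aₙ] ↦ ∑ ± [a₁, …, aₖ, m (aₖ₊₁, …, aₖ₊ⱼ), …, aₙ]`, with sign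
`(-1) ^ (∑_{i ≤ k} (|aᵢ| + 1))`. -/
noncomputable def AInfAlgebra.barD (A : AInfAlgebra 𝓜) :
    (⨁ n : ℕ, ⨂[R]^n M) →ₗ[R] ⨁ n : ℕ, ⨂[R]^n M :=
  DirectSum.toModule R ℕ _ fun n => PiTensorProduct.lift <|
    ∑ k : Fin n, ∑ j : Fin (n - k), contract (suspSign 𝓜) A.m k j
      ((DirectSum.lof R ℕ (fun n => ⨂[R]^n M) (n - j)).compMultilinearMap
        (PiTensorProduct.tprod R))

/-- A graded module is connected if it vanishes in degrees `≤ 0`. -/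
def IsConnected (𝓜 : ℤ → Submodule R M) : Prop :=
  ∀ n : ℤ, n ≤ 0 → 𝓜 n = ⊥

/-- A morphism of `A∞`-algebras: maps `f n` with `n ≥ 1` arguments, of degree `n - 1`
(homological grading, so of degree `0` on suspensions). -/
structure AInfHom (A : AInfAlgebra 𝓜) (A' : AInfAlgebra 𝓜') where
  f : (n : ℕ) → MultilinearMap R (fun _ : Fin n => M) M'
  f_zero : f 0 = 0
  f_mem : ∀ (n : ℕ) (deg : Fin n → ℤ) (a : Fin n → M), (∀ i, a i ∈ 𝓜 (deg i)) →
    f n a ∈ 𝓜' ((∑ i, deg i) + n - 1)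
  relation : ∀ (n : ℕ) (a : Fin n → M),
    ∑ k : Fin n, ∑ j : Fin (n - k), contract (suspSign 𝓜) A.m k j (f (n - j)) a =
      ∑ c : Composition n, substBlocks f c (A'.m c.length) a

variable {A : AInfAlgebra 𝓜} {A' : AInfAlgebra 𝓜'}

/-- The first component, as a linear map. -/
def AInfHom.f₁ (F : AInfHom A A') : M →ₗ[R] M' :=
  (MultilinearMap.ofSubsingleton R M M' (0 : Fin 1)).symm (F.f 1)

/-- The map of bar constructions
`[a₁, …, aₙ] ↦ ∑ [f (a₁, …, a_{k₁}), …, f (a_{n - k_t + 1}, …, aₙ)]`. -/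
noncomputable def AInfHom.bar (F : AInfHom A A') :
    (⨁ n : ℕ, ⨂[R]^n M) →ₗ[R] ⨁ n : ℕ, ⨂[R]^n M' :=
  DirectSum.toModule R ℕ _ fun n => PiTensorProduct.lift <|
    ∑ c : Composition n, substBlocks F.f c
      ((DirectSum.lof R ℕ (fun n => ⨂[R]^n M') c.length).compMultilinearMap
        (PiTensorProduct.tprod R))

/-- The bar construction of the morphism is a homology isomorphism. -/
def AInfHom.IsBarEquiv (F : AInfHom A A') : Prop :=
  IsHomologyIso A.barD A'.barD F.bar

/-- The first component of the morphism is a homology isomorphism. -/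
def AInfHom.IsQuasiIso (F : AInfHom A A') : Prop :=
  IsHomologyIso A.m₁ A'.m₁ F.f₁

end Algebra

section Twisting

variable {R K M M' : Type*} [CommRing R] [AddCommGroup K] [Module R K]
  [AddCommGroup M] [Module R M] [AddCommGroup M'] [Module R M']
  {𝒦 : ℤ → Submodule R K} [DirectSum.Decomposition 𝒦]
  {𝓜 : ℤ → Submodule R M} [DirectSum.Decomposition 𝓜]
  {𝓜' : ℤ → Submodule R M'} [DirectSum.Decomposition 𝓜']

/-- An `A∞`-twisting cochain: a map `φ : K → M` of degree `-1` with
`φ d = ∑_{i ≥ 1} mᵢ (φ ⊗ ⋯ ⊗ φ) ∇ⁱ`. When `M` is connected, the sum is finite on every element,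
because `φ` vanishes on elements of degree `≤ 1`. -/
structure IsTwistingCochain (C : DGCoalgebra 𝒦) (A : AInfAlgebra 𝓜) (φ : K →ₗ[R] M) : Prop where
  mem : ∀ n x, x ∈ 𝒦 n → φ x ∈ 𝓜 (n - 1)
  eq : ∀ x, φ (C.d x) = ∑ᶠ i : ℕ, C.conv (A.m (i + 1)) (fun _ => φ) x

/-- The family `φ, …, φ, c, ψ, …, ψ` with `k` entries `φ` and `l` entries `ψ`. The Koszul sign
`(-1) ^ (|x₁| + ⋯ + |xₖ|)` of moving `c` (of degree `1` as a map to the suspension) past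
`x₁ ⊗ ⋯ ⊗ xₖ` is put into the first `k` entries. -/
def homotopyFamily (𝒦 : ℤ → Submodule R K) [DirectSum.Decomposition 𝒦] (φ c ψ : K →ₗ[R] M)
    (k l : ℕ) (i : Fin (k + l + 1)) : K →ₗ[R] M :=
  if i.val < k then φ ∘ₗ gradeInvol 𝒦 else if i.val = k then c else ψ

/-- Equivalence `φ ∼ ψ` of `A∞`-twisting cochains: there is `c : K → M` of degree `0` with
`φ - ψ = c d + ∑_{k, l ≥ 0} m_{k + 1 + l} (φ^{⊗ k} ⊗ c ⊗ ψ^{⊗ l}) ∇^{k + 1 + l}`. -/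
structure TwistEquiv (C : DGCoalgebra 𝒦) (A : AInfAlgebra 𝓜) (φ ψ : K →ₗ[R] M) : Prop where
  left : IsTwistingCochain C A φ
  right : IsTwistingCochain C A ψ
  exists_homotopy : ∃ c : K →ₗ[R] M, (∀ n x, x ∈ 𝒦 n → c x ∈ 𝓜 n) ∧
    ∀ x, φ x - ψ x = c (C.d x) + ∑ᶠ p : ℕ × ℕ,
      C.conv (A.m (p.1 + p.2 + 1)) (homotopyFamily 𝒦 φ c ψ p.1 p.2) x

/-- `χ = F ∘ ψ = ∑_{i ≥ 1} fᵢ (ψ ⊗ ⋯ ⊗ ψ) ∇ⁱ`. -/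
def IsComposite (C : DGCoalgebra 𝒦) {A : AInfAlgebra 𝓜} {A' : AInfAlgebra 𝓜'} (F : AInfHom A A')
    (ψ : K →ₗ[R] M) (χ : K →ₗ[R] M') : Prop :=
  ∀ x, χ x = ∑ᶠ i : ℕ, C.conv (F.f (i + 1)) (fun _ => ψ) x

end Twisting

end AInf

/-! The cochain ψ and the homotopy c are constructed together by obstruction theory, one degree of K
at a time. A counit is adjoined to K (`DGCoalgebra.Aug`), so that linear maps from R ⊕ K to an
algebra form a unital ring under convolution. A degree -1 map g into a connected module vanishes
below degree 2, hence its geometric series `geom g` converges; it is the coalgebra map into the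
tensor coalgebra with component g. Its failure to commute with the differentials is the defect of g
sandwiched between two such maps (`postcomp_barDiff_sub_precomp_d`). A homotopy c likewise becomes
the coderivation `homotopyMap`. Sums over arbitrarily many operations thus turn into products in a
ring filtered by degree, where first-order calculus is available: the outer factors of a sandwich
are 1 plus terms of positive degree, so modulo higher degree only the middle factor counts
(`vanishBelow_sandwich_sub`).

Suppose that ψ and c are correct below degree n. On the piece of degree n the defects e of ψ and e'
of c satisfy m₁ e = 0 and m₁ e' = -f₁ e (`m₁_cochainDefect`, `m₁_homotopyDefect`), so (-e, e') takes
values in the cycles of the mapping cone of f₁. Changing ψ by w and c by y, both supported in degree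
n, changes e by m₁ w and e' by -(f₁ w + m₁ y). If the cone is acyclic in that degree
(`AInfHom.LiftsAt`), then freeness of the piece of degree n gives a linear choice of (w, y) removing
both defects (`ApproxLift.exists_next`). Every degree is changed only finitely often, so the
corrections have a limit (`exists_twistEquiv_of_liftsAt`).

It remains to show that the cone of f₁ is acyclic. Under (i) this is the standard property of a
homology isomorphism. Under (ii) it is proved by induction on the degree k
(`AInfHom.IsBarEquiv.liftsAt_of_lt`). With respect to word length, the leading part of the bar
differential is the linear differential coming from m₁, and the leading part of B(f) applies f₁ to
every letter. Letters have degree at least 2 in the suspension, so on words of length at least 2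
acyclicity of the cone of f₁ below degree k propagates two degrees further
(`AInfHom.exists_of_lenProj_eq`). This is a Künneth argument, made by splitting off the first letter
and tensoring with flat complexes row by row (`exists_of_rows`). A cone cycle of degree k, read as
words of length one, is bounded in the cone of B(f) by words of some finite length; their longest
parts are removed one length at a time (`AInfHom.exists_shorter`), until a bounding pair of letters
is left. -/

open scoped TensorProduct DirectSum

namespace AInf

open TensorProduct WithConv Coalgebra

set_option linter.unusedSectionVars false

/-! ### Convolution rings of graded coalgebras and their degree filtration -/

section Convolution

variable {R C : Type*} [CommRing R] [AddCommGroup C] [Module R C]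

/-- `g` is zero in degrees below `n`. -/
def VanishBelow (𝒞 : ℤ → Submodule R C) {N : Type*} [AddCommGroup N] [Module R N] (n : ℤ)
    (g : C →ₗ[R] N) : Prop :=
  ∀ j < n, ∀ x ∈ 𝒞 j, g x = 0

/-- `g` is homogeneous of degree `k`. -/
def HasDeg (𝒞 : ℤ → Submodule R C) {N : Type*} [AddCommGroup N] [Module R N]
    (𝒩 : ℤ → Submodule R N) (k : ℤ) (g : C →ₗ[R] N) : Prop :=
  ∀ n, ∀ x ∈ 𝒞 n, g x ∈ 𝒩 (n + k)

/-- Compatibility of a counital coalgebra with a family of graded pieces. -/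
structure IsGradedCoalgebra [Coalgebra R C] (𝒞 : ℤ → Submodule R C) : Prop where
  iSup_eq_top : ⨆ n, 𝒞 n = ⊤
  comul_mem : ∀ n, ∀ x ∈ 𝒞 n,
    comul (R := R) x ∈
      ⨆ p : ℤ, LinearMap.range (TensorProduct.map (𝒞 p).subtype (𝒞 (n - p)).subtype)
  counit_eq_zero : ∀ n, ∀ x ∈ 𝒞 n, n ≠ 0 → counit (R := R) x = 0

/-- The given supremum is spanned by pure tensors of homogeneous elements of complementary degrees.
This reduces statements about the coproduct of a homogeneous element to such tensors. -/
theorem tensor_homogeneous_induction {C D : Type*} [AddCommGroup C] [Module R C]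
    [AddCommGroup D] [Module R D] {𝒞 : ℤ → Submodule R C} {𝒟 : ℤ → Submodule R D} {n : ℤ}
    {t : C ⊗[R] D}
    (ht : t ∈ ⨆ p : ℤ, LinearMap.range (TensorProduct.map (𝒞 p).subtype (𝒟 (n - p)).subtype))
    {N : Type*} [AddCommGroup N] [Module R N] (L : C ⊗[R] D →ₗ[R] N) (Q : Submodule R N)
    (h : ∀ p q, p + q = n → ∀ a ∈ 𝒞 p, ∀ b ∈ 𝒟 q, L (a ⊗ₜ b) ∈ Q) : L t ∈ Q := by
  suffices hle : (⨆ p : ℤ, LinearMap.range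
      (TensorProduct.map (𝒞 p).subtype (𝒟 (n - p)).subtype)) ≤ Q.comap L from hle ht
  refine iSup_le fun p => ?_
  rintro _ ⟨s, rfl⟩
  induction s using TensorProduct.induction_on with
  | zero => simp
  | tmul a b => exact h p (n - p) (by ring) a a.2 b b.2
  | add s s' hs hs' => rw [map_add]; exact add_mem hs hs'

theorem linearMap_ext_of_iSup_eq_top {𝒞 : ℤ → Submodule R C} (htop : ⨆ n, 𝒞 n = ⊤)
    {N : Type*} [AddCommGroup N] [Module R N] {g h : C →ₗ[R] N}
    (H : ∀ n, ∀ x ∈ 𝒞 n, g x = h x) : g = h := by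
  have hle : (⨆ n, 𝒞 n) ≤ LinearMap.eqLocus g h := iSup_le fun n x hx => H n x hx
  ext x
  exact hle (htop ▸ Submodule.mem_top)

section Vanish

variable {𝒞 : ℤ → Submodule R C} {N N' : Type*} [AddCommGroup N] [Module R N]
  [AddCommGroup N'] [Module R N'] {m n : ℤ}

theorem VanishBelow.zero : VanishBelow 𝒞 n (0 : C →ₗ[R] N) := fun _ _ _ _ => rfl

theorem VanishBelow.add {g h : C →ₗ[R] N} (hg : VanishBelow 𝒞 n g) (hh : VanishBelow 𝒞 n h) :
    VanishBelow 𝒞 n (g + h) := fun j hj x hx => by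
  rw [LinearMap.add_apply, hg j hj x hx, hh j hj x hx, add_zero]

theorem VanishBelow.neg {g : C →ₗ[R] N} (hg : VanishBelow 𝒞 n g) : VanishBelow 𝒞 n (-g) :=
  fun j hj x hx => by rw [LinearMap.neg_apply, hg j hj x hx, neg_zero]

theorem VanishBelow.sub {g h : C →ₗ[R] N} (hg : VanishBelow 𝒞 n g) (hh : VanishBelow 𝒞 n h) :
    VanishBelow 𝒞 n (g - h) := sub_eq_add_neg g h ▸ hg.add hh.neg

theorem VanishBelow.mono {g : C →ₗ[R] N} (hg : VanishBelow 𝒞 n g) (hmn : m ≤ n) :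
    VanishBelow 𝒞 m g := fun j hj => hg j (hj.trans_le hmn)

theorem VanishBelow.comp_left {g : C →ₗ[R] N} (hg : VanishBelow 𝒞 n g) (L : N →ₗ[R] N') :
    VanishBelow 𝒞 n (L ∘ₗ g) := fun j hj x hx => by
  rw [LinearMap.comp_apply, hg j hj x hx, map_zero]

theorem VanishBelow.comp_right {g : C →ₗ[R] N} (hg : VanishBelow 𝒞 n g) {k : ℤ} {s : C →ₗ[R] C}
    (hs : HasDeg 𝒞 𝒞 k s) : VanishBelow 𝒞 (n - k) (g ∘ₗ s) := fun j hj x hx =>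
  hg (j + k) (by linarith) _ (hs j x hx)

/-- The degree filtration is separated. Equations between maps can therefore be checked modulo each
n, which replaces all limit arguments below. -/
theorem eq_zero_of_vanishBelow (htop : ⨆ n, 𝒞 n = ⊤) {g : C →ₗ[R] N}
    (h : ∀ n : ℕ, VanishBelow 𝒞 n g) : g = 0 :=
  linearMap_ext_of_iSup_eq_top htop fun j x hx =>
    h (j.toNat + 1) j (by have := Int.self_le_toNat j; push_cast; linarith) x hx

theorem HasDeg.vanishBelow {𝒩 : ℤ → Submodule R N} {k : ℤ} {g : C →ₗ[R] N}
    (hg : HasDeg 𝒞 𝒩 k g) (h𝒩 : ∀ j, j < n + k → 𝒩 j = ⊥) : VanishBelow 𝒞 n g :=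
  fun j hj x hx => by
    have := hg j x hx
    rwa [h𝒩 (j + k) (by linarith), Submodule.mem_bot] at this

theorem HasDeg.add {𝒩 : ℤ → Submodule R N} {k : ℤ} {g h : C →ₗ[R] N}
    (hg : HasDeg 𝒞 𝒩 k g) (hh : HasDeg 𝒞 𝒩 k h) : HasDeg 𝒞 𝒩 k (g + h) :=
  fun n x hx => add_mem (hg n x hx) (hh n x hx)

theorem HasDeg.sub {𝒩 : ℤ → Submodule R N} {k : ℤ} {g h : C →ₗ[R] N}
    (hg : HasDeg 𝒞 𝒩 k g) (hh : HasDeg 𝒞 𝒩 k h) : HasDeg 𝒞 𝒩 k (g - h) :=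
  fun n x hx => sub_mem (hg n x hx) (hh n x hx)

theorem HasDeg.zero {𝒩 : ℤ → Submodule R N} {k : ℤ} : HasDeg 𝒞 𝒩 k (0 : C →ₗ[R] N) :=
  fun _ _ _ => zero_mem _

theorem HasDeg.comp {𝒩 : ℤ → Submodule R N} {𝒩' : ℤ → Submodule R N'} {k l : ℤ}
    {g : C →ₗ[R] N} {h : N →ₗ[R] N'} (hh : HasDeg 𝒩 𝒩' l h) (hg : HasDeg 𝒞 𝒩 k g) :
    HasDeg 𝒞 𝒩' (k + l) (h ∘ₗ g) := fun n x hx => by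
  rw [← add_assoc]; exact hh _ _ (hg n x hx)

theorem HasDeg.congr {𝒩 : ℤ → Submodule R N} {k l : ℤ} {g : C →ₗ[R] N}
    (hg : HasDeg 𝒞 𝒩 k g) (h : k = l) : HasDeg 𝒞 𝒩 l g := h ▸ hg

end Vanish

section Ring

variable [Coalgebra R C] {𝒞 : ℤ → Submodule R C} (h𝒞 : IsGradedCoalgebra 𝒞)
  {A : Type*} [Ring A] [Algebra R A]

include h𝒞

/-- If a + b < p + q, then a < p or b < q. -/
theorem VanishBelow.mul {p q : ℤ} {g h : WithConv (C →ₗ[R] A)} (hg : VanishBelow 𝒞 p g.ofConv)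
    (hh : VanishBelow 𝒞 q h.ofConv) : VanishBelow 𝒞 (p + q) (g * h).ofConv := by
  intro j hj x hx
  have := tensor_homogeneous_induction (h𝒞.comul_mem j x hx)
    (LinearMap.mul' R A ∘ₗ TensorProduct.map g.ofConv h.ofConv) ⊥ fun a b hab y hy z hz => by
      rw [Submodule.mem_bot, LinearMap.comp_apply, TensorProduct.map_tmul, LinearMap.mul'_apply]
      by_cases ha : a < p
      · rw [hg a ha y hy, zero_mul]
      · rw [hh b (by linarith) z hz, mul_zero]
  simpa using this

theorem VanishBelow.one : VanishBelow 𝒞 0 (1 : WithConv (C →ₗ[R] A)).ofConv := by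
  intro j hj x hx
  rw [LinearMap.convOne_apply, h𝒞.counit_eq_zero j x hx hj.ne, map_zero]

theorem VanishBelow.pow {g : WithConv (C →ₗ[R] A)} (hg : VanishBelow 𝒞 1 g.ofConv) (n : ℕ) :
    VanishBelow 𝒞 n (g ^ n).ofConv := by
  induction n with
  | zero => simpa using VanishBelow.one h𝒞
  | succ n ih => rw [pow_succ]; exact_mod_cast ih.mul h𝒞 hg

theorem HasDeg.mul {𝒜 : ℤ → Submodule R A}
    (h𝒜 : ∀ p q, ∀ a ∈ 𝒜 p, ∀ b ∈ 𝒜 q, a * b ∈ 𝒜 (p + q)) {k l : ℤ}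
    {g h : WithConv (C →ₗ[R] A)} (hg : HasDeg 𝒞 𝒜 k g.ofConv)
    (hh : HasDeg 𝒞 𝒜 l h.ofConv) : HasDeg 𝒞 𝒜 (k + l) (g * h).ofConv := by
  intro n x hx
  refine tensor_homogeneous_induction (h𝒞.comul_mem n x hx)
    (LinearMap.mul' R A ∘ₗ TensorProduct.map g.ofConv h.ofConv) _ fun a b hab y hy z hz => ?_
  rw [LinearMap.comp_apply, TensorProduct.map_tmul, LinearMap.mul'_apply]
  have := h𝒜 _ _ _ (hg a y hy) _ (hh b z hz)
  rwa [show a + k + (b + l) = n + (k + l) by rw [← hab]; ring] at this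

theorem HasDeg.one {𝒜 : ℤ → Submodule R A} (h1 : (1 : A) ∈ 𝒜 0) :
    HasDeg 𝒞 𝒜 0 (1 : WithConv (C →ₗ[R] A)).ofConv := by
  intro n x hx
  rw [LinearMap.convOne_apply]
  by_cases hn : n = 0
  · subst hn
    rw [Algebra.algebraMap_eq_smul_one]
    exact Submodule.smul_mem _ _ (by simpa using h1)
  · rw [h𝒞.counit_eq_zero n x hx hn, map_zero]
    exact zero_mem _

/-- Geometric series converge for the filtration by degree. -/
theorem exists_inverse_one_sub {g : WithConv (C →ₗ[R] A)} (hg : VanishBelow 𝒞 1 g.ofConv) :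
    ∃ G : WithConv (C →ₗ[R] A), (1 - g) * G = 1 ∧ G * (1 - g) = 1 ∧
      ∀ n : ℕ, VanishBelow 𝒞 n (G - ∑ i ∈ Finset.range n, g ^ i).ofConv := by
  -- The power of exponent i vanishes below degree i, and x has components in finitely many degrees
  -- only; so the series is a finite sum at each element.
  have hfin : ∀ x, ∃ n : ℕ, ∀ i ≥ n, (g ^ i) x = 0 := by
    intro x
    have hx : x ∈ ⨆ n, 𝒞 n := h𝒞.iSup_eq_top ▸ Submodule.mem_top
    induction hx using Submodule.iSup_induction' with
    | mem j x hx =>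
      exact ⟨j.toNat + 1, fun i hi => VanishBelow.pow h𝒞 hg i j (by omega) x hx⟩
    | zero => exact ⟨0, fun i _ => map_zero _⟩
    | add x y _ _ ihx ihy =>
      obtain ⟨a, ha⟩ := ihx
      obtain ⟨b, hb⟩ := ihy
      refine ⟨max a b, fun i hi => ?_⟩
      rw [map_add, ha i (le_trans (le_max_left _ _) hi), hb i (le_trans (le_max_right _ _) hi),
        add_zero]
  have hsupp : ∀ x, (Function.support fun i => (g ^ i) x).Finite := by
    intro x
    obtain ⟨n, hn⟩ := hfin x
    refine (Finset.range n).finite_toSet.subset fun i hi => ?_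
    by_contra h
    exact hi (hn i (by simpa using h))
  let G : WithConv (C →ₗ[R] A) := toConv
    { toFun := fun x => ∑ᶠ i, (g ^ i) x
      map_add' := fun x y => by
        simp only [map_add]
        exact finsum_add_distrib (hsupp x) (hsupp y)
      map_smul' := fun r x => by
        simp only [map_smul, RingHom.id_apply]
        rw [smul_finsum' _ (hsupp x)] }
  have hG : ∀ n : ℕ, VanishBelow 𝒞 n (G - ∑ i ∈ Finset.range n, g ^ i).ofConv := by
    intro n j hj x hx
    have h1 : G x = ∑ i ∈ Finset.range n, (g ^ i) x := by
      refine finsum_eq_sum_of_support_subset _ fun i hi => ?_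
      by_contra h
      refine hi (VanishBelow.pow h𝒞 hg i j (hj.trans_le ?_) x hx)
      simpa using h
    rw [ofConv_sub, LinearMap.sub_apply, ofConv_sum, LinearMap.sum_apply, h1, sub_self]
  have h0 : VanishBelow 𝒞 0 (1 - g).ofConv := (VanishBelow.one h𝒞).sub (hg.mono zero_le_one)
  refine ⟨G, ?_, ?_, hG⟩
  · rw [← sub_eq_zero]
    refine WithConv.ext (eq_zero_of_vanishBelow h𝒞.iSup_eq_top fun n => ?_)
    -- The partial sum inverts `1 - g` up to `g ^ n`; this error and the tail of the series both
    -- vanish below n.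
    have : (1 - g) * G - 1 = (1 - g) * (G - ∑ i ∈ Finset.range n, g ^ i) - g ^ n := by
      rw [mul_sub, mul_neg_geom_sum]; abel
    rw [this]
    exact ((h0.mul h𝒞 (hG n)).mono (by simp)).sub (VanishBelow.pow h𝒞 hg n)
  · rw [← sub_eq_zero]
    refine WithConv.ext (eq_zero_of_vanishBelow h𝒞.iSup_eq_top fun n => ?_)
    have : G * (1 - g) - 1 = (G - ∑ i ∈ Finset.range n, g ^ i) * (1 - g) - g ^ n := by
      rw [sub_mul, geom_sum_mul_neg]; abel
    rw [this]
    exact (((hG n).mul h𝒞 h0).mono (by simp)).sub (VanishBelow.pow h𝒞 hg n)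

theorem isUnit_one_sub {g : WithConv (C →ₗ[R] A)} (hg : VanishBelow 𝒞 1 g.ofConv) :
    IsUnit (1 - g) := by
  obtain ⟨G, h1, h2, -⟩ := exists_inverse_one_sub h𝒞 hg
  exact ⟨⟨1 - g, G, h1, h2⟩, rfl⟩

theorem vanishBelow_inverse_one_sub_sub {g : WithConv (C →ₗ[R] A)}
    (hg : VanishBelow 𝒞 1 g.ofConv) (n : ℕ) :
    VanishBelow 𝒞 n (Ring.inverse (1 - g) - ∑ i ∈ Finset.range n, g ^ i).ofConv := by
  obtain ⟨G, h1, h2, h3⟩ := exists_inverse_one_sub h𝒞 hg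
  have : Ring.inverse (1 - g) = G := by
    calc Ring.inverse (1 - g) = Ring.inverse (1 - g) * ((1 - g) * G) := by rw [h1, mul_one]
      _ = G := by rw [Ring.inverse_mul_cancel_left _ _ (isUnit_one_sub h𝒞 hg)]
  rw [this]
  exact h3 n

end Ring

section Composition

variable [Coalgebra R C] {A B : Type*} [Ring A] [Algebra R A] [Ring B] [Algebra R B]

/-- Postcomposition with an algebra homomorphism, as a ring homomorphism. -/
noncomputable def convMap (h : A →ₐ[R] B) : WithConv (C →ₗ[R] A) →+* WithConv (C →ₗ[R] B) where
  toFun g := toConv (h.toLinearMap ∘ₗ g.ofConv)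
  map_one' := by ext x; simp
  map_mul' f g := WithConv.ext (LinearMap.algHom_comp_convMul_distrib h f g)
  map_zero' := by ext x; simp
  map_add' f g := by ext x; simp

@[simp] theorem convMap_apply (h : A →ₐ[R] B) (g : WithConv (C →ₗ[R] A)) (x : C) :
    convMap h g x = h (g x) := rfl

theorem ofConv_convMap (h : A →ₐ[R] B) (g : WithConv (C →ₗ[R] A)) :
    (convMap h g).ofConv = h.toLinearMap ∘ₗ g.ofConv := rfl

end Composition

end Convolution


/-! ### The tensor algebra with the deconcatenation coproduct -/

section TensorCoalgebra

variable (R : Type*) {M : Type*} [CommRing R] [AddCommGroup M] [Module R M]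

/-- The product of a list of vectors in the tensor algebra. -/
noncomputable def word (l : List M) : TensorAlgebra R M := (l.map (TensorAlgebra.ι R)).prod

@[simp] theorem word_nil : word R ([] : List M) = 1 := rfl

@[simp] theorem word_cons (a : M) (l : List M) :
    word R (a :: l) = TensorAlgebra.ι R a * word R l := by simp [word]

theorem word_append (l l' : List M) : word R (l ++ l') = word R l * word R l' := by
  simp [word]

variable {R}

theorem span_range_word : Submodule.span R (Set.range (word R (M := M))) = ⊤ := by
  have key : ∀ x : TensorAlgebra R M, ∀ y ∈ Submodule.span R (Set.range (word R (M := M))),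
      x * y ∈ Submodule.span R (Set.range (word R (M := M))) := by
    intro x
    induction x using TensorAlgebra.induction with
    | algebraMap r =>
      intro y hy
      rw [← Algebra.smul_def]
      exact Submodule.smul_mem _ _ hy
    | ι a =>
      intro y hy
      have : Submodule.span R (Set.range (word R (M := M))) ≤
          (Submodule.span R (Set.range (word R (M := M)))).comap
            (LinearMap.mulLeft R (TensorAlgebra.ι R a)) := by
        rw [Submodule.span_le]
        rintro _ ⟨l, rfl⟩
        exact Submodule.subset_span ⟨a :: l, word_cons R a l⟩
      exact this hy
    | mul a b ha hb =>
      intro y hy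
      rw [mul_assoc]
      exact ha _ (hb _ hy)
    | add a b ha hb =>
      intro y hy
      rw [add_mul]
      exact add_mem (ha _ hy) (hb _ hy)
  rw [eq_top_iff]
  intro x _
  simpa using key x 1 (Submodule.subset_span ⟨[], rfl⟩)

theorem linearMap_ext_word {N : Type*} [AddCommGroup N] [Module R N]
    {g h : TensorAlgebra R M →ₗ[R] N} (H : ∀ l, g (word R l) = h (word R l)) : g = h :=
  LinearMap.ext_on_range span_range_word H

theorem word_induction {N : Type*} [AddCommGroup N] [Module R N]
    {g h : TensorAlgebra R M →ₗ[R] N} (h1 : g 1 = h 1)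
    (H : ∀ a w, g w = h w → g (TensorAlgebra.ι R a * w) = h (TensorAlgebra.ι R a * w)) :
    g = h := by
  refine linearMap_ext_word fun l => ?_
  induction l with
  | nil => exact h1
  | cons a l ih => rw [word_cons]; exact H a _ ih

/-- The operators `(w, t) ↦ (a w, 1 ⊗ a w + (a ⊗ 1) t)` that build deconcatenation letter by
letter. -/
noncomputable def deconcatStep : M →ₗ[R] Module.End R
    (TensorAlgebra R M × (TensorAlgebra R M ⊗[R] TensorAlgebra R M)) where
  toFun a := LinearMap.prod (LinearMap.mulLeft R (TensorAlgebra.ι R a) ∘ₗ LinearMap.fst R _ _)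
    ((TensorProduct.mk R _ _ 1) ∘ₗ LinearMap.mulLeft R (TensorAlgebra.ι R a) ∘ₗ
        LinearMap.fst R _ _ +
      LinearMap.mulLeft R (TensorAlgebra.ι R a ⊗ₜ[R] (1 : TensorAlgebra R M)) ∘ₗ
        LinearMap.snd R _ _)
  map_add' a b := by
    refine LinearMap.ext fun x => Prod.ext ?_ ?_
    · simp [add_mul]
    · simp [add_mul, TensorProduct.tmul_add, TensorProduct.add_tmul]; abel
  map_smul' r a := by
    refine LinearMap.ext fun x => Prod.ext ?_ ?_
    · simp
    · simp [← TensorProduct.smul_tmul']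

theorem deconcatStep_apply (a : M)
    (x : TensorAlgebra R M × (TensorAlgebra R M ⊗[R] TensorAlgebra R M)) :
    deconcatStep a x = (TensorAlgebra.ι R a * x.1,
      1 ⊗ₜ (TensorAlgebra.ι R a * x.1) + (TensorAlgebra.ι R a ⊗ₜ 1) * x.2) := rfl

/-- The deconcatenation coproduct on the tensor algebra. -/
noncomputable def deconcat : TensorAlgebra R M →ₗ[R] TensorAlgebra R M ⊗[R] TensorAlgebra R M :=
  LinearMap.snd R _ _ ∘ₗ LinearMap.applyₗ (1, 1 ⊗ₜ[R] 1) ∘ₗ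
    (TensorAlgebra.lift R (deconcatStep (R := R) (M := M))).toLinearMap

/-- The recursion for cutting a word needs the word itself, so the first coordinate carries it
along. -/
theorem lift_deconcatStep_fst (w : TensorAlgebra R M) :
    (TensorAlgebra.lift R (deconcatStep (R := R) (M := M)) w (1, 1 ⊗ₜ[R] 1)).1 = w := by
  have : LinearMap.fst R _ _ ∘ₗ LinearMap.applyₗ (1, 1 ⊗ₜ[R] 1) ∘ₗ
      (TensorAlgebra.lift R (deconcatStep (R := R) (M := M))).toLinearMap = LinearMap.id := by
    refine word_induction (by simp) fun a w h => ?_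
    simp only [LinearMap.comp_apply, AlgHom.toLinearMap_apply, LinearMap.applyₗ_apply_apply,
      map_mul, TensorAlgebra.lift_ι_apply, LinearMap.id_apply, LinearMap.fst_apply,
      Module.End.mul_apply] at h ⊢
    rw [deconcatStep_apply, h]
  exact LinearMap.congr_fun this w

@[simp] theorem deconcat_one : deconcat (1 : TensorAlgebra R M) = 1 ⊗ₜ 1 := by
  simp [deconcat]

theorem deconcat_ι_mul (a : M) (w : TensorAlgebra R M) :
    deconcat (TensorAlgebra.ι R a * w) =
      1 ⊗ₜ (TensorAlgebra.ι R a * w) + (TensorAlgebra.ι R a ⊗ₜ 1) * deconcat w := by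
  have := lift_deconcatStep_fst w
  simp only [deconcat, LinearMap.comp_apply, AlgHom.toLinearMap_apply,
    LinearMap.applyₗ_apply_apply, map_mul, TensorAlgebra.lift_ι_apply, LinearMap.snd_apply,
    Module.End.mul_apply]
  rw [deconcatStep_apply, this]

@[simp] theorem deconcat_ι (a : M) :
    deconcat (TensorAlgebra.ι R a) = 1 ⊗ₜ TensorAlgebra.ι R a + TensorAlgebra.ι R a ⊗ₜ 1 := by
  simpa using deconcat_ι_mul a (1 : TensorAlgebra R M)

/-- Cutting a product: cut the left factor or the right factor; the cut between them is counted
twice. -/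
theorem deconcat_mul (x y : TensorAlgebra R M) :
    deconcat (x * y) = deconcat x * (1 ⊗ₜ y) + (x ⊗ₜ 1) * deconcat y - x ⊗ₜ y := by
  have : deconcat ∘ₗ LinearMap.mulRight R y =
      LinearMap.mulRight R ((1 : TensorAlgebra R M) ⊗ₜ y) ∘ₗ deconcat +
        LinearMap.mulRight R (deconcat y) ∘ₗ (TensorProduct.mk R _ (TensorAlgebra R M)).flip 1 -
        (TensorProduct.mk R _ _).flip y := by
    refine word_induction (by simp [← Algebra.TensorProduct.one_def]) fun a w h => ?_
    simp only [LinearMap.comp_apply, LinearMap.mulRight_apply, LinearMap.sub_apply,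
      LinearMap.add_apply, LinearMap.flip_apply, TensorProduct.mk_apply] at h ⊢
    rw [mul_assoc, deconcat_ι_mul, deconcat_ι_mul, h, add_mul, mul_sub, mul_add]
    simp only [Algebra.TensorProduct.tmul_mul_tmul, one_mul, mul_assoc]
    rw [← mul_assoc (TensorAlgebra.ι R a ⊗ₜ[R] 1) (w ⊗ₜ[R] 1)]
    simp only [Algebra.TensorProduct.tmul_mul_tmul, one_mul]
    abel
  exact LinearMap.congr_fun this x

/-- Induction on words: `hl` and `hr` record how the two iterated coproducts change when a letter is
put in front. The remaining terms are those in which the first cut is made before this letter. -/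
theorem deconcat_coassoc :
    (TensorProduct.assoc R (TensorAlgebra R M) (TensorAlgebra R M) (TensorAlgebra R M)) ∘ₗ
      deconcat.rTensor (TensorAlgebra R M) ∘ₗ deconcat =
    deconcat.lTensor (TensorAlgebra R M) ∘ₗ deconcat := by
  refine word_induction (by simp) fun a w h => ?_
  simp only [LinearMap.comp_apply, LinearEquiv.coe_coe] at h ⊢
  have hl : ∀ t : TensorAlgebra R M ⊗[R] TensorAlgebra R M,
      deconcat.lTensor (TensorAlgebra R M) ((TensorAlgebra.ι R a ⊗ₜ 1) * t) =
        (TensorAlgebra.ι R a ⊗ₜ 1) * deconcat.lTensor (TensorAlgebra R M) t := by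
    intro t
    induction t using TensorProduct.induction_on with
    | zero => simp
    | tmul x y =>
      rw [Algebra.TensorProduct.tmul_mul_tmul, LinearMap.lTensor_tmul, LinearMap.lTensor_tmul,
        Algebra.TensorProduct.tmul_mul_tmul, one_mul, one_mul]
    | add s t hs ht => rw [mul_add, map_add, hs, ht, map_add, mul_add]
  have hr : ∀ t : TensorAlgebra R M ⊗[R] TensorAlgebra R M,
      TensorProduct.assoc R _ _ _
        (deconcat.rTensor (TensorAlgebra R M) ((TensorAlgebra.ι R a ⊗ₜ 1) * t)) =
        1 ⊗ₜ ((TensorAlgebra.ι R a ⊗ₜ 1) * t) + (TensorAlgebra.ι R a ⊗ₜ 1) *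
          TensorProduct.assoc R _ _ _ (deconcat.rTensor (TensorAlgebra R M) t) := by
    intro t
    induction t using TensorProduct.induction_on with
    | zero => simp
    | tmul x y =>
      rw [Algebra.TensorProduct.tmul_mul_tmul, LinearMap.rTensor_tmul, LinearMap.rTensor_tmul,
        deconcat_ι_mul, TensorProduct.add_tmul, map_add, one_mul, TensorProduct.assoc_tmul]
      congr 1
      induction deconcat x using TensorProduct.induction_on with
      | zero => simp
      | tmul u v => simp
      | add u v hu hv => rw [mul_add, add_tmul, map_add, hu, hv, add_tmul, map_add, mul_add]
    | add s t hs ht =>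
      rw [mul_add, map_add, map_add, hs, ht, map_add, map_add, mul_add, tmul_add]
      abel
  rw [deconcat_ι_mul, map_add, map_add, map_add, hl, hr, h]
  simp only [LinearMap.rTensor_tmul, LinearMap.lTensor_tmul, deconcat_one, deconcat_ι_mul,
    TensorProduct.assoc_tmul, tmul_add]
  abel

noncomputable instance tensorAlgebraCoalgebra : Coalgebra R (TensorAlgebra R M) where
  comul := deconcat
  counit := TensorAlgebra.algebraMapInv.toLinearMap
  coassoc := deconcat_coassoc
  rTensor_counit_comp_comul := by
    refine word_induction (by simp) fun a w h => ?_
    simp only [LinearMap.comp_apply] at h ⊢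
    rw [deconcat_ι_mul, map_add]
    have : ∀ t : TensorAlgebra R M ⊗[R] TensorAlgebra R M,
        (TensorAlgebra.algebraMapInv.toLinearMap.rTensor _) ((TensorAlgebra.ι R a ⊗ₜ 1) * t) =
          0 := by
      intro t
      induction t using TensorProduct.induction_on with
      | zero => simp
      | tmul x y => simp [TensorAlgebra.algebraMapInv]
      | add s t hs ht => rw [mul_add, map_add, hs, ht, add_zero]
    rw [this]
    simp
  lTensor_counit_comp_comul := by
    refine word_induction (by simp) fun a w h => ?_
    simp only [LinearMap.comp_apply] at h ⊢
    rw [deconcat_ι_mul, map_add]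
    have : ∀ t : TensorAlgebra R M ⊗[R] TensorAlgebra R M,
        (TensorAlgebra.algebraMapInv.toLinearMap.lTensor _) ((TensorAlgebra.ι R a ⊗ₜ 1) * t) =
          (TensorAlgebra.ι R a ⊗ₜ 1) *
            (TensorAlgebra.algebraMapInv.toLinearMap.lTensor (TensorAlgebra R M)) t := by
      intro t
      induction t using TensorProduct.induction_on with
      | zero => simp
      | tmul x y => simp [TensorAlgebra.algebraMapInv]
      | add s t hs ht => rw [mul_add, map_add, hs, ht, map_add, mul_add]
    rw [this, h]
    simp [TensorAlgebra.algebraMapInv]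

theorem comul_tensorAlgebra : (comul : TensorAlgebra R M →ₗ[R] _) = deconcat := rfl

theorem counit_tensorAlgebra :
    (counit : TensorAlgebra R M →ₗ[R] R) = TensorAlgebra.algebraMapInv.toLinearMap := rfl

@[simp] theorem counit_one : counit (R := R) (1 : TensorAlgebra R M) = 1 := by
  simp [counit_tensorAlgebra]

@[simp] theorem counit_ι (a : M) : counit (R := R) (TensorAlgebra.ι R a) = 0 := by
  simp [counit_tensorAlgebra, TensorAlgebra.algebraMapInv]

@[simp] theorem counit_ι_mul (a : M) (w : TensorAlgebra R M) :
    counit (R := R) (TensorAlgebra.ι R a * w) = 0 := by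
  simp [counit_tensorAlgebra, TensorAlgebra.algebraMapInv]

/-- The operators `(r, m) ↦ (0, r a)` on `R × M`. -/
noncomputable def letterStep : M →ₗ[R] Module.End R (R × M) where
  toFun a := LinearMap.inr R R M ∘ₗ LinearMap.toSpanSingleton R M a ∘ₗ LinearMap.fst R R M
  map_add' a b := by ext <;> simp
  map_smul' r a := by ext <;> simp

theorem letterStep_apply (a : M) (x : R × M) : letterStep a x = (0, x.1 • a) := rfl

/-- The projection onto words of length one. -/
noncomputable def letter : TensorAlgebra R M →ₗ[R] M :=
  LinearMap.snd R R M ∘ₗ LinearMap.applyₗ (1, 0) ∘ₗ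
    (TensorAlgebra.lift R (letterStep (R := R) (M := M))).toLinearMap

@[simp] theorem letter_one : letter (1 : TensorAlgebra R M) = 0 := by
  simp [letter]

theorem letter_ι_mul (a : M) (w : TensorAlgebra R M) :
    letter (TensorAlgebra.ι R a * w) = counit (R := R) w • a := by
  have : LinearMap.fst R R M ∘ₗ LinearMap.applyₗ (1, 0) ∘ₗ
      (TensorAlgebra.lift R (letterStep (R := R) (M := M))).toLinearMap = counit := by
    refine word_induction (by simp) fun b w _ => ?_
    simp [letterStep_apply]
  rw [← this]
  simp [letter, letterStep_apply]

@[simp] theorem letter_ι (a : M) : letter (TensorAlgebra.ι R a) = a := by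
  simpa using letter_ι_mul a (1 : TensorAlgebra R M)

end TensorCoalgebra


/-! ### Coalgebra maps into the tensor coalgebra as geometric series -/

section Geometric

variable {R C M : Type*} [CommRing R] [AddCommGroup C] [Module R C]
  [AddCommGroup M] [Module R M]

/-- A linear map to `M`, as a map to the words of length one. -/
noncomputable def letterMap (g : C →ₗ[R] M) : WithConv (C →ₗ[R] TensorAlgebra R M) :=
  toConv (TensorAlgebra.ι R ∘ₗ g)

@[simp] theorem letterMap_apply (g : C →ₗ[R] M) (x : C) :
    letterMap g x = TensorAlgebra.ι R (g x) := rfl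

theorem letterMap_sub (g h : C →ₗ[R] M) : letterMap (g - h) = letterMap g - letterMap h := by
  ext x; simp

variable [Coalgebra R C]

/-- The sum of the convolution powers of `g`: the coalgebra map to the tensor coalgebra with
component `g`. -/
noncomputable def geom (g : C →ₗ[R] M) : WithConv (C →ₗ[R] TensorAlgebra R M) :=
  Ring.inverse (1 - letterMap g)

section

variable {g : C →ₗ[R] M} (hg : IsUnit (1 - letterMap g))

include hg

theorem one_sub_mul_geom : (1 - letterMap g) * geom g = 1 := Ring.mul_inverse_cancel _ hg

theorem geom_mul_one_sub : geom g * (1 - letterMap g) = 1 := Ring.inverse_mul_cancel _ hg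

theorem geom_eq : geom g = 1 + letterMap g * geom g := by
  have := one_sub_mul_geom hg
  rw [sub_mul, one_mul, sub_eq_iff_eq_add] at this
  exact this

theorem eq_geom_of_mul_eq_one {G : WithConv (C →ₗ[R] TensorAlgebra R M)}
    (h : (1 - letterMap g) * G = 1) : G = geom g := by
  calc G = (geom g * (1 - letterMap g)) * G := by rw [geom_mul_one_sub hg, one_mul]
    _ = geom g := by rw [mul_assoc, h, mul_one]

/-- The fixed point equation has a unique solution because `1 - letterMap g` is a unit. Composites
and sign twists of geometric series are identified in this way. -/
theorem eq_geom {G : WithConv (C →ₗ[R] TensorAlgebra R M)}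
    (h : G = 1 + letterMap g * G) : G = geom g :=
  eq_geom_of_mul_eq_one hg (by rw [sub_mul, one_mul, sub_eq_iff_eq_add]; exact h)

/-- Resolvent identity: a⁻¹ - b⁻¹ = a⁻¹ (b - a) b⁻¹. -/
theorem geom_sub_geom {h : C →ₗ[R] M} (hh : IsUnit (1 - letterMap h)) :
    geom g - geom h = geom g * letterMap (g - h) * geom h := by
  have h1 := geom_mul_one_sub hg
  have h2 := one_sub_mul_geom hh
  calc geom g - geom h = geom g * ((1 - letterMap h) * geom h) -
        (geom g * (1 - letterMap g)) * geom h := by rw [h1, h2, mul_one, one_mul]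
    _ = geom g * letterMap (g - h) * geom h := by
      simp only [letterMap_sub, mul_sub, sub_mul, mul_one, one_mul, mul_assoc]
      abel

end

/-! ### Deconcatenation of convolution products -/

/-- Compatibility with coproducts becomes an equation between products in the convolution ring with
values in the tensor product algebra, where it can be solved algebraically. -/
theorem convMap_includeLeft_mul_convMap_includeRight {A B : Type*} [Ring A] [Algebra R A]
    [Ring B] [Algebra R B] (P : WithConv (C →ₗ[R] A)) (Q : WithConv (C →ₗ[R] B)) :
    convMap (Algebra.TensorProduct.includeLeft (R := R) (S := R) (A := A) (B := B)) P *
      convMap (Algebra.TensorProduct.includeRight (R := R) (A := A) (B := B)) Q =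
    toConv (TensorProduct.map P.ofConv Q.ofConv ∘ₗ comul) := by
  refine WithConv.ext ?_
  rw [LinearMap.convMul_def, ofConv_toConv, ← LinearMap.comp_assoc]
  refine congrArg (· ∘ₗ _) ?_
  refine TensorProduct.ext' fun x y => ?_
  simp [convMap]

/-- The copy of `P` in the left factor of `T ⊗ T`. -/
local notation "𝔩" => convMap (Algebra.TensorProduct.includeLeft (R := R) (S := R)
  (A := TensorAlgebra R M) (B := TensorAlgebra R M))

/-- The copy of `P` in the right factor of `T ⊗ T`. -/
local notation "𝔯" => convMap (Algebra.TensorProduct.includeRight (R := R)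
  (A := TensorAlgebra R M) (B := TensorAlgebra R M))

theorem deconcat_comp_mul (g h : WithConv (C →ₗ[R] TensorAlgebra R M)) :
    toConv (deconcat ∘ₗ (g * h).ofConv) =
      toConv (deconcat ∘ₗ g.ofConv) * 𝔯 h + 𝔩 g * toConv (deconcat ∘ₗ h.ofConv) -
        𝔩 g * 𝔯 h := by
  refine WithConv.ext ?_
  simp only [LinearMap.convMul_def, ofConv_add, ofConv_sub, ofConv_toConv]
  rw [← LinearMap.comp_assoc, ← LinearMap.comp_assoc, ← LinearMap.comp_assoc, ← LinearMap.comp_assoc,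
    ← LinearMap.comp_assoc, ← LinearMap.add_comp, ← LinearMap.sub_comp]
  refine congrArg (· ∘ₗ _) ?_
  refine TensorProduct.ext' fun x y => ?_
  simp [convMap, deconcat_mul]

theorem deconcat_comp_letterMap (g : C →ₗ[R] M) :
    toConv (deconcat ∘ₗ (letterMap g).ofConv) = 𝔩 (letterMap g) + 𝔯 (letterMap g) := by
  ext x
  simp [letterMap, convMap, add_comm]

theorem deconcat_comp_one :
    toConv (deconcat ∘ₗ (1 : WithConv (C →ₗ[R] TensorAlgebra R M)).ofConv) = 1 := by
  ext x
  simp [Algebra.algebraMap_eq_smul_one, Algebra.TensorProduct.one_def]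

/-- `P` is compatible with coproducts. -/
def IsComulHom {D : Type*} [AddCommGroup D] [Module R D] [Coalgebra R D] (P : C →ₗ[R] D) : Prop :=
  comul ∘ₗ P = TensorProduct.map P P ∘ₗ comul

theorem isComulHom_iff (P : WithConv (C →ₗ[R] TensorAlgebra R M)) :
    IsComulHom P.ofConv ↔ toConv (deconcat ∘ₗ P.ofConv) = 𝔩 P * 𝔯 P := by
  rw [convMap_includeLeft_mul_convMap_includeRight, toConv_injective.eq_iff]
  rfl

/-- Deconcatenating `geom g = 1 + letterMap g * geom g` yields a linear equation for the coproduct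
of `geom g`, with coefficient the left copy of `1 - letterMap g` and right-hand side the right copy
of `geom g`. Multiplying by the inverse of the coefficient, the left copy of `geom g`, solves it. -/
theorem isComulHom_geom {g : C →ₗ[R] M} (hg : IsUnit (1 - letterMap g)) :
    IsComulHom (geom g).ofConv := by
  rw [isComulHom_iff]
  have h1 : toConv (deconcat ∘ₗ (geom g).ofConv) =
      𝔯 (geom g) + 𝔩 (letterMap g) * toConv (deconcat ∘ₗ (geom g).ofConv) := by
    conv_lhs => rw [geom_eq hg]
    have : toConv (deconcat ∘ₗ (1 + letterMap g * geom g).ofConv) =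
        1 + toConv (deconcat ∘ₗ (letterMap g * geom g).ofConv) := by
      rw [ofConv_add, LinearMap.comp_add, toConv_add, deconcat_comp_one]
    rw [this, deconcat_comp_mul, deconcat_comp_letterMap]
    conv_rhs => rw [geom_eq hg, map_add, map_one, map_mul, ← geom_eq hg]
    noncomm_ring
  have h2 : 𝔩 (geom g) * 𝔩 (1 - letterMap g) = 1 := by
    rw [← map_mul, geom_mul_one_sub hg, map_one]
  have h3 : 𝔩 (1 - letterMap g) * toConv (deconcat ∘ₗ (geom g).ofConv) = 𝔯 (geom g) := by
    rw [map_sub, map_one, sub_mul, one_mul, sub_eq_iff_eq_add]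
    exact h1
  rw [← h3, ← mul_assoc, h2, one_mul]

theorem counit_comp_geom {g : C →ₗ[R] M} (hg : IsUnit (1 - letterMap g)) :
    counit ∘ₗ (geom g).ofConv = counit (R := R) := by
  have h1 : convMap (TensorAlgebra.algebraMapInv (R := R) (M := M)) (letterMap g) = 0 := by
    ext x
    exact counit_ι (R := R) (g x)
  have h2 := congrArg (convMap (TensorAlgebra.algebraMapInv (R := R) (M := M))) (geom_eq hg)
  rw [map_add, map_mul, h1, zero_mul, add_zero, map_one] at h2
  have h3 := congrArg WithConv.ofConv h2
  rw [ofConv_convMap, ← counit_tensorAlgebra] at h3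
  rw [h3]
  ext x
  simp

/-- The product is a coderivation relative to P and X: a cut falls either before or after the letter
supplied by c, within the part coming from P or from X. Both bar differentials and homotopies have
this form. -/
theorem comul_comp_mul_letterMap_mul {P X : WithConv (C →ₗ[R] TensorAlgebra R M)}
    (hP : IsComulHom P.ofConv) (hX : IsComulHom X.ofConv) (c : C →ₗ[R] M) :
    comul ∘ₗ (P * letterMap c * X).ofConv =
      TensorProduct.map P.ofConv (P * letterMap c * X).ofConv ∘ₗ comul +
      TensorProduct.map (P * letterMap c * X).ofConv X.ofConv ∘ₗ comul := by
  rw [isComulHom_iff] at hP hX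
  refine toConv_injective ?_
  rw [toConv_add, ← convMap_includeLeft_mul_convMap_includeRight,
    ← convMap_includeLeft_mul_convMap_includeRight, comul_tensorAlgebra, mul_assoc,
    deconcat_comp_mul, deconcat_comp_mul, deconcat_comp_letterMap, hP, hX]
  simp only [map_mul]
  noncomm_ring

end Geometric

/-! ### Precomposing convolution products with coalgebra maps and coderivations -/

section Precomposition

variable {R C D A : Type*} [CommRing R] [AddCommGroup C] [Module R C] [Coalgebra R C]
  [AddCommGroup D] [Module R D] [Coalgebra R D] [Ring A] [Algebra R A]

theorem mul_comp_of_comul_comp_eq (g h : WithConv (D →ₗ[R] A)) {Q P P' : C →ₗ[R] D}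
    (hQ : comul ∘ₗ Q = TensorProduct.map P P' ∘ₗ comul) :
    toConv ((g * h).ofConv ∘ₗ Q) = toConv (g.ofConv ∘ₗ P) * toConv (h.ofConv ∘ₗ P') := by
  refine WithConv.ext ?_
  simp only [LinearMap.convMul_def, ofConv_toConv, LinearMap.comp_assoc, hQ,
    TensorProduct.map_comp]

theorem mul_comp_of_comul_comp_eq_add (g h : WithConv (D →ₗ[R] A)) {Q P P' S S' : C →ₗ[R] D}
    (hQ : comul ∘ₗ Q = TensorProduct.map P P' ∘ₗ comul + TensorProduct.map S S' ∘ₗ comul) :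
    toConv ((g * h).ofConv ∘ₗ Q) = toConv (g.ofConv ∘ₗ P) * toConv (h.ofConv ∘ₗ P') +
      toConv (g.ofConv ∘ₗ S) * toConv (h.ofConv ∘ₗ S') := by
  refine WithConv.ext ?_
  simp only [LinearMap.convMul_def, ofConv_toConv, ofConv_add, LinearMap.comp_assoc, hQ,
    TensorProduct.map_comp, LinearMap.comp_add]

/-- Composition of coalgebra maps to tensor coalgebras. -/
theorem geom_comp_geom {M M' : Type*} [AddCommGroup M] [Module R M] [AddCommGroup M'] [Module R M']
    {g : C →ₗ[R] M} (hg : IsUnit (1 - letterMap g)) {f : TensorAlgebra R M →ₗ[R] M'}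
    (hf : IsUnit (1 - letterMap f)) (hfg : IsUnit (1 - letterMap (f ∘ₗ (geom g).ofConv))) :
    toConv ((geom f).ofConv ∘ₗ (geom g).ofConv) = geom (f ∘ₗ (geom g).ofConv) := by
  refine eq_geom hfg ?_
  conv_lhs => rw [geom_eq hf, ofConv_add, LinearMap.add_comp, toConv_add,
    mul_comp_of_comul_comp_eq _ _ (isComulHom_geom hg)]
  congr 1
  ext x
  exact congrArg (algebraMap R _) (LinearMap.congr_fun (counit_comp_geom hg) x)

end Precomposition

/-! ### The projection onto letters as universal component -/

section Letter

variable {R M : Type*} [CommRing R] [AddCommGroup M] [Module R M]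

/-- `letter` kills every prefix except the one of length one, so a single cut of the word
contributes. -/
theorem letterMap_letter_mul_apply {A : Type*} [Ring A] [Algebra R A]
    (L : TensorAlgebra R M →ₐ[R] A) (h : WithConv (TensorAlgebra R M →ₗ[R] A)) (a : M)
    (w : TensorAlgebra R M) :
    (convMap L (letterMap letter) * h) (TensorAlgebra.ι R a * w) =
      L (TensorAlgebra.ι R a) * h w := by
  have key : ∀ t : TensorAlgebra R M ⊗[R] TensorAlgebra R M,
      LinearMap.mul' R A (TensorProduct.map (convMap L (letterMap letter)).ofConv h.ofConv
        ((TensorAlgebra.ι R a ⊗ₜ 1) * t)) =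
      L (TensorAlgebra.ι R a) *
        h (TensorProduct.lid R _ (counit.rTensor (TensorAlgebra R M) t)) := by
    intro t
    induction t using TensorProduct.induction_on with
    | zero => simp
    | tmul x y => simp [letter_ι_mul]
    | add s t hs ht => simp only [mul_add, map_add, hs, ht]
  rw [LinearMap.convMul_apply, comul_tensorAlgebra, deconcat_ι_mul, map_add, map_add, key,
    ← comul_tensorAlgebra, Coalgebra.rTensor_counit_comul]
  simp

/-- The identity of the tensor coalgebra has as its component the projection onto letters. -/
theorem toConv_id_eq : (toConv LinearMap.id : WithConv (TensorAlgebra R M →ₗ[R] _)) =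
    1 + letterMap letter * toConv LinearMap.id := by
  refine WithConv.ext (word_induction ?_ fun a w _ => ?_)
  · simp [comul_tensorAlgebra]
  · have := letterMap_letter_mul_apply (AlgHom.id R (TensorAlgebra R M)) (toConv LinearMap.id) a w
    simp only [convMap, AlgHom.toLinearMap_id, LinearMap.id_comp] at this
    rw [ofConv_add, LinearMap.add_apply]
    erw [this]
    simp

theorem isComulHom_id : IsComulHom (LinearMap.id : TensorAlgebra R M →ₗ[R] TensorAlgebra R M) := by
  simp [IsComulHom]

end Letter


/-! ### Coderivations and geometric series evaluated on words -/

section WordFormulas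

variable {R M N : Type*} [CommRing R] [AddCommGroup M] [Module R M] [AddCommGroup N] [Module R N]

/-- The linear map on the tensor algebra given by multilinear maps in every arity. -/
noncomputable def tensorLift (f : (n : ℕ) → MultilinearMap R (fun _ : Fin n => M) N) :
    TensorAlgebra R M →ₗ[R] N :=
  DirectSum.toModule R ℕ N (fun n => PiTensorProduct.lift (f n)) ∘ₗ
    TensorAlgebra.toDirectSum.toLinearMap

theorem tensorLift_tprod (f : (n : ℕ) → MultilinearMap R (fun _ : Fin n => M) N) {n : ℕ}
    (a : Fin n → M) : tensorLift f (TensorAlgebra.tprod R M n a) = f n a := by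
  rw [tensorLift, LinearMap.comp_apply, AlgHom.toLinearMap_apply,
    TensorAlgebra.toDirectSum_tensorPower_tprod, ← DirectSum.lof_eq_of R, DirectSum.toModule_lof,
    PiTensorProduct.lift.tprod]

theorem word_ofFn {n : ℕ} (a : Fin n → M) : word R (List.ofFn a) = TensorAlgebra.tprod R M n a := by
  rw [word, TensorAlgebra.tprod_apply, List.map_ofFn]
  rfl

theorem tensorLift_word_ofFn (f : (n : ℕ) → MultilinearMap R (fun _ : Fin n => M) N) {n : ℕ}
    (a : Fin n → M) : tensorLift f (word R (List.ofFn a)) = f n a := by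
  rw [word_ofFn, tensorLift_tprod]

theorem tensorLift_word (f : (n : ℕ) → MultilinearMap R (fun _ : Fin n => M) N) (l : List M) :
    tensorLift f (word R l) = f l.length l.get := by
  conv_lhs => rw [← List.ofFn_get l, tensorLift_word_ofFn]

theorem tensorLift_one (f : (n : ℕ) → MultilinearMap R (fun _ : Fin n => M) N) (hf : f 0 = 0) :
    tensorLift f (1 : TensorAlgebra R M) = 0 := by
  rw [← word_nil R, tensorLift_word]
  exact congrArg (fun g : MultilinearMap R (fun _ : Fin 0 => M) N => g _) hf

theorem tensorLift_ι (f : (n : ℕ) → MultilinearMap R (fun _ : Fin n => M) N) (a : M) :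
    tensorLift f (TensorAlgebra.ι R a) = f 1 fun _ => a := by
  have := tensorLift_word_ofFn f (fun _ : Fin 1 => a)
  simpa using this

theorem deconcat_word (l : List M) :
    deconcat (word R l) =
      ∑ i ∈ Finset.range (l.length + 1), word R (l.take i) ⊗ₜ word R (l.drop i) := by
  induction l with
  | nil => simp
  | cons a l ih =>
    rw [word_cons, deconcat_ι_mul, ih, List.length_cons, Finset.sum_range_succ' _ (l.length + 1),
      Finset.mul_sum, add_comm]
    simp

theorem mul_apply_word {A : Type*} [Ring A] [Algebra R A]
    (g h : WithConv (TensorAlgebra R M →ₗ[R] A)) (l : List M) :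
    (g * h) (word R l) =
      ∑ i ∈ Finset.range (l.length + 1), g (word R (l.take i)) * h (word R (l.drop i)) := by
  rw [LinearMap.convMul_apply, comul_tensorAlgebra, deconcat_word]
  simp

/-- The algebra endomorphism that applies `s` to every letter. -/
noncomputable def letterwise (s : M →ₗ[R] N) : TensorAlgebra R M →ₐ[R] TensorAlgebra R N :=
  TensorAlgebra.lift R (TensorAlgebra.ι R ∘ₗ s)

@[simp] theorem letterwise_ι (s : M →ₗ[R] N) (a : M) :
    letterwise s (TensorAlgebra.ι R a) = TensorAlgebra.ι R (s a) := by
  simp [letterwise]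

theorem letterwise_word (s : M →ₗ[R] N) (l : List M) :
    letterwise s (word R l) = word R (l.map s) := by
  induction l with
  | nil => simp
  | cons a l ih => simp [ih]

/-- The coderivation (twisted by `s`) of the tensor coalgebra with component `tensorLift m`. -/
noncomputable def coderiv (s : M →ₗ[R] M) (m : (n : ℕ) → MultilinearMap R (fun _ : Fin n => M) M) :
    TensorAlgebra R M →ₗ[R] TensorAlgebra R M :=
  (toConv (letterwise s).toLinearMap * letterMap (tensorLift m) * toConv LinearMap.id).ofConv

theorem coderiv_word (s : M →ₗ[R] M) (m : (n : ℕ) → MultilinearMap R (fun _ : Fin n => M) M)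
    (l : List M) :
    coderiv s m (word R l) = ∑ i ∈ Finset.range (l.length + 1),
      ∑ j ∈ Finset.range (l.length - i + 1), word R ((l.take i).map s) *
        (TensorAlgebra.ι R (tensorLift m (word R ((l.drop i).take j))) *
          word R ((l.drop i).drop j)) := by
  rw [coderiv, mul_assoc, mul_apply_word]
  refine Finset.sum_congr rfl fun i _ => ?_
  rw [mul_apply_word, List.length_drop, Finset.mul_sum]
  refine Finset.sum_congr rfl fun j _ => ?_
  simp [letterwise_word]

/-- Translates the indexing of `contractArgs` into prefix, contracted block and suffix of a list.
The index j stands for a block of length j + 1. -/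
theorem ofFn_contractArgs (s : M →ₗ[R] M)
    (m : (n : ℕ) → MultilinearMap R (fun _ : Fin n => M) M) {n : ℕ} (k : Fin n)
    (j : Fin (n - k)) (a : Fin n → M) :
    List.ofFn (contractArgs s m k j a) = (((List.ofFn a).take k).map s) ++
      (tensorLift m (word R (((List.ofFn a).drop k).take (j + 1))) ::
        ((List.ofFn a).drop k).drop (j + 1)) := by
  have hk := k.isLt
  have hj := j.isLt
  have hm : tensorLift m (word R (((List.ofFn a).drop k).take (j + 1))) =
      m (j + 1) fun t => a ⟨k + t, by omega⟩ := by
    rw [← tensorLift_word_ofFn]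
    refine congrArg (fun l => tensorLift m (word R l)) ?_
    refine List.ext_getElem (by simp) fun i h1 h2 => ?_
    simp only [List.getElem_take, List.getElem_drop, List.getElem_ofFn]
  rw [hm]
  refine List.ext_getElem (by simp; omega) fun i h1 h2 => ?_
  simp only [List.getElem_ofFn, contractArgs]
  simp only [List.length_ofFn] at h1
  rw [List.getElem_append]
  split_ifs with c1 c2 c3 c4 c5
  · simp
  · simp at c2; omega
  · simp at c4; omega
  · simp [c3]
  · simp at c5; omega
  · rw [List.getElem_cons]
    have : ¬ i - (((List.ofFn a).take k).map s).length = 0 := by simp; omega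
    rw [dif_neg this]
    simp only [List.getElem_drop, List.getElem_ofFn]
    congr 1
    simp
    omega

theorem coderiv_tprod (s : M →ₗ[R] M) (m : (n : ℕ) → MultilinearMap R (fun _ : Fin n => M) M)
    (hm : m 0 = 0) {n : ℕ} (a : Fin n → M) :
    coderiv s m (TensorAlgebra.tprod R M n a) =
      ∑ k : Fin n, ∑ j : Fin (n - k), TensorAlgebra.tprod R M (n - j) (contractArgs s m k j a) := by
  rw [← word_ofFn, coderiv_word, List.length_ofFn, Finset.sum_range_succ, Finset.sum_range]
  have h0 : tensorLift m (1 : TensorAlgebra R M) = 0 := tensorLift_one m hm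
  -- A block that starts after the last letter is empty, and the operation without arguments is
  -- zero.
  have hlast : ∑ j ∈ Finset.range (n - n + 1), word R (((List.ofFn a).take n).map s) *
        (TensorAlgebra.ι R (tensorLift m (word R (((List.ofFn a).drop n).take j))) *
          word R (((List.ofFn a).drop n).drop j)) = 0 := by
    simp [h0]
  rw [hlast, add_zero]
  refine Finset.sum_congr rfl fun k _ => ?_
  -- Empty blocks drop out at every other position too, which shifts j by one.
  rw [Finset.sum_range_succ', Finset.sum_range]
  rw [List.take_zero, word_nil, h0, map_zero, zero_mul, mul_zero, add_zero]
  refine Finset.sum_congr rfl fun j _ => ?_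
  rw [← word_ofFn, ofFn_contractArgs, word_append, word_cons]

/-- A composition of a positive number amounts to its first block i + 1 and a composition of the
rest. This is the combinatorial counterpart of the fixed point equation of `geom`. -/
theorem sum_composition_blocks {A : Type*} [AddCommMonoid A] (h : List ℕ → A) {n : ℕ}
    (hn : 0 < n) :
    ∑ c : Composition n, h c.blocks =
      ∑ i ∈ Finset.range n, ∑ c : Composition (n - (i + 1)), h ((i + 1) :: c.blocks) := by
  rw [Finset.sum_sigma']
  symm
  refine Finset.sum_bij (fun x hx => (⟨(x.1 + 1) :: x.2.blocks, ?_, ?_⟩ : Composition n)) ?_ ?_ ?_ ?_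
  · intro i hi
    rcases List.mem_cons.1 hi with rfl | hi
    · omega
    · exact x.2.blocks_pos hi
  · have hx' : x.1 < n := by simpa using hx
    rw [List.sum_cons, x.2.blocks_sum]
    omega
  · intro x hx
    exact Finset.mem_univ _
  · rintro ⟨i, c⟩ hx ⟨i', c'⟩ hx' heq
    have := congrArg Composition.blocks heq
    simp only [List.cons.injEq, add_left_inj] at this
    obtain ⟨rfl, hc⟩ := this
    exact congrArg _ (Composition.ext hc)
  · intro c _
    rcases hb : c.blocks with _ | ⟨b, bs⟩
    · rw [Composition.blocks_eq_nil] at hb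
      omega
    · have hpos : 0 < b := c.blocks_pos (by simp [hb])
      have hsum := c.blocks_sum
      rw [hb, List.sum_cons] at hsum
      refine ⟨⟨b - 1, ⟨bs, fun hi => c.blocks_pos (by rw [hb]; exact List.mem_cons_of_mem _ hi), by
        omega⟩⟩, by simp; omega, ?_⟩
      refine Composition.ext ?_
      simp only [hb, List.cons.injEq, and_true]
      omega
  · intro x hx
    rfl

/-- Cut a list into consecutive blocks of given lengths and multiply the values of `g`. -/
def blockProd {A : Type*} [Monoid A] (g : List M → A) : List ℕ → List M → A
  | [], _ => 1
  | n :: ns, l => g (l.take n) * blockProd g ns (l.drop n)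

omit [AddCommGroup M] in
theorem blockProd_eq_prod_ofFn {A : Type*} [Monoid A] (g : List M → A) (ns : List ℕ)
    (l : List M) : blockProd g ns l =
      (List.ofFn fun i : Fin ns.length => g ((l.drop (ns.take i).sum).take ns[i])).prod := by
  induction ns generalizing l with
  | nil => rfl
  | cons n ns ih =>
    rw [blockProd, ih]
    simp [List.ofFn_succ, List.drop_drop]

/-- The fixed point equation splits off the first block; strong induction on the length handles the
remaining word. Since f has no component without arguments, the first block is nonempty. -/
theorem geom_tensorLift_word (f : (n : ℕ) → MultilinearMap R (fun _ : Fin n => M) N)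
    (hf : f 0 = 0) (hu : IsUnit (1 - letterMap (tensorLift f))) {n : ℕ} (l : List M)
    (hn : l.length = n) :
    geom (tensorLift f) (word R l) = ∑ c : Composition n,
      blockProd (fun l' => TensorAlgebra.ι R (tensorLift f (word R l'))) c.blocks l := by
  induction n using Nat.strong_induction_on generalizing l with
  | _ n ih =>
  subst hn
  rw [geom_eq hu, ofConv_add, LinearMap.add_apply, mul_apply_word]
  rcases l with _ | ⟨a, l⟩
  · have : ∀ c : Composition 0, c.blocks = [] := fun c => by rw [Composition.blocks_eq_nil]
    simp [tensorLift_one f hf, this, blockProd, composition_card]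
  · rw [sum_composition_blocks (fun ns => blockProd (fun l' => TensorAlgebra.ι R
      (tensorLift f (word R l'))) ns (a :: l)) (by simp), Finset.sum_range_succ']
    have h1 : (1 : WithConv (TensorAlgebra R M →ₗ[R] TensorAlgebra R N)) (word R (a :: l)) = 0 := by
      rw [LinearMap.convOne_apply, word_cons, counit_ι_mul, map_zero]
    rw [h1, zero_add, List.take_zero, word_nil, letterMap_apply, tensorLift_one f hf, map_zero,
      zero_mul, add_zero]
    refine Finset.sum_congr rfl fun i hi => ?_
    have hi' : i < (a :: l).length := by simpa using hi
    rw [ih ((a :: l).length - (i + 1)) (by omega) ((a :: l).drop (i + 1)) (by simp),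
      Finset.mul_sum]
    exact Finset.sum_congr rfl fun c _ => rfl

theorem geom_tensorLift_tprod (f : (n : ℕ) → MultilinearMap R (fun _ : Fin n => M) N)
    (hf : f 0 = 0) (hu : IsUnit (1 - letterMap (tensorLift f))) {n : ℕ} (a : Fin n → M) :
    geom (tensorLift f) (TensorAlgebra.tprod R M n a) = ∑ c : Composition n,
      TensorAlgebra.tprod R N c.length fun i => f (c.blocksFun i) (a ∘ c.embedding i) := by
  rw [← word_ofFn, geom_tensorLift_word f hf hu _ List.length_ofFn]
  refine Finset.sum_congr rfl fun c _ => ?_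
  rw [TensorAlgebra.tprod_apply, blockProd_eq_prod_ofFn]
  refine congrArg List.prod (congrArg List.ofFn (funext fun i => ?_))
  congr 1
  rw [← tensorLift_word_ofFn]
  refine congrArg (fun l => tensorLift f (word R l)) ?_
  have hs := c.sizeUpTo_succ' i
  have hle := c.sizeUpTo_le (i + 1)
  have hb : c.blocks[i] = c.blocksFun i := rfl
  have hsum : (c.blocks.take i).sum = c.sizeUpTo i := rfl
  refine List.ext_getElem ?_ fun t h4 h5 => ?_
  · rw [hsum, hb]
    simp only [List.length_drop, List.length_take, List.length_ofFn]
    omega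
  · simp only [List.getElem_take, List.getElem_drop, List.getElem_ofFn, hsum]
    rfl

end WordFormulas


/-! ### The grading of the tensor coalgebra on the suspension -/

section WordGrading

variable {R M : Type*} [CommRing R] [AddCommGroup M] [Module R M]

/-- Lists of homogeneous vectors, with their total degree in the suspension. -/
inductive IsHomogeneousList (𝓜 : ℤ → Submodule R M) : List M → ℤ → Prop
  | nil : IsHomogeneousList 𝓜 [] 0
  | cons {a : M} {l : List M} {p n : ℤ} : a ∈ 𝓜 p → IsHomogeneousList 𝓜 l n →
      IsHomogeneousList 𝓜 (a :: l) (p + 1 + n)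

/-- The grading of the tensor coalgebra on the suspension of `M`. -/
def wordGrading (𝓜 : ℤ → Submodule R M) (n : ℤ) : Submodule R (TensorAlgebra R M) :=
  Submodule.span R {t | ∃ l, IsHomogeneousList 𝓜 l n ∧ word R l = t}

variable {𝓜 : ℤ → Submodule R M}

theorem IsHomogeneousList.word_mem {l : List M} {n : ℤ} (h : IsHomogeneousList 𝓜 l n) :
    word R l ∈ wordGrading 𝓜 n := Submodule.subset_span ⟨l, h, rfl⟩

theorem wordGrading_le {n : ℤ} {Q : Submodule R (TensorAlgebra R M)}
    (h : ∀ l, IsHomogeneousList 𝓜 l n → word R l ∈ Q) : wordGrading 𝓜 n ≤ Q := by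
  rw [wordGrading, Submodule.span_le]
  rintro _ ⟨l, hl, rfl⟩
  exact h l hl

theorem IsHomogeneousList.append {l l' : List M} {n n' : ℤ} (h : IsHomogeneousList 𝓜 l n)
    (h' : IsHomogeneousList 𝓜 l' n') : IsHomogeneousList 𝓜 (l ++ l') (n + n') := by
  induction h with
  | nil => simpa using h'
  | cons ha _ ih => rw [add_assoc]; exact .cons ha ih

theorem IsHomogeneousList.exists_split {l : List M} {n : ℤ} (h : IsHomogeneousList 𝓜 l n)
    (i : ℕ) : ∃ p, IsHomogeneousList 𝓜 (l.take i) p ∧ IsHomogeneousList 𝓜 (l.drop i) (n - p) := by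
  induction h generalizing i with
  | nil => exact ⟨0, by simpa using .nil, by simpa using .nil⟩
  | @cons a l p n ha hl ih =>
    cases i with
    | zero => exact ⟨0, .nil, by simpa using .cons ha hl⟩
    | succ i =>
      obtain ⟨q, h1, h2⟩ := ih i
      refine ⟨p + 1 + q, .cons ha h1, ?_⟩
      rw [show p + 1 + n - (p + 1 + q) = n - q by ring]
      exact h2

theorem IsHomogeneousList.exists_degrees {l : List M} {n : ℤ} (h : IsHomogeneousList 𝓜 l n) :
    ∃ deg : Fin l.length → ℤ, (∀ i, l.get i ∈ 𝓜 (deg i)) ∧ (∑ i, deg i) + l.length = n := by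
  induction h with
  | nil => exact ⟨fun _ => 0, fun i => i.elim0, by simp⟩
  | @cons a l p n ha hl ih =>
    obtain ⟨deg, h1, h2⟩ := ih
    refine ⟨Fin.cons p deg, fun i => ?_, ?_⟩
    · refine Fin.cases ?_ (fun i => ?_) i
      · simpa using ha
      · simpa using h1 i
    · have : ∑ i, (Fin.cons p deg : Fin (l.length + 1) → ℤ) i = p + ∑ i, deg i := by
        simp [Fin.sum_univ_succ]
      simp only [List.length_cons] at this ⊢
      rw [this]
      push_cast
      linarith

theorem one_mem_wordGrading : (1 : TensorAlgebra R M) ∈ wordGrading 𝓜 0 :=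
  IsHomogeneousList.nil.word_mem

theorem ι_mem_wordGrading {a : M} {p : ℤ} (ha : a ∈ 𝓜 p) :
    TensorAlgebra.ι R a ∈ wordGrading 𝓜 (p + 1) := by
  simpa using (IsHomogeneousList.cons ha .nil).word_mem

theorem mul_mem_wordGrading (p q : ℤ) (x : TensorAlgebra R M) (hx : x ∈ wordGrading 𝓜 p)
    (y : TensorAlgebra R M) (hy : y ∈ wordGrading 𝓜 q) : x * y ∈ wordGrading 𝓜 (p + q) := by
  have h1 : wordGrading 𝓜 p ≤ (wordGrading 𝓜 (p + q)).comap (LinearMap.mulRight R y) := by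
    refine wordGrading_le fun l hl => ?_
    have h2 : wordGrading 𝓜 q ≤
        (wordGrading 𝓜 (p + q)).comap (LinearMap.mulLeft R (word R l)) := by
      refine wordGrading_le fun l' hl' => ?_
      rw [Submodule.mem_comap, LinearMap.mulLeft_apply, ← word_append]
      exact (hl.append hl').word_mem
    exact h2 hy
  exact h1 hx

theorem hasDeg_letterMap {C : Type*} [AddCommGroup C] [Module R C] {𝒞 : ℤ → Submodule R C}
    {k l : ℤ} {g : C →ₗ[R] M} (hg : HasDeg 𝒞 𝓜 k g) (h : l = k + 1) :
    HasDeg 𝒞 (wordGrading 𝓜) l (letterMap g).ofConv := fun n x hx => by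
  rw [h, ← add_assoc]
  exact ι_mem_wordGrading (hg n x hx)

theorem hasDeg_tensorLift {N : Type*} [AddCommGroup N] [Module R N] {𝒩 : ℤ → Submodule R N}
    {f : (n : ℕ) → MultilinearMap R (fun _ : Fin n => M) N} {k : ℤ}
    (hf : ∀ (n : ℕ) (deg : Fin n → ℤ) (a : Fin n → M), (∀ i, a i ∈ 𝓜 (deg i)) →
      f n a ∈ 𝒩 ((∑ i, deg i) + n + k)) :
    HasDeg (wordGrading 𝓜) 𝒩 k (tensorLift f) := by
  intro n
  change wordGrading 𝓜 n ≤ (𝒩 (n + k)).comap (tensorLift f)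
  refine wordGrading_le fun l hl => ?_
  obtain ⟨deg, h1, h2⟩ := hl.exists_degrees
  rw [Submodule.mem_comap, tensorLift_word, ← h2]
  exact hf _ deg _ h1

variable (𝓜) in
theorem iSup_wordGrading [DirectSum.Decomposition 𝓜] : ⨆ n, wordGrading 𝓜 n = ⊤ := by
  rw [eq_top_iff, ← span_range_word, Submodule.span_le]
  rintro _ ⟨l, rfl⟩
  classical
  induction l with
  | nil => exact Submodule.mem_iSup_of_mem 0 one_mem_wordGrading
  | cons a l ih =>
    rw [SetLike.mem_coe] at ih ⊢
    rw [word_cons, ← DirectSum.sum_support_decompose 𝓜 a, map_sum, Finset.sum_mul]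
    refine Submodule.sum_mem _ fun p _ => ?_
    have : (⨆ n, wordGrading 𝓜 n) ≤ (⨆ n, wordGrading 𝓜 n).comap
        (LinearMap.mulLeft R (TensorAlgebra.ι R ((DirectSum.decompose 𝓜 a p : 𝓜 p) : M))) :=
      iSup_le fun n x hx => Submodule.mem_iSup_of_mem (p + 1 + n)
        (mul_mem_wordGrading _ _ _ (ι_mem_wordGrading (SetLike.coe_mem _)) _ hx)
    exact this ih

variable (𝓜) in
theorem isGradedCoalgebra_tensorAlgebra [DirectSum.Decomposition 𝓜] :
    IsGradedCoalgebra (wordGrading 𝓜) where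
  iSup_eq_top := iSup_wordGrading 𝓜
  comul_mem n := by
    suffices h : wordGrading 𝓜 n ≤ (⨆ p : ℤ, LinearMap.range (TensorProduct.map
        (wordGrading 𝓜 p).subtype (wordGrading 𝓜 (n - p)).subtype)).comap deconcat from h
    refine wordGrading_le fun l hl => ?_
    rw [Submodule.mem_comap, deconcat_word]
    refine Submodule.sum_mem _ fun i _ => ?_
    obtain ⟨p, h1, h2⟩ := hl.exists_split i
    exact Submodule.mem_iSup_of_mem p ⟨⟨_, h1.word_mem⟩ ⊗ₜ ⟨_, h2.word_mem⟩, rfl⟩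
  counit_eq_zero n := by
    intro x hx hn
    have : wordGrading 𝓜 n ≤ LinearMap.ker (counit (R := R) (A := TensorAlgebra R M)) := by
      refine wordGrading_le fun l hl => ?_
      cases hl with
      | nil => exact absurd rfl hn
      | cons => simp
    exact this hx

/-- Each letter of degree p contributes the sign of p + 1, its degree in the suspension, and these
degrees add up to n. -/
theorem letterwise_suspSign_apply [DirectSum.Decomposition 𝓜] (n : ℤ) (x : TensorAlgebra R M)
    (hx : x ∈ wordGrading 𝓜 n) :
    letterwise (suspSign 𝓜) x = ((n.negOnePow : ℤˣ) : ℤ) • x := by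
  have : wordGrading 𝓜 n ≤ LinearMap.eqLocus (letterwise (suspSign 𝓜)).toLinearMap
      (((n.negOnePow : ℤˣ) : ℤ) • LinearMap.id) := by
    refine wordGrading_le fun l hl => ?_
    rw [LinearMap.mem_eqLocus, AlgHom.toLinearMap_apply, LinearMap.smul_apply, LinearMap.id_apply]
    clear hx
    induction hl with
    | nil => simp
    | @cons a l p n ha hl ih =>
      rw [word_cons, map_mul, ih, letterwise_ι, suspSign, LinearMap.neg_apply,
        gradeInvol_of_mem 𝓜 ha, Int.negOnePow_add, Int.negOnePow_succ]
      simp only [map_neg, map_zsmul, neg_mul, smul_mul_assoc, mul_smul_comm, Units.val_mul,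
        Units.val_neg, neg_smul, smul_neg, mul_comm (p.negOnePow : ℤ), mul_smul]
  exact this hx

end WordGrading

/-! ### Pre- and postcomposition as additive operators -/

section PrePost

variable {R C D A B : Type*} [CommRing R] [AddCommGroup C] [Module R C]
  [AddCommGroup D] [Module R D] [AddCommGroup A] [Module R A] [AddCommGroup B] [Module R B]

/-- Precomposition, on the additive groups underlying convolution rings. -/
def precomp (d : C →ₗ[R] D) : WithConv (D →ₗ[R] A) →+ WithConv (C →ₗ[R] A) where
  toFun g := toConv (g.ofConv ∘ₗ d)
  map_zero' := by ext x; simp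
  map_add' f g := by ext x; simp

/-- Postcomposition, on the additive groups underlying convolution rings. -/
def postcomp (L : A →ₗ[R] B) : WithConv (C →ₗ[R] A) →+ WithConv (C →ₗ[R] B) where
  toFun g := toConv (L ∘ₗ g.ofConv)
  map_zero' := by ext x; simp
  map_add' f g := by ext x; simp

@[simp] theorem precomp_apply (d : C →ₗ[R] D) (g : WithConv (D →ₗ[R] A)) (x : C) :
    precomp d g x = g (d x) := rfl

@[simp] theorem postcomp_apply (L : A →ₗ[R] B) (g : WithConv (C →ₗ[R] A)) (x : C) :
    postcomp L g x = L (g x) := rfl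

end PrePost

/-! ### Counital dg coalgebras and the Leibniz rule for convolution -/

section DG

variable {R C : Type*} [CommRing R] [AddCommGroup C] [Module R C] [Coalgebra R C]

/-- A graded coalgebra with its grading involution `σ` and a coderivation `d` of degree `-1`. -/
structure IsDGCoalgebra (𝒞 : ℤ → Submodule R C) (σ d : C →ₗ[R] C) : Prop
    extends IsGradedCoalgebra 𝒞 where
  invol_apply : ∀ n, ∀ x ∈ 𝒞 n, σ x = ((n.negOnePow : ℤˣ) : ℤ) • x
  hasDeg_d : HasDeg 𝒞 𝒞 (-1) d
  counit_d : counit ∘ₗ d = (0 : C →ₗ[R] R)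
  comul_d : comul ∘ₗ d = TensorProduct.map d LinearMap.id ∘ₗ comul + TensorProduct.map σ d ∘ₗ comul

theorem isComulHom_invol {𝒞 : ℤ → Submodule R C} (h𝒞 : IsGradedCoalgebra 𝒞) {σ : C →ₗ[R] C}
    (hσ : ∀ n, ∀ x ∈ 𝒞 n, σ x = ((n.negOnePow : ℤˣ) : ℤ) • x) : IsComulHom σ := by
  refine linearMap_ext_of_iSup_eq_top h𝒞.iSup_eq_top fun n x hx => ?_
  have := tensor_homogeneous_induction (h𝒞.comul_mem n x hx)
    (TensorProduct.map σ σ - ((n.negOnePow : ℤˣ) : ℤ) • LinearMap.id) ⊥ fun p q hpq a ha b hb => by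
      rw [Submodule.mem_bot, LinearMap.sub_apply, TensorProduct.map_tmul, hσ p a ha, hσ q b hb,
        ← hpq, Int.negOnePow_add, sub_eq_zero, LinearMap.smul_apply, LinearMap.id_apply,
        Units.val_mul, TensorProduct.tmul_smul, TensorProduct.smul_tmul', smul_smul, mul_comm,
        TensorProduct.smul_tmul']
  rw [Submodule.mem_bot, LinearMap.sub_apply, sub_eq_zero] at this
  rw [LinearMap.comp_apply, hσ n x hx, map_zsmul, LinearMap.comp_apply, this]
  rfl

variable {𝒞 : ℤ → Submodule R C} {σ d : C →ₗ[R] C} (h𝒞 : IsDGCoalgebra 𝒞 σ d)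

include h𝒞

theorem IsDGCoalgebra.invol_comp_invol : σ ∘ₗ σ = LinearMap.id := by
  refine linearMap_ext_of_iSup_eq_top h𝒞.iSup_eq_top fun n x hx => ?_
  rw [LinearMap.comp_apply, h𝒞.invol_apply n x hx, map_zsmul, h𝒞.invol_apply n x hx, smul_smul,
    ← Units.val_mul, ← Int.negOnePow_add, Int.negOnePow_even _ (Even.add_self n)]
  simp

theorem IsDGCoalgebra.hasDeg_invol : HasDeg 𝒞 𝒞 0 σ := fun n x hx => by
  rw [h𝒞.invol_apply n x hx, add_zero]
  exact zsmul_mem hx _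

theorem IsDGCoalgebra.invol_comp_d : σ ∘ₗ d = -(d ∘ₗ σ) := by
  refine linearMap_ext_of_iSup_eq_top h𝒞.iSup_eq_top fun n x hx => ?_
  rw [LinearMap.comp_apply, LinearMap.neg_apply, LinearMap.comp_apply, h𝒞.invol_apply n x hx,
    h𝒞.invol_apply (n + -1) _ (h𝒞.hasDeg_d n x hx), map_zsmul, Int.negOnePow_add]
  simp

theorem IsDGCoalgebra.counit_comp_invol : counit ∘ₗ σ = counit (R := R) := by
  refine linearMap_ext_of_iSup_eq_top h𝒞.iSup_eq_top fun n x hx => ?_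
  rw [LinearMap.comp_apply, h𝒞.invol_apply n x hx, map_zsmul]
  by_cases hn : n = 0
  · simp [hn]
  · simp [h𝒞.counit_eq_zero n x hx hn]

variable {A : Type*} [Ring A] [Algebra R A]

theorem IsDGCoalgebra.precomp_invol_mul (g f : WithConv (C →ₗ[R] A)) :
    precomp σ (g * f) = precomp σ g * precomp σ f :=
  have h : comul ∘ₗ σ = TensorProduct.map σ σ ∘ₗ comul :=
    isComulHom_invol h𝒞.toIsGradedCoalgebra h𝒞.invol_apply
  mul_comp_of_comul_comp_eq g f h

theorem IsDGCoalgebra.precomp_invol_one : precomp σ (1 : WithConv (C →ₗ[R] A)) = 1 := by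
  ext x
  exact congrArg (algebraMap R A) (LinearMap.congr_fun h𝒞.counit_comp_invol x)

theorem IsDGCoalgebra.precomp_invol_precomp_invol (g : WithConv (C →ₗ[R] A)) :
    precomp σ (precomp σ g) = g := by
  ext x
  exact congrArg g.ofConv (LinearMap.congr_fun h𝒞.invol_comp_invol x)

theorem IsDGCoalgebra.precomp_d_precomp_invol (g : WithConv (C →ₗ[R] A)) :
    precomp d (precomp σ g) = -precomp σ (precomp d g) := by
  ext x
  have := LinearMap.congr_fun h𝒞.invol_comp_d x
  simp only [LinearMap.comp_apply, LinearMap.neg_apply] at this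
  simp [this]

theorem IsDGCoalgebra.precomp_d_mul (g h : WithConv (C →ₗ[R] A)) :
    precomp d (g * h) = precomp d g * h + precomp σ g * precomp d h := by
  have := mul_comp_of_comul_comp_eq_add g h h𝒞.comul_d
  rw [LinearMap.comp_id, toConv_ofConv] at this
  exact this

theorem IsDGCoalgebra.precomp_d_one : precomp d (1 : WithConv (C →ₗ[R] A)) = 0 := by
  ext x
  simpa using congrArg (algebraMap R A) (LinearMap.congr_fun h𝒞.counit_d x)

end DG


/-! ### The bar construction on the tensor algebra -/

section Bar

variable {R C M M' : Type*} [CommRing R] [AddCommGroup C] [Module R C] [AddCommGroup M] [Module R M]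
  [AddCommGroup M'] [Module R M'] {𝓜 : ℤ → Submodule R M} [DirectSum.Decomposition 𝓜]
  {𝓜' : ℤ → Submodule R M'} [DirectSum.Decomposition 𝓜']

theorem linearMap_ext_tprod {N : Type*} [AddCommGroup N] [Module R N]
    {g h : TensorAlgebra R M →ₗ[R] N}
    (H : ∀ n (a : Fin n → M), g (TensorAlgebra.tprod R M n a) = h (TensorAlgebra.tprod R M n a)) :
    g = h :=
  linearMap_ext_word fun l => by
    have := H l.length l.get
    rwa [← word_ofFn, List.ofFn_get] at this

/-- All operations of an `A∞`-algebra, as one map on the tensor algebra. -/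
noncomputable def AInfAlgebra.total (A : AInfAlgebra 𝓜) : TensorAlgebra R M →ₗ[R] M :=
  tensorLift A.m

/-- The differential of the bar construction, on the tensor algebra. -/
noncomputable def AInfAlgebra.barDiff (A : AInfAlgebra 𝓜) :
    TensorAlgebra R M →ₗ[R] TensorAlgebra R M :=
  coderiv (suspSign 𝓜) A.m

/-- All components of a morphism of `A∞`-algebras, as one map on the tensor algebra. -/
noncomputable def AInfHom.total {A : AInfAlgebra 𝓜} {A' : AInfAlgebra 𝓜'} (F : AInfHom A A') :
    TensorAlgebra R M →ₗ[R] M' :=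
  tensorLift F.f

/-- The map of bar constructions, on tensor algebras. -/
noncomputable def AInfHom.barMap {A : AInfAlgebra 𝓜} {A' : AInfAlgebra 𝓜'} (F : AInfHom A A') :
    TensorAlgebra R M →ₗ[R] TensorAlgebra R M' :=
  (geom F.total).ofConv

theorem AInfAlgebra.total_ι (A : AInfAlgebra 𝓜) (a : M) :
    A.total (TensorAlgebra.ι R a) = A.m₁ a :=
  tensorLift_ι A.m a

theorem AInfHom.total_ι {A : AInfAlgebra 𝓜} {A' : AInfAlgebra 𝓜'} (F : AInfHom A A') (a : M) :
    F.total (TensorAlgebra.ι R a) = F.f₁ a :=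
  tensorLift_ι F.f a

theorem AInfAlgebra.barDiff_tprod (A : AInfAlgebra 𝓜) {n : ℕ} (a : Fin n → M) :
    A.barDiff (TensorAlgebra.tprod R M n a) = ∑ k : Fin n, ∑ j : Fin (n - k),
      TensorAlgebra.tprod R M (n - j) (contractArgs (suspSign 𝓜) A.m k j a) :=
  coderiv_tprod _ _ A.m_zero a

/-- All `A∞` relations at once: on words of length n this is the relation of arity n. -/
theorem AInfAlgebra.total_comp_barDiff (A : AInfAlgebra 𝓜) : A.total ∘ₗ A.barDiff = 0 := by
  refine linearMap_ext_tprod fun n a => ?_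
  rw [LinearMap.comp_apply, A.barDiff_tprod, LinearMap.zero_apply]
  simp only [map_sum, AInfAlgebra.total, tensorLift_tprod]
  exact A.relation n a

theorem AInfAlgebra.hasDeg_total (A : AInfAlgebra 𝓜) :
    HasDeg (wordGrading 𝓜) 𝓜 (-2) A.total := hasDeg_tensorLift A.m_mem

theorem AInfHom.hasDeg_total {A : AInfAlgebra 𝓜} {A' : AInfAlgebra 𝓜'} (F : AInfHom A A') :
    HasDeg (wordGrading 𝓜) 𝓜' (-1) F.total := hasDeg_tensorLift F.f_mem

section Connected

variable [Coalgebra R C] {𝒞 : ℤ → Submodule R C} (h𝒞 : IsGradedCoalgebra 𝒞)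
  (hM : IsConnected 𝓜) {g : C →ₗ[R] M} (hg : HasDeg 𝒞 𝓜 (-1) g)

omit [Coalgebra R C] [DirectSum.Decomposition 𝓜] in
include hM hg in
-- In degrees j < 2 the values lie in degree j - 1 ≤ 0. This makes all geometric series converge.
theorem vanishBelow_two : VanishBelow 𝒞 2 g := hg.vanishBelow fun j hj => hM j (by linarith)

omit [Coalgebra R C] [DirectSum.Decomposition 𝓜] in
include hM hg in
theorem vanishBelow_letterMap : VanishBelow 𝒞 1 (letterMap g).ofConv :=
  ((vanishBelow_two hM hg).mono one_le_two).comp_left (TensorAlgebra.ι R)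

include h𝒞 hM hg

omit [DirectSum.Decomposition 𝓜] in
theorem isUnit_one_sub_letterMap : IsUnit (1 - letterMap g) :=
  isUnit_one_sub h𝒞 (vanishBelow_letterMap hM hg)

omit [DirectSum.Decomposition 𝓜] in
theorem vanishBelow_geom_sub (n : ℕ) :
    VanishBelow 𝒞 n (geom g - ∑ i ∈ Finset.range n, letterMap g ^ i).ofConv :=
  vanishBelow_inverse_one_sub_sub h𝒞 (vanishBelow_letterMap hM hg) n

omit [DirectSum.Decomposition 𝓜] in
theorem vanishBelow_geom : VanishBelow 𝒞 0 (geom g).ofConv := by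
  simpa using vanishBelow_geom_sub h𝒞 hM hg 0

omit [DirectSum.Decomposition 𝓜] in
theorem vanishBelow_geom_sub_one : VanishBelow 𝒞 1 (geom g - 1).ofConv := by
  simpa using vanishBelow_geom_sub h𝒞 hM hg 1

omit [DirectSum.Decomposition 𝓜] in
theorem hasDeg_geom : HasDeg 𝒞 (wordGrading 𝓜) 0 (geom g).ofConv := by
  have hpow : ∀ i : ℕ, HasDeg 𝒞 (wordGrading 𝓜) 0 (letterMap g ^ i).ofConv := by
    intro i
    induction i with
    | zero =>
      rw [pow_zero]
      exact HasDeg.one h𝒞 (𝒜 := wordGrading 𝓜) one_mem_wordGrading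
    | succ i ih =>
      have h2 : HasDeg 𝒞 (wordGrading 𝓜) 0 (letterMap g).ofConv :=
        hasDeg_letterMap hg (by norm_num)
      rw [pow_succ]
      exact (ih.mul h𝒞 mul_mem_wordGrading h2).congr (add_zero 0)
  intro n x hx
  have h1 := vanishBelow_geom_sub h𝒞 hM hg (n.toNat + 1) n
    (by have := Int.self_le_toNat n; push_cast; linarith) x hx
  rw [ofConv_sub, LinearMap.sub_apply, sub_eq_zero] at h1
  rw [h1, ofConv_sum, LinearMap.sum_apply]
  refine Submodule.sum_mem _ fun i _ => ?_
  exact hpow i n x hx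

end Connected

theorem AInfHom.isUnit {A : AInfAlgebra 𝓜} {A' : AInfAlgebra 𝓜'} (F : AInfHom A A')
    (hM' : IsConnected 𝓜') : IsUnit (1 - letterMap F.total) :=
  isUnit_one_sub_letterMap (isGradedCoalgebra_tensorAlgebra 𝓜) hM' F.hasDeg_total

theorem AInfHom.barMap_tprod {A : AInfAlgebra 𝓜} {A' : AInfAlgebra 𝓜'} (F : AInfHom A A')
    (hM' : IsConnected 𝓜') {n : ℕ} (a : Fin n → M) :
    F.barMap (TensorAlgebra.tprod R M n a) = ∑ c : Composition n,
      TensorAlgebra.tprod R M' c.length fun i => F.f (c.blocksFun i) (a ∘ c.embedding i) :=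
  geom_tensorLift_tprod _ F.f_zero (F.isUnit hM') a

/-- The morphism equations in all arities at once. Equivalently, `F.total` is a twisting cochain on
the tensor coalgebra. -/
theorem AInfHom.total_comp_barDiff {A : AInfAlgebra 𝓜} {A' : AInfAlgebra 𝓜'} (F : AInfHom A A')
    (hM' : IsConnected 𝓜') : F.total ∘ₗ A.barDiff = A'.total ∘ₗ F.barMap := by
  refine linearMap_ext_tprod fun n a => ?_
  rw [LinearMap.comp_apply, A.barDiff_tprod, LinearMap.comp_apply, F.barMap_tprod hM']
  simp only [map_sum, AInfAlgebra.total, AInfHom.total, tensorLift_tprod]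
  exact F.relation n a

theorem AInfAlgebra.barDiff_eq (A : AInfAlgebra 𝓜) :
    toConv A.barDiff = toConv (letterwise (suspSign 𝓜)).toLinearMap * letterMap A.total *
      toConv LinearMap.id := rfl

theorem isComulHom_letterwise_suspSign :
    IsComulHom (letterwise (suspSign 𝓜)).toLinearMap :=
  isComulHom_invol (isGradedCoalgebra_tensorAlgebra 𝓜) letterwise_suspSign_apply

theorem hasDeg_letterwise_suspSign :
    HasDeg (wordGrading 𝓜) (wordGrading 𝓜) 0 (letterwise (suspSign 𝓜)).toLinearMap :=
  fun n x hx => by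
    rw [AlgHom.toLinearMap_apply, letterwise_suspSign_apply n x hx, add_zero]
    exact zsmul_mem hx _

theorem AInfAlgebra.hasDeg_barDiff (A : AInfAlgebra 𝓜) :
    HasDeg (wordGrading 𝓜) (wordGrading 𝓜) (-1) A.barDiff := by
  have h := isGradedCoalgebra_tensorAlgebra 𝓜
  have h1 : HasDeg (wordGrading 𝓜) (wordGrading 𝓜) (0 + -1 + 0) (toConv A.barDiff).ofConv := by
    rw [A.barDiff_eq]
    refine HasDeg.mul h mul_mem_wordGrading (HasDeg.mul h mul_mem_wordGrading
      hasDeg_letterwise_suspSign (hasDeg_letterMap A.hasDeg_total (by norm_num))) ?_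
    intro n x hx
    rwa [add_zero]
  exact h1.congr (by norm_num)

theorem AInfAlgebra.isDGCoalgebra (A : AInfAlgebra 𝓜) :
    IsDGCoalgebra (wordGrading 𝓜) (letterwise (suspSign 𝓜)).toLinearMap A.barDiff where
  toIsGradedCoalgebra := isGradedCoalgebra_tensorAlgebra 𝓜
  invol_apply := letterwise_suspSign_apply
  hasDeg_d := A.hasDeg_barDiff
  counit_d := by
    have h1 : convMap (TensorAlgebra.algebraMapInv (R := R) (M := M)) (letterMap A.total) = 0 := by
      ext x
      exact counit_ι (R := R) (A.total x)
    have h2 := congrArg (convMap (TensorAlgebra.algebraMapInv (R := R) (M := M))) A.barDiff_eq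
    rw [map_mul, map_mul, h1, mul_zero, zero_mul] at h2
    exact congrArg WithConv.ofConv h2
  comul_d := by
    rw [add_comm]
    exact comul_comp_mul_letterMap_mul (P := toConv (letterwise (suspSign 𝓜)).toLinearMap)
      (X := toConv LinearMap.id) isComulHom_letterwise_suspSign isComulHom_id A.total

section Cochains

variable [Coalgebra R C] {𝒞 : ℤ → Submodule R C} {σ d : C →ₗ[R] C}
  (h𝒞 : IsDGCoalgebra 𝒞 σ d) (hM : IsConnected 𝓜)

include h𝒞

/-- A map of degree k into M has degree k + 1 into the suspension, so moving the sign involution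
from target to source costs the sign of k + 1. There is no sign for twisting cochains, and a minus
sign for homotopies. -/
theorem suspSign_comp_eq {k : ℤ} {g : C →ₗ[R] M} (hg : HasDeg 𝒞 𝓜 k g) :
    suspSign 𝓜 ∘ₗ g = (((k + 1).negOnePow : ℤˣ) : ℤ) • g ∘ₗ σ := by
  refine linearMap_ext_of_iSup_eq_top h𝒞.iSup_eq_top fun n x hx => ?_
  rw [LinearMap.comp_apply, suspSign, LinearMap.neg_apply, gradeInvol_of_mem 𝓜 (hg n x hx),
    LinearMap.smul_apply, LinearMap.comp_apply, h𝒞.invol_apply n x hx, map_zsmul,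
    Int.negOnePow_add, Int.negOnePow_succ, smul_smul]
  simp [mul_comm]

theorem convMap_letterwise_letterMap {k : ℤ} {g : C →ₗ[R] M} (hg : HasDeg 𝒞 𝓜 k g) :
    convMap (letterwise (suspSign 𝓜)) (letterMap g) =
      (((k + 1).negOnePow : ℤˣ) : ℤ) • precomp σ (letterMap g) := by
  have := suspSign_comp_eq h𝒞 hg
  ext x
  have hx := LinearMap.congr_fun this x
  simp only [LinearMap.comp_apply, LinearMap.smul_apply] at hx
  rw [convMap_apply, letterMap_apply, letterwise_ι, hx, map_zsmul]
  rfl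

include hM

theorem precomp_invol_geom {g : C →ₗ[R] M} (hg : HasDeg 𝒞 𝓜 (-1) g) :
    precomp σ (geom g) = geom (g ∘ₗ σ) := by
  have hg' : HasDeg 𝒞 𝓜 (-1) (g ∘ₗ σ) := by simpa using hg.comp h𝒞.hasDeg_invol
  refine eq_geom (isUnit_one_sub_letterMap h𝒞.toIsGradedCoalgebra hM hg') ?_
  conv_lhs => rw [geom_eq (isUnit_one_sub_letterMap h𝒞.toIsGradedCoalgebra hM hg), map_add,
    h𝒞.precomp_invol_mul, h𝒞.precomp_invol_one]
  rfl

theorem convMap_letterwise_geom {g : C →ₗ[R] M} (hg : HasDeg 𝒞 𝓜 (-1) g) :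
    convMap (letterwise (suspSign 𝓜)) (geom g) = precomp σ (geom g) := by
  have hg' : HasDeg 𝒞 𝓜 (-1) (g ∘ₗ σ) := by simpa using hg.comp h𝒞.hasDeg_invol
  rw [precomp_invol_geom h𝒞 hM hg]
  refine eq_geom (isUnit_one_sub_letterMap h𝒞.toIsGradedCoalgebra hM hg') ?_
  conv_lhs => rw [geom_eq (isUnit_one_sub_letterMap h𝒞.toIsGradedCoalgebra hM hg), map_add,
    map_mul, map_one, convMap_letterwise_letterMap h𝒞 hg]
  simp
  rfl

/-- The Leibniz rule applied to the fixed point equation gives a linear equation for the left-hand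
side. Its coefficient is the sign twist of `1 - letterMap g`, with inverse the sign twist of `geom
g`. -/
theorem precomp_d_geom {g : C →ₗ[R] M} (hg : HasDeg 𝒞 𝓜 (-1) g) :
    precomp d (geom g) = precomp σ (geom g) * letterMap (g ∘ₗ d) * geom g := by
  have hu := isUnit_one_sub_letterMap h𝒞.toIsGradedCoalgebra hM hg
  have h1 : precomp d (geom g) =
      letterMap (g ∘ₗ d) * geom g + precomp σ (letterMap g) * precomp d (geom g) := by
    conv_lhs => rw [geom_eq hu, map_add, h𝒞.precomp_d_mul, h𝒞.precomp_d_one, zero_add]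
    rfl
  have h2 : precomp σ (geom g) * (1 - precomp σ (letterMap g)) = 1 := by
    have := congrArg (precomp σ) (geom_mul_one_sub hu)
    rwa [h𝒞.precomp_invol_mul, map_sub, h𝒞.precomp_invol_one] at this
  calc precomp d (geom g) = precomp σ (geom g) * (1 - precomp σ (letterMap g)) *
        precomp d (geom g) := by rw [h2, one_mul]
    _ = precomp σ (geom g) * (letterMap (g ∘ₗ d) * geom g) := by
        rw [mul_assoc]
        congr 1
        rw [sub_mul, one_mul, sub_eq_iff_eq_add]
        exact h1
    _ = _ := (mul_assoc _ _ _).symm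

/-- The bar differential is itself a convolution product of three factors, and precomposition with
the coalgebra map `geom g` may be carried out factor by factor. -/
theorem postcomp_barDiff_geom (A : AInfAlgebra 𝓜) {g : C →ₗ[R] M} (hg : HasDeg 𝒞 𝓜 (-1) g) :
    postcomp A.barDiff (geom g) =
      precomp σ (geom g) * letterMap (A.total ∘ₗ (geom g).ofConv) * geom g := by
  have hu := isUnit_one_sub_letterMap h𝒞.toIsGradedCoalgebra hM hg
  have h1 : comul ∘ₗ (geom g).ofConv = TensorProduct.map (geom g).ofConv (geom g).ofConv ∘ₗ comul :=
    isComulHom_geom hu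
  have h2 := mul_comp_of_comul_comp_eq
    (toConv (letterwise (suspSign 𝓜)).toLinearMap * letterMap A.total) (toConv LinearMap.id) h1
  rw [mul_comp_of_comul_comp_eq (toConv (letterwise (suspSign 𝓜)).toLinearMap)
    (letterMap A.total) h1] at h2
  rw [← convMap_letterwise_geom h𝒞 hM hg]
  exact h2

/-- The failure of `geom g` to commute with differentials. -/
theorem postcomp_barDiff_sub_precomp_d (A : AInfAlgebra 𝓜) {g : C →ₗ[R] M}
    (hg : HasDeg 𝒞 𝓜 (-1) g) :
    postcomp A.barDiff (geom g) - precomp d (geom g) =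
      precomp σ (geom g) * letterMap (A.total ∘ₗ (geom g).ofConv - g ∘ₗ d) * geom g := by
  rw [postcomp_barDiff_geom h𝒞 hM A hg, precomp_d_geom h𝒞 hM hg, letterMap_sub, mul_sub, sub_mul]

end Cochains

end Bar


/-! ### Defects of approximate cochains and homotopies to first order -/

section Obstruction

variable {R C M M' : Type*} [CommRing R] [AddCommGroup C] [Module R C] [AddCommGroup M] [Module R M]
  [AddCommGroup M'] [Module R M'] {𝓜 : ℤ → Submodule R M} [DirectSum.Decomposition 𝓜]
  {𝓜' : ℤ → Submodule R M'} [DirectSum.Decomposition 𝓜'] [Coalgebra R C]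
  {𝒞 : ℤ → Submodule R C} {σ d : C →ₗ[R] C}

/-- The homotopy of coalgebra maps with component `c`, between the maps with components `φ`
and `χ`. -/
noncomputable def homotopyMap (σ : C →ₗ[R] C) (φ c χ : C →ₗ[R] M) :
    WithConv (C →ₗ[R] TensorAlgebra R M) :=
  precomp σ (geom φ) * letterMap c * geom χ

theorem neg_convMul {A : Type*} [Ring A] [Algebra R A] (u v : WithConv (C →ₗ[R] A)) :
    -u * v = -(u * v) := by
  rw [eq_neg_iff_add_eq_zero, ← add_mul, neg_add_cancel, zero_mul]

/-- P and Q are 1 plus terms of positive degree, so to leading order they may be deleted. All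
first-order computations below rest on this. -/
theorem vanishBelow_sandwich_sub {A : Type*} [Ring A] [Algebra R A] (h𝒞 : IsGradedCoalgebra 𝒞)
    {P L Q : WithConv (C →ₗ[R] A)} {n : ℤ} (hP : VanishBelow 𝒞 1 (P - 1).ofConv)
    (hL : VanishBelow 𝒞 n L.ofConv) (hQ : VanishBelow 𝒞 1 (Q - 1).ofConv) :
    VanishBelow 𝒞 (n + 1) (P * L * Q - L).ofConv := by
  have h0 : VanishBelow 𝒞 0 Q.ofConv := by
    have := (hQ.mono zero_le_one).add (VanishBelow.one h𝒞 (A := A))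
    rwa [← ofConv_add, sub_add_cancel] at this
  have : P * L * Q - L = (P - 1) * L * Q + L * (Q - 1) := by
    simp only [sub_mul, mul_sub, mul_one, one_mul]
    abel
  rw [this]
  exact (((hP.mul h𝒞 hL).mul h𝒞 h0).mono (by linarith)).add (hL.mul h𝒞 hQ)

section

variable (h𝒞 : IsDGCoalgebra 𝒞 σ d) (hM : IsConnected 𝓜) {φ c χ : C →ₗ[R] M}
  (hφ : HasDeg 𝒞 𝓜 (-1) φ) (hc : HasDeg 𝒞 𝓜 0 c) (hχ : HasDeg 𝒞 𝓜 (-1) χ)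

include h𝒞

theorem IsDGCoalgebra.vanishBelow_precomp_invol {A : Type*} [AddCommGroup A] [Module R A] {n : ℤ}
    {g : WithConv (C →ₗ[R] A)} (hg : VanishBelow 𝒞 n g.ofConv) :
    VanishBelow 𝒞 n (precomp σ g).ofConv :=
  (hg.comp_right h𝒞.hasDeg_invol).mono (by simp)

include hM

theorem vanishBelow_precomp_geom_sub_one (hφ : HasDeg 𝒞 𝓜 (-1) φ) :
    VanishBelow 𝒞 1 (precomp σ (geom φ) - 1).ofConv := by
  have := h𝒞.vanishBelow_precomp_invol
    (vanishBelow_geom_sub_one h𝒞.toIsGradedCoalgebra hM hφ)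
  rwa [map_sub, h𝒞.precomp_invol_one] at this

include hφ hc hχ

/-- Applying the coderivation rule for `homotopyMap` twice, the operation falls on a block before,
around or after the letter from c. In the last case it passes c, which has odd degree into the
suspension; hence the minus sign. -/
theorem postcomp_barDiff_homotopyMap (A : AInfAlgebra 𝓜) :
    postcomp A.barDiff (homotopyMap σ φ c χ) =
      geom φ * precomp σ (letterMap (A.total ∘ₗ (geom φ).ofConv)) * homotopyMap σ φ c χ +
      geom φ * letterMap (A.total ∘ₗ (homotopyMap σ φ c χ).ofConv) * geom χ -
      geom φ * precomp σ (letterMap c) * precomp σ (geom χ) *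
        letterMap (A.total ∘ₗ (geom χ).ofConv) * geom χ := by
  have hφσ : HasDeg 𝒞 𝓜 (-1) (φ ∘ₗ σ) := by simpa using hφ.comp h𝒞.hasDeg_invol
  have hP : IsComulHom (precomp σ (geom φ)).ofConv := by
    rw [precomp_invol_geom h𝒞 hM hφ]
    exact isComulHom_geom (isUnit_one_sub_letterMap h𝒞.toIsGradedCoalgebra hM hφσ)
  have hX : IsComulHom (geom χ).ofConv :=
    isComulHom_geom (isUnit_one_sub_letterMap h𝒞.toIsGradedCoalgebra hM hχ)
  have hH := comul_comp_mul_letterMap_mul hP hX c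
  have h1 := mul_comp_of_comul_comp_eq_add
    (toConv (letterwise (suspSign 𝓜)).toLinearMap * letterMap A.total) (toConv LinearMap.id) hH
  rw [mul_comp_of_comul_comp_eq (toConv (letterwise (suspSign 𝓜)).toLinearMap)
    (letterMap A.total) hP, mul_comp_of_comul_comp_eq_add
    (toConv (letterwise (suspSign 𝓜)).toLinearMap) (letterMap A.total) hH] at h1
  have hSP : convMap (letterwise (suspSign 𝓜)) (precomp σ (geom φ)) = geom φ := by
    have := congrArg (precomp σ) (convMap_letterwise_geom h𝒞 hM hφ)
    rw [h𝒞.precomp_invol_precomp_invol] at this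
    exact this
  have hSH : convMap (letterwise (suspSign 𝓜)) (homotopyMap σ φ c χ) =
      -(geom φ * precomp σ (letterMap c) * precomp σ (geom χ)) := by
    rw [homotopyMap, map_mul, map_mul, hSP, convMap_letterwise_geom h𝒞 hM hχ,
      convMap_letterwise_letterMap h𝒞 hc]
    simp
  have h2 : postcomp A.barDiff (homotopyMap σ φ c χ) =
      convMap (letterwise (suspSign 𝓜)) (precomp σ (geom φ)) *
        precomp σ (letterMap (A.total ∘ₗ (geom φ).ofConv)) * homotopyMap σ φ c χ +
      (convMap (letterwise (suspSign 𝓜)) (precomp σ (geom φ)) *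
        letterMap (A.total ∘ₗ (homotopyMap σ φ c χ).ofConv) +
      convMap (letterwise (suspSign 𝓜)) (homotopyMap σ φ c χ) *
        letterMap (A.total ∘ₗ (geom χ).ofConv)) * geom χ := h1
  rw [h2, hSP, hSH]
  simp only [add_mul, neg_mul]
  abel

/-- The failure of `homotopyMap σ φ c χ` to be a homotopy between `geom φ` and `geom χ`. -/
theorem geom_sub_geom_sub_homotopy (A : AInfAlgebra 𝓜)
    (hφd : A.total ∘ₗ (geom φ).ofConv = φ ∘ₗ d) :
    geom φ - geom χ - postcomp A.barDiff (homotopyMap σ φ c χ) -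
        precomp d (homotopyMap σ φ c χ) =
      geom φ * letterMap (φ - χ - A.total ∘ₗ (homotopyMap σ φ c χ).ofConv - c ∘ₗ d) * geom χ +
      geom φ * precomp σ (letterMap c) * precomp σ (geom χ) *
        letterMap (A.total ∘ₗ (geom χ).ofConv - χ ∘ₗ d) * geom χ := by
  have h1 : precomp d (homotopyMap σ φ c χ) =
      -(geom φ * precomp σ (letterMap (φ ∘ₗ d)) * homotopyMap σ φ c χ) +
      geom φ * (letterMap (c ∘ₗ d) * geom χ +
        precomp σ (letterMap c) * (precomp σ (geom χ) * letterMap (χ ∘ₗ d) * geom χ)) := by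
    have h2 : precomp d (letterMap c) = letterMap (c ∘ₗ d) := rfl
    rw [homotopyMap, mul_assoc, h𝒞.precomp_d_mul, h𝒞.precomp_d_mul, h𝒞.precomp_d_precomp_invol,
      h𝒞.precomp_invol_precomp_invol, precomp_d_geom h𝒞 hM hφ, precomp_d_geom h𝒞 hM hχ,
      h𝒞.precomp_invol_mul, h𝒞.precomp_invol_mul, h𝒞.precomp_invol_precomp_invol, h2]
    rw [neg_convMul]
    simp only [mul_assoc]
  -- Because φ is twisting, the terms in which an operation or the differential falls before c
  -- cancel. The resolvent identity writes the difference of the two coalgebra maps as a sandwich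
  -- like the other terms.
  rw [postcomp_barDiff_homotopyMap h𝒞 hM hφ hc hχ, h1, hφd,
    geom_sub_geom (isUnit_one_sub_letterMap h𝒞.toIsGradedCoalgebra hM hφ)
      (isUnit_one_sub_letterMap h𝒞.toIsGradedCoalgebra hM hχ)]
  simp only [letterMap_sub, mul_sub, sub_mul, mul_add, mul_assoc]
  abel

end

variable {A : AInfAlgebra 𝓜} {A' : AInfAlgebra 𝓜'} (F : AInfHom A A')

/-- The failure of `ψ` to be a twisting cochain. -/
noncomputable def cochainDefect (A : AInfAlgebra 𝓜) (d : C →ₗ[R] C) (ψ : C →ₗ[R] M) : C →ₗ[R] M :=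
  A.total ∘ₗ (geom ψ).ofConv - ψ ∘ₗ d

/-- The composite of `ψ` with the morphism `F`. -/
noncomputable def AInfHom.push (ψ : C →ₗ[R] M) : C →ₗ[R] M' := F.total ∘ₗ (geom ψ).ofConv

/-- The failure of `c` to be an equivalence between `φ` and `χ`. -/
noncomputable def homotopyDefect (A : AInfAlgebra 𝓜) (σ d : C →ₗ[R] C) (φ c χ : C →ₗ[R] M) :
    C →ₗ[R] M :=
  φ - χ - A.total ∘ₗ (homotopyMap σ φ c χ).ofConv - c ∘ₗ d

variable (h𝒞 : IsDGCoalgebra 𝒞 σ d) (hd : ∀ x, d (d x) = 0) (hM : IsConnected 𝓜)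
  (hM' : IsConnected 𝓜') {φ c c₂ : C →ₗ[R] M'} {ψ ψ₂ : C →ₗ[R] M}
  (hφ : HasDeg 𝒞 𝓜' (-1) φ) (hc : HasDeg 𝒞 𝓜' 0 c) (hψ : HasDeg 𝒞 𝓜 (-1) ψ)
  (hψ₂ : HasDeg 𝒞 𝓜 (-1) ψ₂) {n : ℤ}

include h𝒞 hM

theorem hasDeg_homotopyMap {c χ φ : C →ₗ[R] M} (hφ : HasDeg 𝒞 𝓜 (-1) φ) (hc : HasDeg 𝒞 𝓜 0 c)
    (hχ : HasDeg 𝒞 𝓜 (-1) χ) :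
    HasDeg 𝒞 (wordGrading 𝓜) 1 (homotopyMap σ φ c χ).ofConv := by
  have h0 := hasDeg_geom h𝒞.toIsGradedCoalgebra hM hφ
  have h1 : HasDeg 𝒞 (wordGrading 𝓜) 0 (precomp σ (geom φ)).ofConv := by
    exact (h0.comp h𝒞.hasDeg_invol).congr (add_zero 0)
  have h2 : HasDeg 𝒞 (wordGrading 𝓜) 1 (letterMap c).ofConv := hasDeg_letterMap hc (by norm_num)
  have h3 := hasDeg_geom h𝒞.toIsGradedCoalgebra hM hχ
  exact ((h1.mul h𝒞.toIsGradedCoalgebra mul_mem_wordGrading h2).mul h𝒞.toIsGradedCoalgebra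
    mul_mem_wordGrading h3).congr (by norm_num)

theorem hasDeg_cochainDefect (A : AInfAlgebra 𝓜) (hψ : HasDeg 𝒞 𝓜 (-1) ψ) :
    HasDeg 𝒞 𝓜 (-2) (cochainDefect A d ψ) :=
  HasDeg.sub ((A.hasDeg_total.comp (hasDeg_geom h𝒞.toIsGradedCoalgebra hM hψ)).congr (by norm_num))
    ((hψ.comp h𝒞.hasDeg_d).congr (by norm_num))

theorem AInfHom.hasDeg_push (hψ : HasDeg 𝒞 𝓜 (-1) ψ) : HasDeg 𝒞 𝓜' (-1) (F.push ψ) :=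
  (F.hasDeg_total.comp (hasDeg_geom h𝒞.toIsGradedCoalgebra hM hψ)).congr (by norm_num)

theorem hasDeg_homotopyDefect (A : AInfAlgebra 𝓜) {φ c χ : C →ₗ[R] M} (hφ : HasDeg 𝒞 𝓜 (-1) φ)
    (hc : HasDeg 𝒞 𝓜 0 c) (hχ : HasDeg 𝒞 𝓜 (-1) χ) :
    HasDeg 𝒞 𝓜 (-1) (homotopyDefect A σ d φ c χ) :=
  HasDeg.sub (HasDeg.sub (hφ.sub hχ)
    ((A.hasDeg_total.comp (hasDeg_homotopyMap h𝒞 hM hφ hc hχ)).congr (by norm_num)))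
    ((hc.comp h𝒞.hasDeg_d).congr (by norm_num))

include hψ

theorem vanishBelow_defect_sub (h : VanishBelow 𝒞 n (cochainDefect A d ψ)) :
    VanishBelow 𝒞 (n + 1) (postcomp A.barDiff (geom ψ) - precomp d (geom ψ) -
      letterMap (cochainDefect A d ψ)).ofConv := by
  rw [postcomp_barDiff_sub_precomp_d h𝒞 hM A hψ]
  exact vanishBelow_sandwich_sub h𝒞.toIsGradedCoalgebra
    (vanishBelow_precomp_geom_sub_one h𝒞 hM hψ) (h.comp_left (TensorAlgebra.ι R))
    (vanishBelow_geom_sub_one h𝒞.toIsGradedCoalgebra hM hψ)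

theorem ι_cochainDefect (h : VanishBelow 𝒞 n (cochainDefect A d ψ)) {x : C} (hx : x ∈ 𝒞 n) :
    TensorAlgebra.ι R (cochainDefect A d ψ x) = A.barDiff (geom ψ x) - geom ψ (d x) := by
  have := vanishBelow_defect_sub h𝒞 hM hψ h n (by linarith) x hx
  rw [ofConv_sub, LinearMap.sub_apply, sub_eq_zero] at this
  exact this.symm

include hd in
-- To leading order the defect is the commutator of `geom ψ` with the differentials. `A.total` kills
-- the part starting with `barDiff`; the other part is the defect at d x, of lower degree and hence
-- zero, since ψ (d (d x)) = 0.
theorem m₁_cochainDefect (h : VanishBelow 𝒞 n (cochainDefect A d ψ)) {x : C} (hx : x ∈ 𝒞 n) :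
    A.m₁ (cochainDefect A d ψ x) = 0 := by
  have h1 : A.total (A.barDiff (geom ψ x)) = 0 := LinearMap.congr_fun A.total_comp_barDiff _
  have h2 : cochainDefect A d ψ (d x) = 0 := h (n + -1) (by linarith) _ (h𝒞.hasDeg_d n x hx)
  have h3 : cochainDefect A d ψ (d x) = A.total (geom ψ (d x)) - ψ (d (d x)) := rfl
  rw [← A.total_ι, ι_cochainDefect h𝒞 hM hψ h hx, map_sub, h1, zero_sub, neg_eq_zero]
  rwa [h3, hd, map_zero, sub_zero] at h2

include hM'

theorem AInfHom.geom_push : geom (F.push ψ) = postcomp F.barMap (geom ψ) :=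
  (geom_comp_geom (isUnit_one_sub_letterMap h𝒞.toIsGradedCoalgebra hM hψ) (F.isUnit hM')
    (isUnit_one_sub_letterMap h𝒞.toIsGradedCoalgebra hM' (F.hasDeg_push h𝒞 hM hψ))).symm

/-- The morphism equations let `A'.total` after the bar map be replaced by `F.total` after
`A.barDiff`. So pushing forward turns the commutator of `geom ψ` into the new defect. -/
theorem AInfHom.cochainDefect_push :
    cochainDefect A' d (F.push ψ) =
      F.total ∘ₗ (postcomp A.barDiff (geom ψ) - precomp d (geom ψ)).ofConv := by
  have h1 := F.geom_push h𝒞 hM hM' hψ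
  refine LinearMap.ext fun x => ?_
  have h2 : cochainDefect A' d (F.push ψ) x =
    A'.total (geom (F.push ψ) x) - F.total (geom ψ (d x)) := rfl
  have h3 := LinearMap.congr_fun (F.total_comp_barDiff (A' := A') hM') (geom ψ x)
  simp only [LinearMap.comp_apply] at h3
  rw [h2, h1, postcomp_apply, ← h3]
  simp

theorem AInfHom.cochainDefect_push_apply (h : VanishBelow 𝒞 n (cochainDefect A d ψ)) {x : C}
    (hx : x ∈ 𝒞 n) :
    cochainDefect A' d (F.push ψ) x = F.f₁ (cochainDefect A d ψ x) := by
  rw [F.cochainDefect_push h𝒞 hM hM' hψ, ← F.total_ι, ι_cochainDefect h𝒞 hM hψ h hx]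
  rfl

theorem AInfHom.vanishBelow_cochainDefect_push (h : VanishBelow 𝒞 n (cochainDefect A d ψ)) :
    VanishBelow 𝒞 n (cochainDefect A' d (F.push ψ)) := by
  rw [F.cochainDefect_push h𝒞 hM hM' hψ]
  refine VanishBelow.comp_left ?_ _
  have := ((vanishBelow_defect_sub h𝒞 hM hψ h).mono (by linarith : n ≤ n + 1)).add
    (h.comp_left (TensorAlgebra.ι R))
  have h2 : (letterMap (cochainDefect A d ψ)).ofConv =
    TensorAlgebra.ι R ∘ₗ cochainDefect A d ψ := rfl
  rwa [← h2, ← ofConv_add, sub_add_cancel] at this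

include hφ hc hd in
-- Let χ be the pushforward of ψ and H the homotopy map. To leading order the defect is geom φ -
-- geom χ - barDiff H - H d at x. Applying `A'.total` kills the third term and yields φ (d x) from
-- the first and χ (d x) + f₁ e x from the second, where e is the defect of ψ. What is left besides
-- -f₁ e x is the homotopy defect at d x, which vanishes for degree reasons.
theorem m₁_homotopyDefect (hφd : cochainDefect A' d φ = 0)
    (h : VanishBelow 𝒞 n (cochainDefect A d ψ))
    (h' : VanishBelow 𝒞 n (homotopyDefect A' σ d φ c (F.push ψ))) {x : C} (hx : x ∈ 𝒞 n) :
    A'.m₁ (homotopyDefect A' σ d φ c (F.push ψ) x) = -F.f₁ (cochainDefect A d ψ x) := by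
  have hχ := F.hasDeg_push h𝒞 hM hψ
  have h𝒢 := h𝒞.toIsGradedCoalgebra
  have hE := geom_sub_geom_sub_homotopy h𝒞 hM' hφ hc hχ A' (sub_eq_zero.1 hφd)
  have hV1 : VanishBelow 𝒞 (n + 1) (geom φ * letterMap (homotopyDefect A' σ d φ c (F.push ψ)) *
      geom (F.push ψ) - letterMap (homotopyDefect A' σ d φ c (F.push ψ))).ofConv :=
    vanishBelow_sandwich_sub h𝒢 (vanishBelow_geom_sub_one h𝒢 hM' hφ)
      (h'.comp_left (TensorAlgebra.ι R)) (vanishBelow_geom_sub_one h𝒢 hM' hχ)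
  have hcV : VanishBelow 𝒞 1 (letterMap c).ofConv :=
    (hc.vanishBelow fun j hj => hM' j (by linarith)).comp_left _
  -- The pushed-forward defect vanishes below n, and the factor c, which vanishes below 1, gains one
  -- more degree.
  have hV2 : VanishBelow 𝒞 (n + 1) (geom φ * precomp σ (letterMap c) *
      precomp σ (geom (F.push ψ)) * letterMap (cochainDefect A' d (F.push ψ)) *
      geom (F.push ψ)).ofConv := by
    have h1 : VanishBelow 𝒞 n (letterMap (cochainDefect A' d (F.push ψ))).ofConv :=
      (F.vanishBelow_cochainDefect_push h𝒞 hM hM' hψ h).comp_left _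
    refine VanishBelow.mono (((((vanishBelow_geom h𝒢 hM' hφ).mul h𝒢
      (h𝒞.vanishBelow_precomp_invol hcV)).mul h𝒢
      (h𝒞.vanishBelow_precomp_invol (vanishBelow_geom h𝒢 hM' hχ))).mul h𝒢 h1).mul h𝒢
      (vanishBelow_geom h𝒢 hM' hχ)) (by linarith)
  have hEx : TensorAlgebra.ι R (homotopyDefect A' σ d φ c (F.push ψ) x) =
      geom φ x - geom (F.push ψ) x - A'.barDiff (homotopyMap σ φ c (F.push ψ) x) -
        homotopyMap σ φ c (F.push ψ) (d x) := by
    have h1 := (hV1.add hV2) n (by linarith) x hx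
    have h2 : geom φ x - geom (F.push ψ) x - A'.barDiff (homotopyMap σ φ c (F.push ψ) x) -
        homotopyMap σ φ c (F.push ψ) (d x) = _ := congrArg (fun g => g.ofConv x) hE
    rw [h2]
    rw [← ofConv_add, sub_add_eq_add_sub, ofConv_sub, LinearMap.sub_apply, sub_eq_zero] at h1
    exact h1.symm
  have hb : A'.total (A'.barDiff (homotopyMap σ φ c (F.push ψ) x)) = 0 :=
    LinearMap.congr_fun A'.total_comp_barDiff _
  have h1 : A'.total (geom φ x) - φ (d x) = 0 := LinearMap.congr_fun hφd x
  have h2 : A'.total (geom (F.push ψ) x) - F.push ψ (d x) = F.f₁ (cochainDefect A d ψ x) :=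
    F.cochainDefect_push_apply h𝒞 hM hM' hψ h hx
  have h3 : φ (d x) - F.push ψ (d x) - A'.total (homotopyMap σ φ c (F.push ψ) (d x)) -
    c (d (d x)) = 0 := h' (n + -1) (by linarith) _ (h𝒞.hasDeg_d n x hx)
  rw [hd, map_zero, sub_zero] at h3
  rw [← A'.total_ι, hEx, map_sub, map_sub, map_sub, hb, sub_zero, ← h2]
  rw [sub_eq_zero] at h1 h3
  rw [h1, ← h3]
  abel

omit hM' in
include hψ₂ in
theorem vanishBelow_geom_sub_geom_sub (hw : VanishBelow 𝒞 n (ψ₂ - ψ)) :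
    VanishBelow 𝒞 (n + 1) (geom ψ₂ - geom ψ - letterMap (ψ₂ - ψ)).ofConv := by
  have h𝒢 := h𝒞.toIsGradedCoalgebra
  rw [geom_sub_geom (isUnit_one_sub_letterMap h𝒢 hM hψ₂) (isUnit_one_sub_letterMap h𝒢 hM hψ)]
  exact vanishBelow_sandwich_sub h𝒢 (vanishBelow_geom_sub_one h𝒢 hM hψ₂)
    (hw.comp_left (TensorAlgebra.ι R)) (vanishBelow_geom_sub_one h𝒢 hM hψ)

omit hM' in
include hψ₂ in
/-- The defect to first order. -/
theorem vanishBelow_cochainDefect_sub (hw : VanishBelow 𝒞 n (ψ₂ - ψ)) :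
    VanishBelow 𝒞 (n + 1) (cochainDefect A d ψ₂ - cochainDefect A d ψ - A.m₁ ∘ₗ (ψ₂ - ψ)) := by
  -- The difference of ψ₂ and ψ composed with d vanishes one degree further up, because d lowers
  -- degrees. To first order only the letter part of the difference of the geometric series remains,
  -- on which `A.total` is m₁.
  have h1 := ((vanishBelow_geom_sub_geom_sub h𝒞 hM hψ hψ₂ hw).comp_left A.total).sub
    ((hw.comp_right h𝒞.hasDeg_d).mono (by linarith : n + 1 ≤ n - -1))
  convert h1 using 1
  refine LinearMap.ext fun x => ?_
  simp [cochainDefect, ← A.total_ι]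
  abel

omit hM' in
include hψ₂ in
theorem AInfHom.vanishBelow_push_sub (hw : VanishBelow 𝒞 n (ψ₂ - ψ)) :
    VanishBelow 𝒞 (n + 1) (F.push ψ₂ - F.push ψ - F.f₁ ∘ₗ (ψ₂ - ψ)) := by
  have h1 := (vanishBelow_geom_sub_geom_sub h𝒞 hM hψ hψ₂ hw).comp_left F.total
  convert h1 using 1
  refine LinearMap.ext fun x => ?_
  simp [AInfHom.push, ← F.total_ι]

include hψ₂ hφ hc in
-- To first order the pushforward changes by f₁ of the change of ψ, and the homotopy map by the
-- change of c.
theorem vanishBelow_homotopyDefect_sub (hw : VanishBelow 𝒞 n (ψ₂ - ψ))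
    (hy : VanishBelow 𝒞 n (c₂ - c)) :
    VanishBelow 𝒞 (n + 1) (homotopyDefect A' σ d φ c₂ (F.push ψ₂) -
      homotopyDefect A' σ d φ c (F.push ψ) + F.f₁ ∘ₗ (ψ₂ - ψ) + A'.m₁ ∘ₗ (c₂ - c)) := by
  have h𝒢 := h𝒞.toIsGradedCoalgebra
  have hχ := F.hasDeg_push h𝒞 hM hψ
  have hχ₂ := F.hasDeg_push h𝒞 hM hψ₂
  have h1 := F.vanishBelow_push_sub h𝒞 hM hψ hψ₂ hw
  have h2 : VanishBelow 𝒞 n (F.push ψ₂ - F.push ψ) := by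
    have := (h1.mono (by linarith : n ≤ n + 1)).add (hw.comp_left F.f₁)
    rwa [sub_add_cancel] at this
  have h3 : VanishBelow 𝒞 n (geom (F.push ψ₂) - geom (F.push ψ)).ofConv := by
    have := ((vanishBelow_geom_sub_geom_sub h𝒞 hM' hχ hχ₂ h2).mono
      (by linarith : n ≤ n + 1)).add (h2.comp_left (TensorAlgebra.ι R))
    have h2 : (letterMap (F.push ψ₂ - F.push ψ)).ofConv =
      TensorAlgebra.ι R ∘ₗ (F.push ψ₂ - F.push ψ) := rfl
    rwa [← h2, ← ofConv_add, sub_add_cancel] at this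
  have hcV : VanishBelow 𝒞 1 (letterMap c).ofConv :=
    (hc.vanishBelow fun j hj => hM' j (by linarith)).comp_left _
  have h4 : VanishBelow 𝒞 (n + 1) (homotopyMap σ φ c₂ (F.push ψ₂) -
      homotopyMap σ φ c (F.push ψ) - letterMap (c₂ - c)).ofConv := by
    -- The effect of ψ on the homotopy map is multiplied by c, which vanishes below degree 1; so it
    -- is of higher order.
    have h5 : homotopyMap σ φ c₂ (F.push ψ₂) - homotopyMap σ φ c (F.push ψ) -
        letterMap (c₂ - c) =
        (precomp σ (geom φ) * letterMap (c₂ - c) * geom (F.push ψ₂) - letterMap (c₂ - c)) +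
        precomp σ (geom φ) * letterMap c * (geom (F.push ψ₂) - geom (F.push ψ)) := by
      simp only [homotopyMap, letterMap_sub, mul_sub, sub_mul]
      abel
    rw [h5]
    refine VanishBelow.add (vanishBelow_sandwich_sub h𝒢
      (vanishBelow_precomp_geom_sub_one h𝒞 hM' hφ) (hy.comp_left (TensorAlgebra.ι R))
      (vanishBelow_geom_sub_one h𝒢 hM' hχ₂)) (VanishBelow.mono
      (((h𝒞.vanishBelow_precomp_invol (vanishBelow_geom h𝒢 hM' hφ)).mul h𝒢 hcV).mul h𝒢 h3)
      (by linarith))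
  have h6 := ((h1.neg).sub (h4.comp_left A'.total)).sub
    ((hy.comp_right h𝒞.hasDeg_d).mono (by linarith : n + 1 ≤ n - -1))
  convert h6 using 1
  refine LinearMap.ext fun x => ?_
  simp [homotopyDefect, ← A'.total_ι]
  abel

end Obstruction


/-! ### Adjoining a counit to the dg coalgebra K -/

section Augmented

variable {R K : Type*} [CommRing R] [AddCommGroup K] [Module R K] {𝒦 : ℤ → Submodule R K}
  [DirectSum.Decomposition 𝒦]

/-- The counital coalgebra `R ⊕ K`. -/
def DGCoalgebra.Aug (_ : DGCoalgebra 𝒦) : Type _ := R × K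

namespace DGCoalgebra

variable (C : DGCoalgebra 𝒦)

instance : AddCommGroup C.Aug := inferInstanceAs (AddCommGroup (R × K))

instance : Module R C.Aug := inferInstanceAs (Module R (R × K))

/-- The inclusion of `K` into `R ⊕ K`. -/
def incl : K →ₗ[R] C.Aug := LinearMap.inr R R K

/-- The projection of `R ⊕ K` to `K`. -/
def proj : C.Aug →ₗ[R] K := LinearMap.snd R R K

/-- The projection of `R ⊕ K` to `R`. -/
def augCounit : C.Aug →ₗ[R] R := LinearMap.fst R R K

/-- The grouplike element of `R ⊕ K`. -/
def unit : C.Aug := ((1 : R), (0 : K))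

@[simp] theorem proj_incl (x : K) : C.proj (C.incl x) = x := rfl

@[simp] theorem proj_unit : C.proj C.unit = 0 := rfl

@[simp] theorem augCounit_incl (x : K) : C.augCounit (C.incl x) = 0 := rfl

@[simp] theorem augCounit_unit : C.augCounit C.unit = 1 := rfl

theorem aug_eq (x : C.Aug) : x = C.augCounit x • C.unit + C.incl (C.proj x) := by
  obtain ⟨r, x⟩ := x
  refine Prod.ext ?_ ?_
  · change r = r * 1 + 0; simp
  · change x = r • (0 : K) + x; simp

theorem aug_ext {N : Type*} [AddCommGroup N] [Module R N] {g h : C.Aug →ₗ[R] N}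
    (h1 : g C.unit = h C.unit) (h2 : ∀ x, g (C.incl x) = h (C.incl x)) : g = h := by
  refine LinearMap.ext fun x => ?_
  rw [C.aug_eq x, map_add, map_add, map_smul, map_smul, h1, h2]

/-- The coproduct on `R ⊕ K`. -/
noncomputable def augComul : C.Aug →ₗ[R] C.Aug ⊗[R] C.Aug :=
  LinearMap.toSpanSingleton R _ (C.unit ⊗ₜ C.unit) ∘ₗ C.augCounit +
    ((TensorProduct.mk R _ _).flip C.unit ∘ₗ C.incl + TensorProduct.mk R _ _ C.unit ∘ₗ C.incl +
      TensorProduct.map C.incl C.incl ∘ₗ C.comul) ∘ₗ C.proj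

@[simp] theorem augComul_unit : C.augComul C.unit = C.unit ⊗ₜ C.unit := by
  simp [augComul]

theorem augComul_incl (x : K) : C.augComul (C.incl x) =
    C.incl x ⊗ₜ C.unit + C.unit ⊗ₜ C.incl x + TensorProduct.map C.incl C.incl (C.comul x) := by
  simp [augComul]

/-- Both sides expand into terms containing the grouplike element, which match one by one, and the
two iterated coproducts of K, which agree by coassociativity. The facts `h0`, `h1`, `h2` are these
expansions. -/
theorem augComul_coassoc : (TensorProduct.assoc R C.Aug C.Aug C.Aug) ∘ₗ
    C.augComul.rTensor C.Aug ∘ₗ C.augComul = C.augComul.lTensor C.Aug ∘ₗ C.augComul := by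
  have h0 : ∀ t : K ⊗[R] K, TensorProduct.assoc R C.Aug C.Aug C.Aug
      (TensorProduct.map C.incl C.incl t ⊗ₜ C.unit) =
      TensorProduct.map C.incl ((TensorProduct.mk R _ _).flip C.unit ∘ₗ C.incl) t := by
    intro t
    induction t using TensorProduct.induction_on with
    | zero => simp
    | tmul x y => simp
    | add s t hs ht => simp only [map_add, TensorProduct.add_tmul, hs, ht]
  have h1 : ∀ t : K ⊗[R] K, TensorProduct.assoc R C.Aug C.Aug C.Aug
      (C.augComul.rTensor C.Aug (TensorProduct.map C.incl C.incl t)) =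
      TensorProduct.map C.incl (TensorProduct.mk R _ _ C.unit ∘ₗ C.incl) t +
      C.unit ⊗ₜ TensorProduct.map C.incl C.incl t +
      TensorProduct.map C.incl (TensorProduct.map C.incl C.incl)
        (TensorProduct.assoc R K K K (C.comul.rTensor K t)) := by
    intro t
    induction t using TensorProduct.induction_on with
    | zero => simp
    | tmul x y =>
      simp only [TensorProduct.map_tmul, LinearMap.rTensor_tmul, augComul_incl,
        TensorProduct.add_tmul, map_add, TensorProduct.assoc_tmul, LinearMap.comp_apply,
        TensorProduct.mk_apply]
      congr 1
      induction C.comul x using TensorProduct.induction_on with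
      | zero => simp
      | tmul a b => simp
      | add s t hs ht => simp only [map_add, TensorProduct.add_tmul, hs, ht]
    | add s t hs ht =>
      simp only [map_add, TensorProduct.tmul_add, hs, ht]
      abel
  have h2 : ∀ t : K ⊗[R] K, C.augComul.lTensor C.Aug (TensorProduct.map C.incl C.incl t) =
      TensorProduct.map C.incl ((TensorProduct.mk R _ _).flip C.unit ∘ₗ C.incl) t +
      TensorProduct.map C.incl (TensorProduct.mk R _ _ C.unit ∘ₗ C.incl) t +
      TensorProduct.map C.incl (TensorProduct.map C.incl C.incl) (C.comul.lTensor K t) := by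
    intro t
    induction t using TensorProduct.induction_on with
    | zero => simp
    | tmul x y =>
      simp [augComul_incl, TensorProduct.tmul_add]
    | add s t hs ht =>
      simp only [map_add, hs, ht]
      abel
  refine C.aug_ext (by simp) fun x => ?_
  have hc := LinearMap.congr_fun C.coassoc x
  simp only [LinearMap.comp_apply, LinearEquiv.coe_coe] at hc
  simp only [LinearMap.comp_apply, LinearEquiv.coe_coe]
  rw [augComul_incl]
  simp only [map_add, LinearMap.rTensor_tmul, LinearMap.lTensor_tmul, augComul_incl, augComul_unit,
    TensorProduct.add_tmul, TensorProduct.tmul_add, TensorProduct.assoc_tmul, h0, h1, h2, hc]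
  abel

noncomputable instance : Coalgebra R C.Aug where
  comul := C.augComul
  counit := C.augCounit
  coassoc := C.augComul_coassoc
  rTensor_counit_comp_comul := by
    refine C.aug_ext (by simp) fun x => ?_
    rw [LinearMap.comp_apply, augComul_incl, map_add, map_add]
    have : ∀ t : K ⊗[R] K, C.augCounit.rTensor C.Aug (TensorProduct.map C.incl C.incl t) = 0 := by
      intro t
      induction t using TensorProduct.induction_on with
      | zero => simp
      | tmul x y => simp
      | add s t hs ht => rw [map_add, map_add, hs, ht, add_zero]
    simp [this]
  lTensor_counit_comp_comul := by
    refine C.aug_ext (by simp) fun x => ?_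
    rw [LinearMap.comp_apply, augComul_incl, map_add, map_add]
    have : ∀ t : K ⊗[R] K, C.augCounit.lTensor C.Aug (TensorProduct.map C.incl C.incl t) = 0 := by
      intro t
      induction t using TensorProduct.induction_on with
      | zero => simp
      | tmul x y => simp
      | add s t hs ht => rw [map_add, map_add, hs, ht, add_zero]
    simp [this]

theorem comul_aug : (Coalgebra.comul : C.Aug →ₗ[R] _) = C.augComul := rfl

theorem counit_aug : (Coalgebra.counit : C.Aug →ₗ[R] R) = C.augCounit := rfl

/-- The grading of `R ⊕ K`, with `R` in degree zero. -/
def augGrading (n : ℤ) : Submodule R C.Aug :=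
  (if n = 0 then (⊤ : Submodule R R) else ⊥).comap C.augCounit ⊓ (𝒦 n).comap C.proj

theorem incl_mem {n : ℤ} {x : K} (hx : x ∈ 𝒦 n) : C.incl x ∈ C.augGrading n :=
  ⟨by simp, hx⟩

theorem unit_mem : C.unit ∈ C.augGrading 0 := ⟨by simp, by simp⟩

theorem proj_mem {n : ℤ} {x : C.Aug} (hx : x ∈ C.augGrading n) : C.proj x ∈ 𝒦 n := hx.2

theorem augGrading_eq {n : ℤ} {x : C.Aug} (hx : x ∈ C.augGrading n) (hn : n ≠ 0) :
    x = C.incl (C.proj x) := by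
  have h1 : x ∈ (if n = 0 then (⊤ : Submodule R R) else ⊥).comap C.augCounit := hx.1
  rw [if_neg hn, Submodule.mem_comap, Submodule.mem_bot] at h1
  conv_lhs => rw [C.aug_eq x, h1, zero_smul, zero_add]

theorem augGrading_le {n : ℤ} {Q : Submodule R C.Aug} (h1 : n = 0 → C.unit ∈ Q)
    (h2 : ∀ x ∈ 𝒦 n, C.incl x ∈ Q) : C.augGrading n ≤ Q := by
  intro x hx
  by_cases hn : n = 0
  · rw [C.aug_eq x]
    exact add_mem (Submodule.smul_mem _ _ (h1 hn)) (h2 _ (C.proj_mem hx))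
  · rw [C.augGrading_eq hx hn]
    exact h2 _ (C.proj_mem hx)

/-- The grading involution of `R ⊕ K`. -/
noncomputable def augInvol : C.Aug →ₗ[R] C.Aug :=
  LinearMap.toSpanSingleton R _ C.unit ∘ₗ C.augCounit + C.incl ∘ₗ gradeInvol 𝒦 ∘ₗ C.proj

/-- The differential of `R ⊕ K`. -/
noncomputable def augD : C.Aug →ₗ[R] C.Aug := C.incl ∘ₗ C.d ∘ₗ C.proj

@[simp] theorem augInvol_unit : C.augInvol C.unit = C.unit := by simp [augInvol]

@[simp] theorem augInvol_incl (x : K) : C.augInvol (C.incl x) = C.incl (gradeInvol 𝒦 x) := by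
  simp [augInvol]

@[simp] theorem augD_unit : C.augD C.unit = 0 := by simp [augD]

@[simp] theorem augD_incl (x : K) : C.augD (C.incl x) = C.incl (C.d x) := by simp [augD]

theorem augD_augD (x : C.Aug) : C.augD (C.augD x) = 0 := by
  simp [augD, C.d_d]

theorem isDGCoalgebra : IsDGCoalgebra C.augGrading C.augInvol C.augD where
  iSup_eq_top := by
    classical
    rw [eq_top_iff]
    intro x _
    rw [C.aug_eq x, ← DirectSum.sum_support_decompose 𝒦 (C.proj x), map_sum]
    exact add_mem (Submodule.smul_mem _ _ (Submodule.mem_iSup_of_mem 0 C.unit_mem))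
      (Submodule.sum_mem _ fun p _ => Submodule.mem_iSup_of_mem p
        (C.incl_mem (SetLike.coe_mem _)))
  comul_mem n := by
    suffices h : C.augGrading n ≤ (⨆ p : ℤ, LinearMap.range (TensorProduct.map
        (C.augGrading p).subtype (C.augGrading (n - p)).subtype)).comap C.augComul from h
    refine C.augGrading_le ?_ fun x hx => ?_
    · rintro rfl
      rw [Submodule.mem_comap, augComul_unit]
      exact Submodule.mem_iSup_of_mem 0 ⟨⟨_, C.unit_mem⟩ ⊗ₜ ⟨_, C.unit_mem⟩, rfl⟩
    · rw [Submodule.mem_comap, augComul_incl]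
      refine add_mem (add_mem ?_ ?_) ?_
      · refine Submodule.mem_iSup_of_mem n ⟨⟨_, C.incl_mem hx⟩ ⊗ₜ ⟨C.unit, ?_⟩, rfl⟩
        rw [sub_self]
        exact C.unit_mem
      · refine Submodule.mem_iSup_of_mem 0 ⟨⟨_, C.unit_mem⟩ ⊗ₜ ⟨C.incl x, ?_⟩, rfl⟩
        rw [sub_zero]
        exact C.incl_mem hx
      · refine tensor_homogeneous_induction (C.comul_mem n x hx)
          (TensorProduct.map C.incl C.incl) _ fun p q hpq a ha b hb => ?_
        obtain rfl : q = n - p := by linarith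
        exact Submodule.mem_iSup_of_mem p ⟨⟨_, C.incl_mem ha⟩ ⊗ₜ ⟨_, C.incl_mem hb⟩, rfl⟩
  counit_eq_zero n x hx hn := by
    rw [C.augGrading_eq hx hn, counit_aug, augCounit_incl]
  invol_apply n := by
    have h : C.augGrading n ≤ LinearMap.eqLocus C.augInvol
        (((n.negOnePow : ℤˣ) : ℤ) • LinearMap.id) := by
      refine C.augGrading_le ?_ fun x hx => ?_
      · rintro rfl
        simp
      · rw [LinearMap.mem_eqLocus, augInvol_incl, gradeInvol_of_mem 𝒦 hx, map_zsmul]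
        rfl
    exact fun x hx => h hx
  hasDeg_d n x hx := C.incl_mem (C.d_mem n _ (C.proj_mem hx))
  counit_d := by
    refine C.aug_ext ?_ fun x => ?_ <;> simp [counit_aug]
  comul_d := by
    refine C.aug_ext (by simp [comul_aug]) fun x => ?_
    simp only [comul_aug, LinearMap.comp_apply, LinearMap.add_apply, augD_incl, augComul_incl,
      map_add, TensorProduct.map_tmul, LinearMap.id_apply, augD_unit, augInvol_incl, augInvol_unit,
      TensorProduct.tmul_zero, TensorProduct.zero_tmul]
    have hc := LinearMap.congr_fun C.comul_d x
    simp only [LinearMap.comp_apply, LinearMap.add_apply] at hc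
    have h1 : ∀ t : K ⊗[R] K, TensorProduct.map C.incl C.incl (C.d.rTensor K t) =
        TensorProduct.map C.augD LinearMap.id (TensorProduct.map C.incl C.incl t) := by
      intro t
      induction t using TensorProduct.induction_on with
      | zero => simp
      | tmul x y => simp
      | add s t hs ht => simp only [map_add, hs, ht]
    have h2 : ∀ t : K ⊗[R] K,
        TensorProduct.map C.incl C.incl (TensorProduct.map (gradeInvol 𝒦) C.d t) =
        TensorProduct.map C.augInvol C.augD (TensorProduct.map C.incl C.incl t) := by
      intro t
      induction t using TensorProduct.induction_on with
      | zero => simp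
      | tmul x y => simp
      | add s t hs ht => simp only [map_add, hs, ht]
    rw [hc, map_add, h1, h2]
    abel

end DGCoalgebra

end Augmented

/-! ### Iterated comultiplications as convolution powers -/

section Link

variable {R K M N : Type*} [CommRing R] [AddCommGroup K] [Module R K] {𝒦 : ℤ → Submodule R K}
  [DirectSum.Decomposition 𝒦] (C : DGCoalgebra 𝒦) [AddCommGroup M] [Module R M]
  [AddCommGroup N] [Module R N]

theorem toTensorAlgebra_map_mulEquiv {n : ℕ} (g : Fin (n + 1) → K →ₗ[R] M) (t : ⨂[R]^n K) (b : K) :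
    TensorPower.toTensorAlgebra (PiTensorProduct.map g
      (TensorPower.mulEquiv (R := R) (M := K) (n := n) (m := 1) (t ⊗ₜ
        (PiTensorProduct.subsingletonEquiv (R := R) (s := fun _ : Fin 1 => K) 0).symm b))) =
    TensorPower.toTensorAlgebra (PiTensorProduct.map (fun i => g i.castSucc) t) *
      TensorAlgebra.ι R (g (Fin.last n) b) := by
  induction t using PiTensorProduct.induction_on with
  | smul_tprod r a =>
    have h1 : (PiTensorProduct.subsingletonEquiv (R := R) (s := fun _ : Fin 1 => K) 0).symm b =
        PiTensorProduct.tprod R fun _ => b := by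
      rw [LinearEquiv.symm_apply_eq]
      simp
    have h2 := TensorPower.tprod_mul_tprod R a (fun _ : Fin 1 => b)
    rw [TensorPower.gMul_def] at h2
    rw [h1, ← TensorProduct.smul_tmul', map_smul, h2]
    simp only [map_smul, PiTensorProduct.map_tprod, TensorPower.toTensorAlgebra_tprod,
      smul_mul_assoc]
    congr 1
    rw [TensorAlgebra.tprod_apply, TensorAlgebra.tprod_apply, List.ofFn_succ', List.concat_eq_append,
      List.prod_append]
    have h3 : ∀ i : Fin n, Fin.append a (fun _ : Fin 1 => b) i.castSucc = a i := fun i =>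
      Fin.append_left a _ i
    have h4 : Fin.append a (fun _ : Fin 1 => b) (Fin.last n) = b :=
      Fin.append_right a (fun _ : Fin 1 => b) 0
    simp only [h3, h4, List.prod_singleton]
  | add s t hs ht =>
    simp only [TensorProduct.add_tmul, map_add, hs, ht, add_mul]

/-- A map on `K`, extended by zero to `R ⊕ K`. -/
def DGCoalgebra.extend (g : K →ₗ[R] M) : C.Aug →ₗ[R] M := g ∘ₗ C.proj

@[simp] theorem DGCoalgebra.extend_incl (g : K →ₗ[R] M) (x : K) : C.extend g (C.incl x) = g x := rfl

@[simp] theorem DGCoalgebra.extend_unit (g : K →ₗ[R] M) : C.extend g C.unit = 0 := map_zero g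

theorem mul_apply_unit {A : Type*} [Ring A] [Algebra R A] (g h : WithConv (C.Aug →ₗ[R] A)) :
    (g * h) C.unit = g C.unit * h C.unit := by
  simp [C.comul_aug]

theorem mul_letterMap_apply_incl (Q : WithConv (C.Aug →ₗ[R] TensorAlgebra R M))
    (hQ : Q C.unit = 0) (h : K →ₗ[R] M) (x : K) :
    (Q * letterMap (C.extend h)) (C.incl x) = LinearMap.mul' R _
      (TensorProduct.map (Q.ofConv ∘ₗ C.incl) (TensorAlgebra.ι R ∘ₗ h) (C.comul x)) := by
  rw [LinearMap.convMul_apply, C.comul_aug, C.augComul_incl, map_add, map_add, map_add, map_add,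
    TensorProduct.map_tmul, TensorProduct.map_tmul, LinearMap.mul'_apply, LinearMap.mul'_apply, hQ,
    zero_mul, add_zero, letterMap_apply, C.extend_unit, map_zero, mul_zero, zero_add]
  rw [← LinearMap.comp_apply (TensorProduct.map _ _), ← TensorProduct.map_comp]
  rfl

/-- Maps extended by zero kill the grouplike element, so the terms x ⊗ 1 and 1 ⊗ x of the augmented
coproduct drop out and the comultiplication of K remains. The vanishing at the unit is part of the
induction for this reason. -/
theorem prod_letterMap_apply_incl (n : ℕ) (g : Fin (n + 1) → K →ₗ[R] M) :
    (List.ofFn fun i => letterMap (C.extend (g i))).prod C.unit = 0 ∧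
    ∀ x, (List.ofFn fun i => letterMap (C.extend (g i))).prod (C.incl x) =
      TensorPower.toTensorAlgebra (PiTensorProduct.map g (C.iterComul n x)) := by
  induction n with
  | zero =>
    refine ⟨by simp, fun x => ?_⟩
    have h1 : (PiTensorProduct.subsingletonEquiv (R := R) (s := fun _ : Fin 1 => K) 0).symm x =
        PiTensorProduct.tprod R fun _ => x := by
      rw [LinearEquiv.symm_apply_eq]
      simp
    simp only [DGCoalgebra.iterComul, LinearEquiv.coe_coe, h1, PiTensorProduct.map_tprod,
      TensorPower.toTensorAlgebra_tprod, TensorAlgebra.tprod_apply]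
    simp
  | succ n ih =>
    obtain ⟨h1, h2⟩ := ih fun i => g i.castSucc
    rw [List.ofFn_succ', List.concat_eq_append, List.prod_append, List.prod_singleton]
    refine ⟨by rw [mul_apply_unit, h1, zero_mul], fun x => ?_⟩
    rw [mul_letterMap_apply_incl _ _ h1]
    simp only [DGCoalgebra.iterComul, LinearMap.comp_apply]
    induction C.comul x using TensorProduct.induction_on with
    | zero => simp
    | tmul a b =>
      rw [TensorProduct.map_tmul, TensorProduct.map_tmul, LinearMap.mul'_apply,
        LinearMap.comp_apply, LinearMap.comp_apply, h2]
      exact (toTensorAlgebra_map_mulEquiv g (C.iterComul n a) b).symm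
    | add s t hs ht => simp only [map_add, hs, ht]

theorem tensorLift_toTensorAlgebra (f : (n : ℕ) → MultilinearMap R (fun _ : Fin n => M) N) {n : ℕ}
    (t : ⨂[R]^n M) :
    tensorLift f (TensorPower.toTensorAlgebra t) = PiTensorProduct.lift (f n) t := by
  induction t using PiTensorProduct.induction_on with
  | smul_tprod r a =>
    simp only [map_smul, TensorPower.toTensorAlgebra_tprod, tensorLift_tprod,
      PiTensorProduct.lift.tprod]
  | add s t hs ht => simp only [map_add, hs, ht]

theorem DGCoalgebra.conv_apply (f : (n : ℕ) → MultilinearMap R (fun _ : Fin n => M) N) {n : ℕ}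
    (g : Fin (n + 1) → K →ₗ[R] M) (x : K) :
    C.conv (f (n + 1)) g x =
      tensorLift f ((List.ofFn fun i => letterMap (C.extend (g i))).prod (C.incl x)) := by
  rw [(prod_letterMap_apply_incl C n g).2 x, tensorLift_toTensorAlgebra]
  rfl

/-- One bound serves all maps simultaneously, so infinite sums at x may be truncated at the same
index. -/
theorem exists_bound {C : Type*} [AddCommGroup C] [Module R C] {𝒞 : ℤ → Submodule R C}
    (htop : ⨆ n, 𝒞 n = ⊤) (N : Type*) [AddCommGroup N] [Module R N] (x : C) :
    ∃ n : ℕ, ∀ g : C →ₗ[R] N, VanishBelow 𝒞 n g → g x = 0 := by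
  have hx : x ∈ ⨆ n, 𝒞 n := htop ▸ Submodule.mem_top
  induction hx using Submodule.iSup_induction' with
  | mem j x hx => exact ⟨j.toNat + 1, fun g hg => hg j (by omega) x hx⟩
  | zero => exact ⟨0, fun g _ => map_zero g⟩
  | add x y _ _ ihx ihy =>
    obtain ⟨a, ha⟩ := ihx
    obtain ⟨b, hb⟩ := ihy
    refine ⟨max a b, fun g hg => ?_⟩
    rw [map_add, ha g (hg.mono (by simp)), hb g (hg.mono (by simp)), add_zero]

variable {𝓜 : ℤ → Submodule R M} [DirectSum.Decomposition 𝓜]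

theorem DGCoalgebra.hasDeg_extend {k : ℤ} {g : K →ₗ[R] M} (hg : HasDeg 𝒦 𝓜 k g) :
    HasDeg C.augGrading 𝓜 k (C.extend g) := fun n _ hx => hg n _ (C.proj_mem hx)

theorem finsum_conv_const (hM : IsConnected 𝓜)
    (f : (n : ℕ) → MultilinearMap R (fun _ : Fin n => M) N) {ψ : K →ₗ[R] M}
    (hψ : HasDeg 𝒦 𝓜 (-1) ψ) (x : K) :
    ∑ᶠ i : ℕ, C.conv (f (i + 1)) (fun _ => ψ) x =
      tensorLift f (geom (C.extend ψ) (C.incl x)) := by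
  have h𝒢 := C.isDGCoalgebra.toIsGradedCoalgebra
  have hψ' := C.hasDeg_extend hψ
  obtain ⟨n, hn⟩ := exists_bound h𝒢.iSup_eq_top (TensorAlgebra R M) (C.incl x)
  have h1 : ∀ i, C.conv (f (i + 1)) (fun _ => ψ) x =
      tensorLift f ((letterMap (C.extend ψ) ^ (i + 1)) (C.incl x)) := fun i => by
    rw [C.conv_apply, List.ofFn_const, List.prod_replicate]
  have h2 : ∀ i ≥ n, (letterMap (C.extend ψ) ^ i) (C.incl x) = 0 := fun i hi =>
    hn _ ((VanishBelow.pow h𝒢 (vanishBelow_letterMap hM hψ') i).mono (by exact_mod_cast hi))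
  have h3 := hn _ ((vanishBelow_geom_sub h𝒢 hM hψ' (n + 1)).mono (by simp))
  rw [ofConv_sub, LinearMap.sub_apply, sub_eq_zero, ofConv_sum, LinearMap.sum_apply,
    Finset.sum_range_succ'] at h3
  rw [finsum_eq_sum_of_support_subset (s := Finset.range n), h3, map_add, map_sum]
  · have : (letterMap (C.extend ψ) ^ 0) (C.incl x) = 0 := by
      rw [pow_zero, LinearMap.convOne_apply, C.counit_aug, C.augCounit_incl, map_zero]
    rw [this, map_zero, add_zero]
    exact Finset.sum_congr rfl fun i _ => h1 i
  · intro i hi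
    by_contra h
    refine hi ?_
    change C.conv (f (i + 1)) (fun _ => ψ) x = 0
    rw [h1, h2 (i + 1) (by simp at h; omega), map_zero]

theorem prod_ofFn_homotopyFamily (φ c ψ : K →ₗ[R] M) (k l : ℕ) :
    (List.ofFn fun i => letterMap (C.extend (homotopyFamily 𝒦 φ c ψ k l i))).prod =
      precomp C.augInvol (letterMap (C.extend φ)) ^ k * letterMap (C.extend c) *
        letterMap (C.extend ψ) ^ l := by
  have h0 : precomp C.augInvol (letterMap (C.extend φ)) =
      letterMap (C.extend (φ ∘ₗ gradeInvol 𝒦)) := by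
    refine WithConv.ext (C.aug_ext ?_ fun x => ?_)
    · simp
    · simp
  have h1 : (List.ofFn fun i => letterMap (C.extend (homotopyFamily 𝒦 φ c ψ k l i))) =
      List.replicate k (letterMap (C.extend (φ ∘ₗ gradeInvol 𝒦))) ++
        (letterMap (C.extend c) :: List.replicate l (letterMap (C.extend ψ))) := by
    refine List.ext_getElem (by simp; omega) fun i h1 h2 => ?_
    rw [List.getElem_ofFn, List.getElem_append]
    simp only [homotopyFamily, List.length_replicate]
    split_ifs with h3 h4
    · simp
    · simp [h4]
    · rw [List.getElem_cons, dif_neg (by omega)]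
      simp
  rw [h0, h1, List.prod_append, List.prod_cons, List.prod_replicate, List.prod_replicate, mul_assoc]

/-- At a given element both outer geometric series may be truncated at a common n: the tails vanish
below n. Multiplying out the truncated product gives the double sum. -/
theorem finsum_conv_homotopyFamily (hM : IsConnected 𝓜) (A : AInfAlgebra 𝓜) {φ c ψ : K →ₗ[R] M}
    (hφ : HasDeg 𝒦 𝓜 (-1) φ) (hc : HasDeg 𝒦 𝓜 0 c) (hψ : HasDeg 𝒦 𝓜 (-1) ψ) (x : K) :
    ∑ᶠ p : ℕ × ℕ, C.conv (A.m (p.1 + p.2 + 1)) (homotopyFamily 𝒦 φ c ψ p.1 p.2) x =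
      A.total (homotopyMap C.augInvol (C.extend φ) (C.extend c) (C.extend ψ) (C.incl x)) := by
  have h𝒞 := C.isDGCoalgebra
  have h𝒢 := h𝒞.toIsGradedCoalgebra
  have hψ' := C.hasDeg_extend hψ
  have hφ' := C.hasDeg_extend hφ
  obtain ⟨n, hn⟩ := exists_bound h𝒢.iSup_eq_top (TensorAlgebra R M) (C.incl x)
  set p := precomp C.augInvol (letterMap (C.extend φ)) with hp
  set q := letterMap (C.extend ψ) with hq
  set e := letterMap (C.extend c) with he
  have hpV : VanishBelow C.augGrading 1 p.ofConv :=
    h𝒞.vanishBelow_precomp_invol (vanishBelow_letterMap hM hφ')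
  have hqV : VanishBelow C.augGrading 1 q.ofConv := vanishBelow_letterMap hM hψ'
  have heV : VanishBelow C.augGrading 1 e.ofConv :=
    ((C.hasDeg_extend hc).vanishBelow fun j hj => hM j (by linarith)).comp_left _
  have h1 : ∀ k l, C.conv (A.m (k + l + 1)) (homotopyFamily 𝒦 φ c ψ k l) x =
      A.total ((p ^ k * e * q ^ l) (C.incl x)) := fun k l => by
    rw [C.conv_apply, prod_ofFn_homotopyFamily]
    rfl
  have h2 : ∀ k l, (n ≤ k ∨ n ≤ l) → (p ^ k * e * q ^ l) (C.incl x) = 0 := fun k l hkl =>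
    hn _ ((((VanishBelow.pow h𝒢 hpV k).mul h𝒢 heV).mul h𝒢 (VanishBelow.pow h𝒢 hqV l)).mono
      (by omega))
  have hP : VanishBelow C.augGrading n (precomp C.augInvol (geom (C.extend φ)) -
      ∑ i ∈ Finset.range n, p ^ i).ofConv := by
    have h3 := h𝒞.vanishBelow_precomp_invol (vanishBelow_geom_sub h𝒢 hM hφ' n)
    have h4 : ∀ i : ℕ, precomp C.augInvol (letterMap (C.extend φ) ^ i) = p ^ i := by
      intro i
      induction i with
      | zero => rw [pow_zero, pow_zero, h𝒞.precomp_invol_one]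
      | succ i ih => rw [pow_succ, pow_succ, h𝒞.precomp_invol_mul, ih]
    rw [map_sub, map_sum] at h3
    simpa only [h4] using h3
  have hX := vanishBelow_geom_sub h𝒢 hM hψ' n
  have hS : VanishBelow C.augGrading 0 (∑ i ∈ Finset.range n, p ^ i).ofConv := by
    have h3 := (h𝒞.vanishBelow_precomp_invol (vanishBelow_geom h𝒢 hM hφ')).sub
      (hP.mono (by simp))
    rwa [← ofConv_sub, sub_sub_cancel] at h3
  have hH : (homotopyMap C.augInvol (C.extend φ) (C.extend c) (C.extend ψ)) (C.incl x) =
      ((∑ i ∈ Finset.range n, p ^ i) * e * ∑ i ∈ Finset.range n, q ^ i) (C.incl x) := by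
    rw [← sub_eq_zero, ← LinearMap.sub_apply, ← ofConv_sub]
    have h3 : homotopyMap C.augInvol (C.extend φ) (C.extend c) (C.extend ψ) -
        (∑ i ∈ Finset.range n, p ^ i) * e * ∑ i ∈ Finset.range n, q ^ i =
        (precomp C.augInvol (geom (C.extend φ)) - ∑ i ∈ Finset.range n, p ^ i) * e *
          geom (C.extend ψ) + (∑ i ∈ Finset.range n, p ^ i) * e *
          (geom (C.extend ψ) - ∑ i ∈ Finset.range n, q ^ i) := by
      rw [homotopyMap]
      simp only [sub_mul, mul_sub]
      abel
    refine hn _ ?_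
    rw [h3]
    exact (((hP.mul h𝒢 heV).mul h𝒢 (vanishBelow_geom h𝒢 hM hψ')).mono (by linarith)).add
      (((hS.mul h𝒢 heV).mul h𝒢 hX).mono (by linarith))
  rw [hH, Finset.sum_mul, Finset.sum_mul_sum, ← Finset.sum_product', ofConv_sum,
    LinearMap.sum_apply, map_sum, finsum_eq_sum_of_support_subset]
  · exact Finset.sum_congr rfl fun kl _ => h1 kl.1 kl.2
  · intro kl hkl
    by_contra h
    refine hkl ?_
    change C.conv (A.m (kl.1 + kl.2 + 1)) (homotopyFamily 𝒦 φ c ψ kl.1 kl.2) x = 0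
    rw [h1, h2 _ _ ?_, map_zero]
    simp at h
    omega

/-- On K the defect is the difference of the two sides of the twisting equation. On the unit it
takes a value of degree -2, which is zero by connectedness. -/
theorem isTwistingCochain_iff (hM : IsConnected 𝓜) (A : AInfAlgebra 𝓜) {φ : K →ₗ[R] M}
    (hφ : HasDeg 𝒦 𝓜 (-1) φ) :
    IsTwistingCochain C A φ ↔ cochainDefect A C.augD (C.extend φ) = 0 := by
  have h1 : cochainDefect A C.augD (C.extend φ) C.unit = 0 := by
    have h2 : cochainDefect A C.augD (C.extend φ) C.unit ∈ 𝓜 (0 + -2) :=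
      hasDeg_cochainDefect C.isDGCoalgebra hM A (C.hasDeg_extend hφ) 0 _ C.unit_mem
    rwa [hM _ (by norm_num), Submodule.mem_bot] at h2
  have h2 : ∀ x, cochainDefect A C.augD (C.extend φ) (C.incl x) =
      ∑ᶠ i : ℕ, C.conv (A.m (i + 1)) (fun _ => φ) x - φ (C.d x) := fun x => by
    rw [finsum_conv_const C hM A.m hφ]
    simp [cochainDefect, AInfAlgebra.total]
  constructor
  · rintro ⟨-, h⟩
    refine C.aug_ext (by rw [h1]; rfl) fun x => ?_
    rw [h2, h, sub_self]
    rfl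
  · intro h
    refine ⟨fun n x hx => hφ n x hx, fun x => ?_⟩
    have := h2 x
    rw [h, LinearMap.zero_apply, eq_comm, sub_eq_zero] at this
    exact this.symm

end Link


/-! ### Degreewise gluing, linear lifts and limits -/

section Lifting

variable {R K : Type*} [CommRing R] [AddCommGroup K] [Module R K] (𝒦 : ℤ → Submodule R K)
  [DirectSum.Decomposition 𝒦] {N N' : Type*} [AddCommGroup N] [Module R N] [AddCommGroup N']
  [Module R N']

/-- The map that is `s j` on the piece of degree `j`. -/
noncomputable def glue (s : (j : ℤ) → 𝒦 j →ₗ[R] N) : K →ₗ[R] N :=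
  DirectSum.toModule R ℤ N s ∘ₗ (DirectSum.decomposeLinearEquiv 𝒦).toLinearMap

theorem glue_apply (s : (j : ℤ) → 𝒦 j →ₗ[R] N) {j : ℤ} {x : K} (hx : x ∈ 𝒦 j) :
    glue 𝒦 s x = s j ⟨x, hx⟩ := by
  have h : DirectSum.decompose 𝒦 x = DirectSum.lof R ℤ (fun i => 𝒦 i) j ⟨x, hx⟩ :=
    DirectSum.decompose_of_mem 𝒦 hx
  simp only [glue, LinearMap.comp_apply, LinearEquiv.coe_coe,
    DirectSum.decomposeLinearEquiv_apply, h, DirectSum.toModule_lof]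

theorem exists_lift_of_free {P : Type*} [AddCommGroup P] [Module R P] [Module.Free R P]
    (Q : Submodule R N) (T : N →ₗ[R] N') (g : P →ₗ[R] N') (h : ∀ x, ∃ l ∈ Q, T l = g x) :
    ∃ s : P →ₗ[R] N, (∀ x, s x ∈ Q) ∧ ∀ x, T (s x) = g x := by
  let b := Module.Free.chooseBasis R P
  choose l hl hT using fun i => h (b i)
  let s : P →ₗ[R] Q := b.constr R fun i => ⟨l i, hl i⟩
  refine ⟨Q.subtype ∘ₗ s, fun x => (s x).2, fun x => ?_⟩
  have : T ∘ₗ Q.subtype ∘ₗ s = g := b.ext fun i => by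
    simp only [s, LinearMap.comp_apply, Module.Basis.constr_basis, Submodule.subtype_apply, hT]
  exact LinearMap.congr_fun this x

variable {𝒦}

/-- In degree j the sequence is constant from index `j.toNat + 1` on, so the limit is glued from
these values. -/
theorem exists_limit {𝒩 : ℤ → Submodule R N} {k : ℤ} {g : ℕ → K →ₗ[R] N}
    (hg : ∀ n, HasDeg 𝒦 𝒩 k (g n)) (h : ∀ n : ℕ, VanishBelow 𝒦 n (g (n + 1) - g n)) :
    ∃ g' : K →ₗ[R] N, HasDeg 𝒦 𝒩 k g' ∧ ∀ n : ℕ, VanishBelow 𝒦 n (g' - g n) := by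
  have h1 : ∀ n m : ℕ, n ≤ m → VanishBelow 𝒦 n (g m - g n) := fun n m hnm => by
    induction m, hnm using Nat.le_induction with
    | base => rw [sub_self]; exact VanishBelow.zero
    | succ m hnm ih =>
      have := ((h m).mono (by exact_mod_cast hnm : (n : ℤ) ≤ m)).add ih
      rwa [sub_add_sub_cancel] at this
  refine ⟨glue 𝒦 fun j => g (j.toNat + 1) ∘ₗ (𝒦 j).subtype, fun j x hx => ?_,
    fun n j hj x hx => ?_⟩
  · rw [glue_apply 𝒦 _ hx]
    exact hg _ j x hx
  · rw [LinearMap.sub_apply, glue_apply 𝒦 _ hx, LinearMap.comp_apply, Submodule.subtype_apply]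
    rcases le_total n (j.toNat + 1) with h2 | h2
    · exact h1 _ _ h2 j hj x hx
    · have := h1 _ _ h2 j (by push_cast; omega) x hx
      rw [LinearMap.sub_apply, sub_eq_zero] at this
      rw [this, sub_self]

end Lifting

/-! ### The inductive construction of the lift -/

section Main

variable {R K M M' : Type*} [CommRing R] [AddCommGroup K] [Module R K] {𝒦 : ℤ → Submodule R K}
  [DirectSum.Decomposition 𝒦] [AddCommGroup M] [Module R M] [AddCommGroup M'] [Module R M']
  {𝓜 : ℤ → Submodule R M} [DirectSum.Decomposition 𝓜]
  {𝓜' : ℤ → Submodule R M'} [DirectSum.Decomposition 𝓜']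
  {A : AInfAlgebra 𝓜} {A' : AInfAlgebra 𝓜'}

/-- Acyclicity of the mapping cone of `f₁` in one degree. -/
def AInfHom.LiftsAt (F : AInfHom A A') (n : ℤ) : Prop :=
  ∀ u ∈ 𝓜 (n - 1), ∀ v ∈ 𝓜' n, A.m₁ u = 0 → F.f₁ u = A'.m₁ v →
    ∃ w ∈ 𝓜 n, ∃ y ∈ 𝓜' (n + 1), A.m₁ w = u ∧ F.f₁ w + A'.m₁ y = v

theorem DGCoalgebra.vanishBelow_extend (C : DGCoalgebra 𝒦) {n : ℤ} {g : K →ₗ[R] M}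
    (hg : VanishBelow 𝒦 n g) : VanishBelow C.augGrading n (C.extend g) :=
  fun j hj _ hx => hg j hj _ (C.proj_mem hx)

theorem DGCoalgebra.extend_sub (C : DGCoalgebra 𝒦) (g h : K →ₗ[R] M) :
    C.extend (g - h) = C.extend g - C.extend h := LinearMap.sub_comp _ _ _

theorem DGCoalgebra.apply_unit_of_hasDeg (C : DGCoalgebra 𝒦) (hM : IsConnected 𝓜) {k : ℤ}
    (hk : k ≤ 0) {g : C.Aug →ₗ[R] M} (hg : HasDeg C.augGrading 𝓜 k g) : g C.unit = 0 := by
  have := hg 0 _ C.unit_mem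
  rwa [hM _ (by linarith), Submodule.mem_bot] at this

theorem DGCoalgebra.extend_comp_incl (C : DGCoalgebra 𝒦) (hM : IsConnected 𝓜) {k : ℤ}
    (hk : k ≤ 0) {g : C.Aug →ₗ[R] M} (hg : HasDeg C.augGrading 𝓜 k g) :
    C.extend (g ∘ₗ C.incl) = g :=
  C.aug_ext (by rw [C.apply_unit_of_hasDeg hM hk hg, C.extend_unit]) fun _ => rfl

variable (C : DGCoalgebra 𝒦) (F : AInfHom A A') (φ : K →ₗ[R] M')

/-- `ψ` is a twisting cochain and `c` a homotopy from `φ` to `F ∘ ψ`, in degrees below `n`. -/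
structure ApproxLift (n : ℤ) (ψ : K →ₗ[R] M) (c : K →ₗ[R] M') : Prop where
  hasDeg_left : HasDeg 𝒦 𝓜 (-1) ψ
  hasDeg_right : HasDeg 𝒦 𝓜' 0 c
  cochain : VanishBelow C.augGrading n (cochainDefect A C.augD (C.extend ψ))
  homotopy : VanishBelow C.augGrading n (homotopyDefect A' C.augInvol C.augD (C.extend φ)
    (C.extend c) (F.push (C.extend ψ)))

variable {C F φ} (hM : IsConnected 𝓜) (hM' : IsConnected 𝓜')

include hM hM'

/-- The defects have degrees -2 and -1, so in negative degrees they take values where M and M'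
vanish. -/
theorem approxLift_zero (hφ : HasDeg 𝒦 𝓜' (-1) φ) : ApproxLift C F φ 0 0 0 where
  hasDeg_left := HasDeg.zero
  hasDeg_right := HasDeg.zero
  cochain := (hasDeg_cochainDefect C.isDGCoalgebra hM A
    (C.hasDeg_extend HasDeg.zero)).vanishBelow fun j hj => hM j (by linarith)
  homotopy := (hasDeg_homotopyDefect C.isDGCoalgebra hM' A' (C.hasDeg_extend hφ)
    (C.hasDeg_extend HasDeg.zero) (F.hasDeg_push C.isDGCoalgebra hM
      (C.hasDeg_extend HasDeg.zero))).vanishBelow fun j hj => hM' j (by linarith)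

/-- The defects in degree n form a cycle of the cone of f₁; a linear choice of bounding elements
corrects ψ and c. Twisting cochains have degree -1, which is why acyclicity is needed at n - 1. -/
theorem ApproxLift.exists_next {n : ℤ} [Module.Free R (𝒦 n)] (hF : F.LiftsAt (n - 1))
    (hφ : HasDeg 𝒦 𝓜' (-1) φ) (hφd : cochainDefect A' C.augD (C.extend φ) = 0)
    {ψ : K →ₗ[R] M} {c : K →ₗ[R] M'} (h : ApproxLift C F φ n ψ c) :
    ∃ ψ₂ c₂, ApproxLift C F φ (n + 1) ψ₂ c₂ ∧ VanishBelow 𝒦 n (ψ₂ - ψ) ∧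
      VanishBelow 𝒦 n (c₂ - c) := by
  have h𝒞 := C.isDGCoalgebra
  have hψ' := C.hasDeg_extend h.hasDeg_left
  have hc' := C.hasDeg_extend h.hasDeg_right
  have hφ' := C.hasDeg_extend hφ
  set e := cochainDefect A C.augD (C.extend ψ) with he
  set e' := homotopyDefect A' C.augInvol C.augD (C.extend φ) (C.extend c)
    (F.push (C.extend ψ)) with he'
  have hde : HasDeg C.augGrading 𝓜 (-2) e := hasDeg_cochainDefect h𝒞 hM A hψ'
  have hde' : HasDeg C.augGrading 𝓜' (-1) e' :=
    hasDeg_homotopyDefect h𝒞 hM' A' hφ' hc' (F.hasDeg_push h𝒞 hM hψ')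
  -- T is the cone differential, up to sign convention. The correction is to be a preimage of (-e,
  -- e').
  let T : M × M' →ₗ[R] M × M' := (A.m₁ ∘ₗ LinearMap.fst R M M').prod
    (F.f₁ ∘ₗ LinearMap.fst R M M' + A'.m₁ ∘ₗ LinearMap.snd R M M')
  obtain ⟨s, hsmem, hs⟩ := exists_lift_of_free ((𝓜 (n - 1)).prod (𝓜' n)) T
    (((-e).prod e') ∘ₗ C.incl ∘ₗ (𝒦 n).subtype) (by
      rintro ⟨x, hx⟩
      have hx' := C.incl_mem hx
      obtain ⟨w, hw, y, hy, h1, h2⟩ := hF (-e (C.incl x))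
        (neg_mem (by have := hde _ _ hx'; convert this using 2; ring)) (e' (C.incl x))
        (hde' _ _ hx')
        (by rw [map_neg, m₁_cochainDefect h𝒞 C.augD_augD hM hψ' h.cochain hx', neg_zero])
        (by rw [map_neg]; exact (m₁_homotopyDefect F h𝒞 C.augD_augD hM hM' hφ' hc' hψ' hφd
          h.cochain h.homotopy hx').symm)
      rw [sub_add_cancel] at hy
      exact ⟨(w, y), ⟨hw, hy⟩, Prod.ext h1 h2⟩)
  -- The correction is supported in degree n alone, so what was achieved below n persists.
  let s' : K →ₗ[R] M × M' := glue 𝒦 (Pi.single n s)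
  have hsn : ∀ x (hx : x ∈ 𝒦 n), s' x = s ⟨x, hx⟩ := fun x hx => by
    simp only [s']
    rw [glue_apply 𝒦 _ hx, Pi.single_eq_same]
  have hsj : ∀ j, j ≠ n → ∀ x ∈ 𝒦 j, s' x = 0 := fun j hj x hx => by
    simp only [s']
    rw [glue_apply 𝒦 _ hx, Pi.single_eq_of_ne hj, LinearMap.zero_apply]
  let w := LinearMap.fst R M M' ∘ₗ s'
  let y := LinearMap.snd R M M' ∘ₗ s'
  have hwV : VanishBelow 𝒦 n w := fun j hj x hx => congrArg Prod.fst (hsj j hj.ne x hx)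
  have hyV : VanishBelow 𝒦 n y := fun j hj x hx => congrArg Prod.snd (hsj j hj.ne x hx)
  have hwd : HasDeg 𝒦 𝓜 (-1) w := fun j x hx => by
    by_cases hj : j = n
    · subst hj
      simp only [w, LinearMap.comp_apply, hsn x hx]
      exact (hsmem _).1
    · simp only [w, LinearMap.comp_apply, hsj j hj x hx, map_zero, zero_mem]
  have hyd : HasDeg 𝒦 𝓜' 0 y := fun j x hx => by
    by_cases hj : j = n
    · subst hj
      simp only [y, LinearMap.comp_apply, hsn x hx, add_zero]
      exact (hsmem _).2
    · simp only [y, LinearMap.comp_apply, hsj j hj x hx, map_zero, zero_mem]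
  have hψ₂ : HasDeg 𝒦 𝓜 (-1) (ψ + w) := h.hasDeg_left.add hwd
  have hc₂ : HasDeg 𝒦 𝓜' 0 (c + y) := h.hasDeg_right.add hyd
  have hsub1 : ψ + w - ψ = w := add_sub_cancel_left _ _
  have hsub2 : c + y - c = y := add_sub_cancel_left _ _
  have hW : C.extend (ψ + w) - C.extend ψ = C.extend w := by rw [← C.extend_sub, hsub1]
  have hY : C.extend (c + y) - C.extend c = C.extend y := by rw [← C.extend_sub, hsub2]
  have hWV : VanishBelow C.augGrading n (C.extend (ψ + w) - C.extend ψ) := by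
    rw [hW]; exact C.vanishBelow_extend hwV
  have hYV : VanishBelow C.augGrading n (C.extend (c + y) - C.extend c) := by
    rw [hY]; exact C.vanishBelow_extend hyV
  have hT : ∀ x ∈ C.augGrading n, A.m₁ (C.extend w x) = -e x ∧
      F.f₁ (C.extend w x) + A'.m₁ (C.extend y x) = e' x := fun x hx => by
    have hp := C.proj_mem hx
    have h1 := hs ⟨_, hp⟩
    rw [← hsn _ hp] at h1
    have h2 : e x = e (C.incl (C.proj x)) :=
      (LinearMap.congr_fun (C.extend_comp_incl hM (by norm_num) hde) x).symm
    have h3 : e' x = e' (C.incl (C.proj x)) :=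
      (LinearMap.congr_fun (C.extend_comp_incl hM' (by norm_num) hde') x).symm
    rw [h2, h3]
    exact ⟨congrArg Prod.fst h1, congrArg Prod.snd h1⟩
  refine ⟨ψ + w, c + y, ⟨hψ₂, hc₂, fun j hj x hx => ?_, fun j hj x hx => ?_⟩, by rwa [hsub1],
    by rwa [hsub2]⟩
  · have h1 := vanishBelow_cochainDefect_sub (A := A) h𝒞 hM hψ' (C.hasDeg_extend hψ₂) hWV j hj x hx
    rw [hW] at h1
    simp only [LinearMap.sub_apply, LinearMap.comp_apply] at h1
    rw [sub_sub, sub_eq_zero] at h1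
    rw [h1]
    rcases (Int.lt_add_one_iff.1 hj).lt_or_eq with hj' | rfl
    · have h2 : C.extend w x = 0 := C.vanishBelow_extend hwV j hj' x hx
      rw [h.cochain j hj' x hx, h2, map_zero, add_zero]
    · rw [(hT x hx).1, add_neg_cancel]
  · have h1 := vanishBelow_homotopyDefect_sub F h𝒞 hM hM' hφ' hc' hψ' (C.hasDeg_extend hψ₂)
      hWV hYV j hj x hx
    rw [hW, hY] at h1
    simp only [LinearMap.sub_apply, LinearMap.add_apply, LinearMap.comp_apply] at h1
    rw [add_assoc, sub_add, sub_eq_zero] at h1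
    rw [h1]
    rcases (Int.lt_add_one_iff.1 hj).lt_or_eq with hj' | rfl
    · have h2 : C.extend w x = 0 := C.vanishBelow_extend hwV j hj' x hx
      have h3 : C.extend y x = 0 := C.vanishBelow_extend hyV j hj' x hx
      rw [h.homotopy j hj' x hx, h2, h3, map_zero, map_zero, add_zero, sub_zero]
    · rw [(hT x hx).2, sub_self]

/-- Iterate the correction from the zero maps and pass to the limit. The limit agrees with stage n
below degree n, so its defects vanish below every n. -/
theorem exists_twistEquiv_of_liftsAt (hfree : ∀ n, Module.Free R (𝒦 n))
    (hF : ∀ n, F.LiftsAt n) (hφ : IsTwistingCochain C A' φ) :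
    ∃ ψ : K →ₗ[R] M, IsTwistingCochain C A ψ ∧
      ∃ χ : K →ₗ[R] M', IsComposite C F ψ χ ∧ TwistEquiv C A' φ χ := by
  have h𝒞 := C.isDGCoalgebra
  have hφ1 : HasDeg 𝒦 𝓜' (-1) φ := fun n x hx => hφ.mem n x hx
  have hφd := (isTwistingCochain_iff C hM' A' hφ1).1 hφ
  have hφ' := C.hasDeg_extend hφ1
  choose! ψ₂ c₂ h₂ using fun (n : ℕ) (ψ : K →ₗ[R] M) (c : K →ₗ[R] M')
    (h : ApproxLift C F φ n ψ c) => h.exists_next hM hM' (hF _) hφ1 hφd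
  let s : ℕ → (K →ₗ[R] M) × (K →ₗ[R] M') := fun n =>
    Nat.rec (0, 0) (fun n p => (ψ₂ n p.1 p.2, c₂ n p.1 p.2)) n
  have hs : ∀ n : ℕ, ApproxLift C F φ n (s n).1 (s n).2 := fun n => by
    induction n with
    | zero => exact approxLift_zero hM hM' hφ1
    | succ n ih => exact_mod_cast (h₂ n _ _ ih).1
  obtain ⟨ψ, hψ, hψV⟩ := exists_limit (fun n => (hs n).hasDeg_left)
    (fun n => (h₂ n _ _ (hs n)).2.1)
  obtain ⟨c, hc, hcV⟩ := exists_limit (fun n => (hs n).hasDeg_right)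
    (fun n => (h₂ n _ _ (hs n)).2.2)
  have hψ' := C.hasDeg_extend hψ
  have hc' := C.hasDeg_extend hc
  have hψV' : ∀ n : ℕ, VanishBelow C.augGrading n (C.extend ψ - C.extend (s n).1) := fun n => by
    rw [← C.extend_sub]; exact C.vanishBelow_extend (hψV n)
  have hcV' : ∀ n : ℕ, VanishBelow C.augGrading n (C.extend c - C.extend (s n).2) := fun n => by
    rw [← C.extend_sub]; exact C.vanishBelow_extend (hcV n)
  have hψ0 : cochainDefect A C.augD (C.extend ψ) = 0 := by
    refine eq_zero_of_vanishBelow h𝒞.iSup_eq_top fun n => ?_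
    have h1 := (((vanishBelow_cochainDefect_sub (A := A) h𝒞 hM (C.hasDeg_extend (hs n).hasDeg_left)
      hψ' (hψV' n)).mono (by linarith : (n : ℤ) ≤ n + 1)).add
      ((hψV' n).comp_left A.m₁)).add (hs n).cochain
    rwa [sub_add_cancel, sub_add_cancel] at h1
  have hc0 : homotopyDefect A' C.augInvol C.augD (C.extend φ) (C.extend c)
      (F.push (C.extend ψ)) = 0 := by
    refine eq_zero_of_vanishBelow h𝒞.iSup_eq_top fun n => ?_
    have h1 := ((((vanishBelow_homotopyDefect_sub F h𝒞 hM hM' hφ'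
      (C.hasDeg_extend (hs n).hasDeg_right) (C.hasDeg_extend (hs n).hasDeg_left)
      hψ' (hψV' n) (hcV' n)).mono (by linarith : (n : ℤ) ≤ n + 1)).sub
      ((hcV' n).comp_left A'.m₁)).sub ((hψV' n).comp_left F.f₁)).add (hs n).homotopy
    rwa [add_sub_cancel_right, add_sub_cancel_right, sub_add_cancel] at h1
  have hχ' := F.hasDeg_push h𝒞 hM hψ'
  set χ : K →ₗ[R] M' := F.push (C.extend ψ) ∘ₗ C.incl with hχdef
  have hχ : C.extend χ = F.push (C.extend ψ) := C.extend_comp_incl hM' (by norm_num) hχ'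
  have hχ1 : HasDeg 𝒦 𝓜' (-1) χ := fun n x hx => hχ' n _ (C.incl_mem hx)
  -- A pushforward has no defect in the degrees where ψ has none, so the composite is twisting.
  have hχd : cochainDefect A' C.augD (C.extend χ) = 0 := by
    rw [hχ]
    refine eq_zero_of_vanishBelow h𝒞.iSup_eq_top fun n =>
      F.vanishBelow_cochainDefect_push h𝒞 hM hM' hψ' ?_
    rw [hψ0]
    exact VanishBelow.zero
  refine ⟨ψ, (isTwistingCochain_iff C hM A hψ).2 hψ0, χ, fun x => ?_, hφ,
    (isTwistingCochain_iff C hM' A' hχ1).2 hχd, c, fun n x hx => by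
      have := hc n x hx
      rwa [add_zero] at this, fun x => ?_⟩
  · rw [finsum_conv_const C hM F.f hψ x]
    rfl
  · rw [finsum_conv_homotopyFamily C hM' A' hφ1 hc hχ1 x, hχ]
    have h1 : φ x - χ x - A'.total (homotopyMap C.augInvol (C.extend φ) (C.extend c)
        (F.push (C.extend ψ)) (C.incl x)) - c (C.d x) = 0 :=
      LinearMap.congr_fun hc0 (C.incl x)
    rw [sub_sub, sub_eq_zero] at h1
    rw [h1, add_comm]

end Main

/-! ### Acyclic cones from homology isomorphisms, and homogeneous components -/

section QuasiIso

variable {R L L' : Type*} [CommRing R] [AddCommGroup L] [Module R L] [AddCommGroup L'] [Module R L']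

/-- Injectivity on homology gives w with d w = u. Then v - g w is a cycle, and surjectivity makes it
homologous to g z for a cycle z, to be added to w. -/
theorem IsHomologyIso.exists_lift {d : L →ₗ[R] L} {d' : L' →ₗ[R] L'} {g : L →ₗ[R] L'}
    (h : IsHomologyIso d d' g) (hdg : ∀ x, g (d x) = d' (g x)) {u : L} {v : L'} (hu : d u = 0)
    (huv : g u = d' v) : ∃ w y, d w = u ∧ g w + d' y = v := by
  obtain ⟨w, hw⟩ := h.1 u hu ⟨v, huv.symm⟩
  obtain ⟨z, hz, y, hy⟩ := h.2 (v - g w) (by rw [map_sub, ← hdg, hw, huv, sub_self])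
  refine ⟨w + z, -y, by rw [map_add, hw, hz, add_zero], ?_⟩
  rw [map_neg, hy, map_add]
  abel

theorem iSup_eq_top_of_decomposition (𝓛 : ℤ → Submodule R L) [DirectSum.Decomposition 𝓛] :
    ⨆ n, 𝓛 n = ⊤ := (DirectSum.Decomposition.isInternal 𝓛).submodule_iSup_eq_top

/-- The projection to the component of degree `n`. -/
noncomputable def gradeProj (𝓛 : ℤ → Submodule R L) [DirectSum.Decomposition 𝓛] (n : ℤ) :
    L →ₗ[R] L :=
  glue 𝓛 (Pi.single n (𝓛 n).subtype)

variable {𝓛 : ℤ → Submodule R L} [DirectSum.Decomposition 𝓛]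
  {𝓛' : ℤ → Submodule R L'} [DirectSum.Decomposition 𝓛'] {n : ℤ}

theorem gradeProj_of_mem {x : L} (hx : x ∈ 𝓛 n) : gradeProj 𝓛 n x = x := by
  rw [gradeProj, glue_apply 𝓛 _ hx, Pi.single_eq_same, Submodule.subtype_apply]

theorem gradeProj_of_mem_ne {m : ℤ} (hm : m ≠ n) {x : L} (hx : x ∈ 𝓛 m) :
    gradeProj 𝓛 n x = 0 := by
  rw [gradeProj, glue_apply 𝓛 _ hx, Pi.single_eq_of_ne hm, LinearMap.zero_apply]

theorem gradeProj_mem (x : L) : gradeProj 𝓛 n x ∈ 𝓛 n := by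
  have hx : x ∈ ⨆ m, 𝓛 m := iSup_eq_top_of_decomposition 𝓛 ▸ Submodule.mem_top
  suffices h : ⨆ m, 𝓛 m ≤ (𝓛 n).comap (gradeProj 𝓛 n) from h hx
  refine iSup_le fun m y hy => ?_
  by_cases hm : m = n
  · subst hm
    rwa [Submodule.mem_comap, gradeProj_of_mem hy]
  · rw [Submodule.mem_comap, gradeProj_of_mem_ne hm hy]
    exact zero_mem _

theorem HasDeg.gradeProj_apply {k : ℤ} {g : L →ₗ[R] L'} (hg : HasDeg 𝓛 𝓛' k g) {m : ℤ}
    (hm : n + k = m) (x : L) : gradeProj 𝓛' m (g x) = g (gradeProj 𝓛 n x) := by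
  subst hm
  refine LinearMap.congr_fun (f := gradeProj 𝓛' (n + k) ∘ₗ g) (g := g ∘ₗ gradeProj 𝓛 n)
    (linearMap_ext_of_iSup_eq_top (iSup_eq_top_of_decomposition 𝓛) fun m x hx => ?_) x
  rw [LinearMap.comp_apply, LinearMap.comp_apply]
  by_cases hm : m = n
  · subst hm
    rw [gradeProj_of_mem hx, gradeProj_of_mem (hg m x hx)]
  · rw [gradeProj_of_mem_ne hm hx, gradeProj_of_mem_ne (fun h => hm (by linarith)) (hg m x hx),
      map_zero]

variable {A : AInfAlgebra 𝓛} {A' : AInfAlgebra 𝓛'} (F : AInfHom A A')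

theorem AInfAlgebra.m₁_apply (A : AInfAlgebra 𝓛) (x : L) : A.m₁ x = A.m 1 fun _ => x := rfl

theorem AInfHom.f₁_apply (x : L) : F.f₁ x = F.f 1 fun _ => x := rfl

theorem AInfAlgebra.hasDeg_m₁ (A : AInfAlgebra 𝓛) : HasDeg 𝓛 𝓛 (-1) A.m₁ := fun n x hx => by
  have := A.m_mem 1 (fun _ => n) (fun _ => x) fun _ => hx
  rw [A.m₁_apply]
  convert this using 2
  simp
  ring

theorem AInfHom.hasDeg_f₁ : HasDeg 𝓛 𝓛' 0 F.f₁ := fun n x hx => by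
  have := F.f_mem 1 (fun _ => n) (fun _ => x) fun _ => hx
  rw [F.f₁_apply]
  convert this using 2
  simp

theorem AInfAlgebra.barDiff_ι (A : AInfAlgebra 𝓛) (x : L) :
    A.barDiff (TensorAlgebra.ι R x) = TensorAlgebra.ι R (A.m₁ x) := by
  have h : A.total 1 = 0 := tensorLift_one A.m A.m_zero
  have := congrArg (fun g => g.ofConv (TensorAlgebra.ι R x)) A.barDiff_eq
  simpa [comul_tensorAlgebra, h, A.total_ι] using this

theorem AInfHom.barMap_ι (hM' : IsConnected 𝓛') (x : L) :
    F.barMap (TensorAlgebra.ι R x) = TensorAlgebra.ι R (F.f₁ x) := by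
  have h : F.total 1 = 0 := tensorLift_one F.f F.f_zero
  have h1 : F.barMap 1 = 1 := by
    change (geom F.total).ofConv 1 = 1
    have := congrArg (fun g => g.ofConv (1 : TensorAlgebra R L)) (geom_eq (F.isUnit hM'))
    simpa [comul_tensorAlgebra, h] using this
  have := congrArg (fun g => g.ofConv (TensorAlgebra.ι R x)) (geom_eq (F.isUnit hM'))
  change (geom F.total).ofConv 1 = 1 at h1
  change (geom F.total).ofConv _ = _
  simpa [comul_tensorAlgebra, h, h1, F.total_ι] using this

theorem AInfAlgebra.m₁_m₁ (A : AInfAlgebra 𝓛) (x : L) : A.m₁ (A.m₁ x) = 0 := by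
  have := LinearMap.congr_fun A.total_comp_barDiff (TensorAlgebra.ι R x)
  rwa [LinearMap.comp_apply, A.barDiff_ι, A.total_ι] at this

theorem AInfHom.f₁_m₁ (hM' : IsConnected 𝓛') (x : L) : F.f₁ (A.m₁ x) = A'.m₁ (F.f₁ x) := by
  have := LinearMap.congr_fun (F.total_comp_barDiff hM') (TensorAlgebra.ι R x)
  rwa [LinearMap.comp_apply, A.barDiff_ι, F.total_ι, LinearMap.comp_apply, F.barMap_ι hM',
    A'.total_ι] at this

/-- All maps involved are homogeneous, so the components of w and y in the right degrees solve the
same equations. -/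
theorem AInfHom.liftsAt_of_exists {u : L} {v : L'} (hv : v ∈ 𝓛' n) (hu : u ∈ 𝓛 (n - 1))
    (h : ∃ w y, A.m₁ w = u ∧ F.f₁ w + A'.m₁ y = v) :
    ∃ w ∈ 𝓛 n, ∃ y ∈ 𝓛' (n + 1), A.m₁ w = u ∧ F.f₁ w + A'.m₁ y = v := by
  obtain ⟨w, y, h1, h2⟩ := h
  refine ⟨gradeProj 𝓛 n w, gradeProj_mem _, gradeProj 𝓛' (n + 1) y, gradeProj_mem _, ?_, ?_⟩
  · rw [← A.hasDeg_m₁.gradeProj_apply (sub_eq_add_neg n 1).symm, h1, gradeProj_of_mem hu]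
  · rw [← F.hasDeg_f₁.gradeProj_apply (add_zero n),
      ← A'.hasDeg_m₁.gradeProj_apply (by ring : n + 1 + -1 = n), ← map_add, h2, gradeProj_of_mem hv]

theorem AInfHom.IsQuasiIso.liftsAt (hM' : IsConnected 𝓛') (h : F.IsQuasiIso) (n : ℤ) :
    F.LiftsAt n := fun _ hu _ hv h1 h2 =>
  F.liftsAt_of_exists hv hu (IsHomologyIso.exists_lift h (F.f₁_m₁ hM') h1 h2)

end QuasiIso

/-! ### Gradings as systems of orthogonal projections -/

section ProjSystem

variable {R V : Type*} [CommRing R] [AddCommGroup V] [Module R V]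

/-- Orthogonal projections, such that every element is a finite sum of its components. -/
structure IsProjSystem (π : ℤ → V →ₗ[R] V) : Prop where
  self : ∀ p, π p ∘ₗ π p = π p
  ne : ∀ p q, p ≠ q → π p ∘ₗ π q = 0
  exists_sum : ∀ x, ∃ s : Finset ℤ, x = ∑ p ∈ s, π p x

/-- Elements without components in degrees up to `n`. -/
def fil (π : ℤ → V →ₗ[R] V) (n : ℤ) : Submodule R V where
  carrier := {x | ∀ q ≤ n, π q x = 0}
  add_mem' hx hy q hq := by rw [map_add, hx q hq, hy q hq, add_zero]
  zero_mem' q _ := map_zero _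
  smul_mem' r x hx q hq := by rw [map_smul, hx q hq, smul_zero]

theorem IsProjSystem.exists_bound {π : ℤ → V →ₗ[R] V} (hπ : IsProjSystem π) (x : V) :
    ∃ B : ℤ, ∀ p ≥ B, π p x = 0 := by
  obtain ⟨s, hs⟩ := hπ.exists_sum x
  obtain ⟨B, hB⟩ := s.bddAbove
  refine ⟨B + 1, fun p hp => ?_⟩
  rw [hs, map_sum]
  refine Finset.sum_eq_zero fun q hq => ?_
  have h1 : q ≤ B := hB hq
  exact LinearMap.congr_fun (hπ.ne p q (by linarith)) x

theorem IsProjSystem.exists_bound_tensor {π : ℤ → V →ₗ[R] V} (hπ : IsProjSystem π)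
    {W : Type*} [AddCommGroup W] [Module R W] (x : V ⊗[R] W) :
    ∃ B : ℤ, ∀ p ≥ B, (π p).rTensor W x = 0 := by
  induction x using TensorProduct.induction_on with
  | zero => exact ⟨0, fun p _ => map_zero _⟩
  | tmul v w =>
    obtain ⟨B, hB⟩ := hπ.exists_bound v
    exact ⟨B, fun p hp => by rw [LinearMap.rTensor_tmul, hB p hp, TensorProduct.zero_tmul]⟩
  | add x y hx hy =>
    obtain ⟨B, hB⟩ := hx
    obtain ⟨B', hB'⟩ := hy
    exact ⟨max B B', fun p hp => by
      rw [map_add, hB p (le_trans (le_max_left _ _) hp), hB' p (le_trans (le_max_right _ _) hp),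
        add_zero]⟩

theorem gradeProj_apply_eq (𝓥 : ℤ → Submodule R V) [DirectSum.Decomposition 𝓥] (n : ℤ) (x : V) :
    gradeProj 𝓥 n x = (DirectSum.decompose 𝓥 x n : V) := by
  let L : V →ₗ[R] V := (𝓥 n).subtype ∘ₗ DirectSum.component R ℤ (fun i => 𝓥 i) n ∘ₗ
    (DirectSum.decomposeLinearEquiv 𝓥).toLinearMap
  have hL : ∀ x, L x = (DirectSum.decompose 𝓥 x n : V) := fun _ => rfl
  rw [← hL]
  refine LinearMap.congr_fun (linearMap_ext_of_iSup_eq_top (iSup_eq_top_of_decomposition 𝓥)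
    fun m x hx => ?_) x
  rw [hL]
  by_cases hm : m = n
  · subst hm
    rw [gradeProj_of_mem hx, DirectSum.decompose_of_mem_same 𝓥 hx]
  · rw [gradeProj_of_mem_ne hm hx, DirectSum.decompose_of_mem_ne 𝓥 hx hm]

theorem isProjSystem_gradeProj (𝓥 : ℤ → Submodule R V) [DirectSum.Decomposition 𝓥] :
    IsProjSystem (gradeProj 𝓥) where
  self p := LinearMap.ext fun x => gradeProj_of_mem (gradeProj_mem x)
  ne p q hpq := LinearMap.ext fun x => gradeProj_of_mem_ne hpq.symm (gradeProj_mem x)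
  exists_sum x := by
    classical
    refine ⟨(DirectSum.decompose 𝓥 x).support, ?_⟩
    simp only [gradeProj_apply_eq]
    exact (DirectSum.sum_support_decompose 𝓥 x).symm

theorem IsProjSystem.shift {π : ℤ → V →ₗ[R] V} (hπ : IsProjSystem π) (k : ℤ) :
    IsProjSystem fun p => π (p - k) where
  self p := hπ.self _
  ne p q hpq := hπ.ne _ _ fun h => hpq (by linarith)
  exists_sum x := by
    obtain ⟨s, hs⟩ := hπ.exists_sum x
    refine ⟨s.map (Equiv.addRight k).toEmbedding, ?_⟩
    rw [Finset.sum_map]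
    simpa using hs

end ProjSystem

/-! ### Low-degree acyclicity of cones and flat base change -/

section Connectivity

variable {R W W' W'' : Type*} [CommRing R] [AddCommGroup W] [Module R W] [AddCommGroup W']
  [Module R W'] [AddCommGroup W''] [Module R W'']

/-- The mapping cone of `g` is acyclic in one degree, up to terms of higher filtration. -/
def ConnAt (d : W →ₗ[R] W) (d' : W' →ₗ[R] W') (g : W →ₗ[R] W') (𝓕 : ℤ → Submodule R W)
    (𝓕' : ℤ → Submodule R W') (n : ℤ) : Prop :=
  ∀ u v, d u ∈ 𝓕 (n - 2) → g u - d' v ∈ 𝓕' (n - 1) →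
    ∃ w y, u - d w ∈ 𝓕 (n - 1) ∧ v - g w - d' y ∈ 𝓕' n

variable {d : W →ₗ[R] W} {d' : W' →ₗ[R] W'} {g : W →ₗ[R] W'} {𝓕 : ℤ → Submodule R W}
  {𝓕' : ℤ → Submodule R W'} {n : ℤ}

/-- Flatness identifies the kernel after tensoring with the tensored kernel; surjectivity onto the
range of α survives tensoring by right exactness. -/
theorem exists_lTensor_eq (V : Type*) [AddCommGroup V] [Module R V] [Module.Flat R V]
    {α : W →ₗ[R] W'} {β : W' →ₗ[R] W''} (h : LinearMap.ker β ≤ LinearMap.range α)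
    {x : V ⊗[R] W'} (hx : β.lTensor V x = 0) : ∃ s, α.lTensor V s = x := by
  obtain ⟨t, rfl⟩ := (Module.Flat.lTensor_exact V (LinearMap.exact_subtype_ker_map β) x).1 hx
  obtain ⟨s, hs⟩ := LinearMap.lTensor_surjective V α.surjective_rangeRestrict
    ((Submodule.inclusion h).lTensor V t)
  refine ⟨s, ?_⟩
  have h1 : α = (LinearMap.range α).subtype ∘ₗ α.rangeRestrict := rfl
  have h2 : (LinearMap.ker β).subtype = (LinearMap.range α).subtype ∘ₗ Submodule.inclusion h := rfl
  rw [h1, h2, LinearMap.lTensor_comp, LinearMap.lTensor_comp, LinearMap.comp_apply, hs]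
  rfl

/-- Acyclicity in one degree, tensored with a flat module. -/
theorem ConnAt.exists_lTensor (h : ConnAt d d' g 𝓕 𝓕' n) {V : Type*} [AddCommGroup V] [Module R V]
    [Module.Flat R V] {x : V ⊗[R] W} {z : V ⊗[R] W'}
    (hx : ((𝓕 (n - 2)).mkQ ∘ₗ d).lTensor V x = 0)
    (hz : ((𝓕' (n - 1)).mkQ ∘ₗ g).lTensor V x = ((𝓕' (n - 1)).mkQ ∘ₗ d').lTensor V z) :
    ∃ w y, (𝓕 (n - 1)).mkQ.lTensor V x = ((𝓕 (n - 1)).mkQ ∘ₗ d).lTensor V w ∧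
      (𝓕' n).mkQ.lTensor V z = ((𝓕' n).mkQ ∘ₗ g).lTensor V w + ((𝓕' n).mkQ ∘ₗ d').lTensor V y := by
  -- The kernel of β consists of the cone cycles modulo the filtration, and the range of α of
  -- boundaries plus filtration. In this form `ConnAt` is an inclusion of a kernel in a range, which
  -- flatness preserves.
  let β : W × W' →ₗ[R] (W ⧸ 𝓕 (n - 2)) × (W' ⧸ 𝓕' (n - 1)) :=
    ((𝓕 (n - 2)).mkQ ∘ₗ d ∘ₗ LinearMap.fst R W W').prod
      ((𝓕' (n - 1)).mkQ ∘ₗ (g ∘ₗ LinearMap.fst R W W' - d' ∘ₗ LinearMap.snd R W W'))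
  let α : (W × W') × (𝓕 (n - 1) × 𝓕' n) →ₗ[R] W × W' :=
    (d ∘ₗ LinearMap.fst R W W' ∘ₗ LinearMap.fst R _ _ +
      (𝓕 (n - 1)).subtype ∘ₗ LinearMap.fst R _ _ ∘ₗ LinearMap.snd R _ _).prod
    (g ∘ₗ LinearMap.fst R W W' ∘ₗ LinearMap.fst R _ _ +
      d' ∘ₗ LinearMap.snd R W W' ∘ₗ LinearMap.fst R _ _ +
      (𝓕' n).subtype ∘ₗ LinearMap.snd R _ _ ∘ₗ LinearMap.snd R _ _)
  have hβα : LinearMap.ker β ≤ LinearMap.range α := by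
    rintro ⟨u, v⟩ huv
    have h1 := congrArg Prod.fst (LinearMap.mem_ker.1 huv)
    have h2 := congrArg Prod.snd (LinearMap.mem_ker.1 huv)
    obtain ⟨w, y, h3, h4⟩ := h u v ((Submodule.Quotient.mk_eq_zero _).1 h1)
      ((Submodule.Quotient.mk_eq_zero _).1 h2)
    refine ⟨((w, y), (⟨_, h3⟩, ⟨_, h4⟩)), Prod.ext ?_ ?_⟩
    · change d w + (u - d w) = u
      abel
    · change g w + d' y + (v - g w - d' y) = v
      abel
  have h0 : β.lTensor V ((LinearMap.inl R W W').lTensor V x + (LinearMap.inr R W W').lTensor V z) =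
      0 := by
    have h1 : β ∘ₗ LinearMap.inl R W W' = LinearMap.inl R _ _ ∘ₗ (𝓕 (n - 2)).mkQ ∘ₗ d +
        LinearMap.inr R _ _ ∘ₗ (𝓕' (n - 1)).mkQ ∘ₗ g := by
      refine LinearMap.ext fun a => Prod.ext ?_ ?_ <;> simp [β]
    have h2 : β ∘ₗ LinearMap.inr R W W' = -(LinearMap.inr R _ _ ∘ₗ (𝓕' (n - 1)).mkQ ∘ₗ d') := by
      refine LinearMap.ext fun a => Prod.ext ?_ ?_ <;> simp [β]
    rw [map_add, ← LinearMap.comp_apply, ← LinearMap.lTensor_comp, h1, ← LinearMap.comp_apply,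
      ← LinearMap.lTensor_comp, h2, LinearMap.lTensor_add, LinearMap.lTensor_neg,
      LinearMap.add_apply, LinearMap.neg_apply, LinearMap.lTensor_comp, LinearMap.comp_apply, hx,
      LinearMap.lTensor_comp, LinearMap.comp_apply, hz, LinearMap.lTensor_comp _ _ (_ ∘ₗ d'),
      LinearMap.comp_apply]
    simp
  obtain ⟨s, hs⟩ := exists_lTensor_eq V hβα h0
  refine ⟨(LinearMap.fst R W W' ∘ₗ LinearMap.fst R _ _).lTensor V s,
    (LinearMap.snd R W W' ∘ₗ LinearMap.fst R _ _).lTensor V s, ?_, ?_⟩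
  · have h1 := congrArg (((𝓕 (n - 1)).mkQ ∘ₗ LinearMap.fst R W W').lTensor V) hs
    rw [map_add, ← LinearMap.lTensor_comp_apply, ← LinearMap.lTensor_comp_apply,
      ← LinearMap.lTensor_comp_apply] at h1
    have h2 : ((𝓕 (n - 1)).mkQ ∘ₗ LinearMap.fst R W W') ∘ₗ LinearMap.inl R W W' =
      (𝓕 (n - 1)).mkQ := rfl
    have h3 : ((𝓕 (n - 1)).mkQ ∘ₗ LinearMap.fst R W W') ∘ₗ LinearMap.inr R W W' = 0 :=
      LinearMap.ext fun a => by simp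
    have h4 : ((𝓕 (n - 1)).mkQ ∘ₗ LinearMap.fst R W W') ∘ₗ α =
        ((𝓕 (n - 1)).mkQ ∘ₗ d) ∘ₗ LinearMap.fst R W W' ∘ₗ LinearMap.fst R _ _ :=
      LinearMap.ext fun a => by simp [α]
    rw [h2, h3, h4, LinearMap.lTensor_zero, LinearMap.zero_apply, add_zero] at h1
    rw [← h1, ← LinearMap.lTensor_comp_apply]
  · have h1 := congrArg (((𝓕' n).mkQ ∘ₗ LinearMap.snd R W W').lTensor V) hs
    rw [map_add, ← LinearMap.lTensor_comp_apply, ← LinearMap.lTensor_comp_apply,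
      ← LinearMap.lTensor_comp_apply] at h1
    have h2 : ((𝓕' n).mkQ ∘ₗ LinearMap.snd R W W') ∘ₗ LinearMap.inr R W W' = (𝓕' n).mkQ := rfl
    have h3 : ((𝓕' n).mkQ ∘ₗ LinearMap.snd R W W') ∘ₗ LinearMap.inl R W W' = 0 :=
      LinearMap.ext fun a => by simp
    have h4 : ((𝓕' n).mkQ ∘ₗ LinearMap.snd R W W') ∘ₗ α =
        ((𝓕' n).mkQ ∘ₗ g) ∘ₗ LinearMap.fst R W W' ∘ₗ LinearMap.fst R _ _ +
        ((𝓕' n).mkQ ∘ₗ d') ∘ₗ LinearMap.snd R W W' ∘ₗ LinearMap.fst R _ _ :=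
      LinearMap.ext fun a => by simp [α]
    rw [h2, h3, h4, LinearMap.lTensor_zero, LinearMap.zero_apply, zero_add, LinearMap.lTensor_add,
      LinearMap.add_apply] at h1
    rw [← h1, ← LinearMap.lTensor_comp_apply, ← LinearMap.lTensor_comp_apply]

end Connectivity

/-! ### Tensoring with a flat graded complex, row by row -/

section TensorConnectivity

variable {R V V' W W' : Type*} [CommRing R] [AddCommGroup V] [Module R V] [AddCommGroup W]
  [Module R W] [AddCommGroup W'] [Module R W'] [AddCommGroup V'] [Module R V']

/-- Elements of `V ⊗ W` with component of degree `p` in `V` in the filtration step of total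
degree `n`. -/
def lev (π : ℤ → V →ₗ[R] V) (𝓕 : ℤ → Submodule R W) (p n : ℤ) : Submodule R (V ⊗[R] W) :=
  LinearMap.ker (TensorProduct.map (π p) (𝓕 (n - p)).mkQ)

theorem map_map_apply {A A' A'' B B' B'' : Type*} [AddCommGroup A] [Module R A] [AddCommGroup B]
    [Module R B] [AddCommGroup A'] [Module R A'] [AddCommGroup B'] [Module R B']
    [AddCommGroup A''] [Module R A''] [AddCommGroup B''] [Module R B'']
    (f' : A' →ₗ[R] A'') (g' : B' →ₗ[R] B'') (f : A →ₗ[R] A') (g : B →ₗ[R] B') (x : A ⊗[R] B) :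
    TensorProduct.map f' g' (TensorProduct.map f g x) =
      TensorProduct.map (f' ∘ₗ f) (g' ∘ₗ g) x := by
  rw [TensorProduct.map_comp, LinearMap.comp_apply]

theorem mem_lev_of_rTensor_eq_zero {π : ℤ → V →ₗ[R] V} {𝓕 : ℤ → Submodule R W} {t : V ⊗[R] W}
    {p n : ℤ} (ht : (π p).rTensor W t = 0) : t ∈ lev π 𝓕 p n := by
  have : TensorProduct.map (π p) (𝓕 (n - p)).mkQ t =
      (𝓕 (n - p)).mkQ.lTensor V ((π p).rTensor W t) := by
    rw [LinearMap.lTensor, LinearMap.rTensor, map_map_apply]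
    rfl
  rw [lev, LinearMap.mem_ker, this, ht, map_zero]

variable {π : ℤ → V →ₗ[R] V} (hπ : IsProjSystem π) {δ ε : V →ₗ[R] V}
  (hδ : ∀ p, π p ∘ₗ δ = δ ∘ₗ π (p + 1)) {e : ℤ → R} (he : ∀ p, e p * e p = 1)
  (hε : ∀ p, π p ∘ₗ ε = e p • π p)
  {d : W →ₗ[R] W} {d' : W' →ₗ[R] W'} {α : W →ₗ[R] W} {α' : W' →ₗ[R] W'} {g : W →ₗ[R] W'}
  {𝓕 : ℤ → Submodule R W} {𝓕' : ℤ → Submodule R W'}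
  (hα : ∀ n, 𝓕 n ≤ (𝓕 n).comap α) (hα' : ∀ n, 𝓕' n ≤ (𝓕' n).comap α')
  {D : V ⊗[R] W →ₗ[R] V ⊗[R] W} {D' : V ⊗[R] W' →ₗ[R] V ⊗[R] W'}
  (hD : D = TensorProduct.map δ α + TensorProduct.map ε d)
  (hD' : D' = TensorProduct.map δ α' + TensorProduct.map ε d')

include hδ hε hα hD in
/-- The component of `D x`, if the next component of `x` is in high filtration. -/
theorem map_apply_of_mem_lev {p n : ℤ} {x : V ⊗[R] W} (hx : x ∈ lev π 𝓕 (p + 1) n) :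
    TensorProduct.map (π p) (𝓕 (n - 1 - p)).mkQ (D x) =
      e p • TensorProduct.map (π p) ((𝓕 (n - 1 - p)).mkQ ∘ₗ d) x := by
  have h0 : n - (p + 1) = n - 1 - p := by ring
  rw [lev, LinearMap.mem_ker, h0] at hx
  have h1 : (𝓕 (n - 1 - p)).mkQ ∘ₗ α =
      Submodule.mapQ _ _ α (hα (n - 1 - p)) ∘ₗ (𝓕 (n - 1 - p)).mkQ := rfl
  rw [hD, LinearMap.add_apply, map_add, map_map_apply, map_map_apply, hδ, hε, h1,
    ← map_map_apply, hx, map_zero, zero_add, TensorProduct.map_smul_left, LinearMap.smul_apply]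

include hπ hδ hε hD in
theorem map_apply_rTensor_of_ne {p q : ℤ} (hpq : p < q) (Q : Submodule R W) (w : V ⊗[R] W) :
    TensorProduct.map (π q) Q.mkQ (D ((π p).rTensor W w)) = 0 := by
  rw [hD, LinearMap.add_apply, map_add, LinearMap.rTensor, map_map_apply, map_map_apply,
    map_map_apply, map_map_apply, hδ, LinearMap.comp_assoc,
    hπ.ne (q + 1) p (by linarith), hε, LinearMap.smul_comp,
    hπ.ne q p hpq.ne']
  simp

include hπ hδ hε hD in
theorem map_apply_rTensor_self {p : ℤ} (Q : Submodule R W) (w : V ⊗[R] W) :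
    TensorProduct.map (π p) Q.mkQ (D ((π p).rTensor W w)) =
      e p • TensorProduct.map (π p) (Q.mkQ ∘ₗ d) w := by
  rw [hD, LinearMap.add_apply, map_add, LinearMap.rTensor, map_map_apply, map_map_apply,
    map_map_apply, map_map_apply, hδ, LinearMap.comp_assoc,
    hπ.ne (p + 1) p (by linarith), hε, LinearMap.smul_comp,
    hπ.self p, LinearMap.comp_id]
  simp [TensorProduct.map_smul_left]

variable [Module.Flat R V] (hDD : D ∘ₗ D = 0) (hDD' : D' ∘ₗ D' = 0)
  (hgD : g.lTensor V ∘ₗ D = D' ∘ₗ g.lTensor V)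

include hπ hδ he hε hα hα' hD hD' in
-- Rows above P are already negligible, so in row P only d and d' contribute and the hypothesis on
-- this row applies. The correction sits in row P; the differentials carry it to rows P and P - 1
-- only, leaving the rows above intact.
theorem exists_lev_step {n P : ℤ} (hrow : ConnAt d d' g 𝓕 𝓕' (n - P)) {x : V ⊗[R] W}
    {z : V ⊗[R] W'} (hx : D x ∈ lev π 𝓕 P (n - 2)) (hz : g.lTensor V x - D' z ∈ lev π 𝓕' P (n - 1))
    (h : ∀ p > P, x ∈ lev π 𝓕 p (n - 1) ∧ z ∈ lev π 𝓕' p n) :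
    ∃ w y, ∀ p ≥ P, x - D w ∈ lev π 𝓕 p (n - 1) ∧
      z - g.lTensor V w - D' y ∈ lev π 𝓕' p n := by
  have h1 : TensorProduct.map (π P) ((𝓕 (n - P - 2)).mkQ ∘ₗ d) x = 0 := by
    have h2 := map_apply_of_mem_lev hδ hε hα hD (h (P + 1) (by linarith)).1
    have h3 : n - 1 - 1 - P = n - P - 2 := by ring
    have h4 : n - 2 - P = n - P - 2 := by ring
    rw [lev, LinearMap.mem_ker, h4] at hx
    rw [h3, hx] at h2
    have := congrArg (fun t => e P • t) h2
    simpa only [smul_zero, smul_smul, he, one_smul] using this.symm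
  have h2 : TensorProduct.map (π P) ((𝓕' (n - P - 1)).mkQ ∘ₗ g) x =
      e P • TensorProduct.map (π P) ((𝓕' (n - P - 1)).mkQ ∘ₗ d') z := by
    have h2 := map_apply_of_mem_lev hδ hε hα' hD' (h (P + 1) (by linarith)).2
    have h3 : n - 1 - P = n - P - 1 := by ring
    rw [lev, LinearMap.mem_ker, map_sub, h3, LinearMap.lTensor, map_map_apply, LinearMap.comp_id,
      sub_eq_zero] at hz
    rw [h3] at h2
    rw [hz, h2]
  obtain ⟨w, y, hw, hy⟩ := hrow.exists_lTensor (V := V) (x := (π P).rTensor W x)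
    (z := e P • (π P).rTensor W' z)
    (by rw [LinearMap.lTensor, LinearMap.rTensor, map_map_apply]; exact h1)
    (by
      rw [map_smul, LinearMap.lTensor, LinearMap.lTensor, LinearMap.rTensor, LinearMap.rTensor,
        map_map_apply, map_map_apply]
      exact h2)
  have hw' := congrArg (TensorProduct.map (π P) LinearMap.id) hw
  have hy' := congrArg (fun t => e P • TensorProduct.map (π P) LinearMap.id t) hy
  simp only [map_add, map_smul, LinearMap.lTensor, LinearMap.rTensor, map_map_apply,
    LinearMap.comp_id, LinearMap.id_comp, hπ.self, smul_smul, he, one_smul, smul_add] at hw' hy'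
  -- The factors compensate the sign `e P` that `D` and `D'` bring in on row P.
  refine ⟨e P • (π P).rTensor W w, e P • e P • (π P).rTensor W' y, fun p hp => ?_⟩
  rw [smul_smul, he, one_smul]
  have hg : TensorProduct.map (π p) (𝓕' (n - p)).mkQ (g.lTensor V ((π P).rTensor W w)) =
      TensorProduct.map (π p ∘ₗ π P) ((𝓕' (n - p)).mkQ ∘ₗ g) w := by
    rw [LinearMap.lTensor, LinearMap.rTensor, map_map_apply, map_map_apply]
    rfl
  have hm : n - 1 - p = n - p - 1 := by ring
  rcases hp.lt_or_eq with hp | rfl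
  · obtain ⟨hx1, hz1⟩ := h p hp
    rw [lev, LinearMap.mem_ker] at hx1 hz1 ⊢
    rw [lev, LinearMap.mem_ker, map_sub, map_sub, map_sub, map_smul, map_smul, map_smul, map_smul, hx1, hz1,
      map_apply_rTensor_of_ne hπ hδ hε hD hp, map_apply_rTensor_of_ne hπ hδ hε hD' hp, hg,
      hπ.ne p P hp.ne']
    simp
  · rw [lev, LinearMap.mem_ker, lev, LinearMap.mem_ker, map_sub, map_sub, map_sub, map_smul,
      map_smul, map_smul, map_smul, map_apply_rTensor_self hπ hδ hε hD, map_apply_rTensor_self hπ hδ hε hD',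
      hg, hπ.self, hm, hw', hy', smul_smul, he, one_smul]
    refine ⟨sub_self _, ?_⟩
    abel

include hπ hδ he hε hα hα' hD hD' hDD hDD' hgD in
/-- Tensoring with a flat graded complex: the rows of degrees `≥ P` contribute their
connectivity. -/
theorem exists_of_rows {n P : ℤ} (hrow : ∀ p ≥ P, ConnAt d d' g 𝓕 𝓕' (n - p)) {x : V ⊗[R] W}
    {z : V ⊗[R] W'} (hx : ∀ p ≥ P, D x ∈ lev π 𝓕 p (n - 2))
    (hz : ∀ p ≥ P, g.lTensor V x - D' z ∈ lev π 𝓕' p (n - 1)) :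
    ∃ w y, ∀ p ≥ P, x - D w ∈ lev π 𝓕 p (n - 1) ∧
      z - g.lTensor V w - D' y ∈ lev π 𝓕' p n := by
  -- Here k counts the rows from P upwards that are still to be corrected; the topmost one comes
  -- first. The cycle conditions survive a correction because D and D' square to zero and commute
  -- with g.
  have key : ∀ (k : ℕ) (x : V ⊗[R] W) (z : V ⊗[R] W'), (∀ p ≥ P, D x ∈ lev π 𝓕 p (n - 2)) →
      (∀ p ≥ P, g.lTensor V x - D' z ∈ lev π 𝓕' p (n - 1)) →
      (∀ p ≥ P + k, x ∈ lev π 𝓕 p (n - 1) ∧ z ∈ lev π 𝓕' p n) →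
      ∃ w y, ∀ p ≥ P, x - D w ∈ lev π 𝓕 p (n - 1) ∧
        z - g.lTensor V w - D' y ∈ lev π 𝓕' p n := by
    intro k
    induction k with
    | zero =>
      intro x z _ _ h
      refine ⟨0, 0, fun p hp => ?_⟩
      simpa using h p (by simpa using hp)
    | succ k ih =>
      intro x z hx hz h
      obtain ⟨w, y, hwy⟩ := exists_lev_step hπ hδ he hε hα hα' hD hD' (hrow (P + k) (by simp))
        (hx (P + k) (by simp)) (hz (P + k) (by simp))
        (fun p hp => h p (by push_cast; linarith [Int.add_one_le_iff.2 hp]))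
      have h1 : D (D w) = 0 := LinearMap.congr_fun hDD w
      have h2 : D' (D' y) = 0 := LinearMap.congr_fun hDD' y
      have h3 : g.lTensor V (D w) = D' (g.lTensor V w) := LinearMap.congr_fun hgD w
      obtain ⟨w', y', h'⟩ := ih (x - D w) (z - g.lTensor V w - D' y)
        (fun p hp => by rw [map_sub, h1, sub_zero]; exact hx p hp)
        (fun p hp => by
          rw [map_sub, map_sub, map_sub, h2, h3, sub_zero, sub_sub_sub_cancel_right]
          exact hz p hp) hwy
      refine ⟨w + w', y + y', fun p hp => ?_⟩
      obtain ⟨h4, h5⟩ := h' p hp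
      refine ⟨?_, ?_⟩
      · rwa [map_add, ← sub_sub]
      · rw [map_add, map_add]
        convert h5 using 1
        abel
  -- A tensor has finitely many nonzero rows, so the induction has a start.
  obtain ⟨B, hB⟩ := hπ.exists_bound_tensor x
  obtain ⟨B', hB'⟩ := hπ.exists_bound_tensor z
  refine key (max B B' - P).toNat x z hx hz fun p hp => ?_
  have hp' : p ≥ max B B' := by
    have := Int.self_le_toNat (max B B' - P)
    linarith
  exact ⟨mem_lev_of_rTensor_eq_zero (hB p (le_trans (le_max_left _ _) hp')),
    mem_lev_of_rTensor_eq_zero (hB' p (le_trans (le_max_right _ _) hp'))⟩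

end TensorConnectivity

/-! ### The tensor algebra as a graded algebra -/

section WordDecomposition

variable {R M : Type*} [CommRing R] [AddCommGroup M] [Module R M] (𝓜 : ℤ → Submodule R M)
  [DirectSum.Decomposition 𝓜]

instance gradedMonoid_wordGrading : SetLike.GradedMonoid (wordGrading 𝓜) where
  one_mem := one_mem_wordGrading
  mul_mem p q x y hx hy := mul_mem_wordGrading p q x hx y hy

/-- The decomposition of letters into their homogeneous components. -/
noncomputable def letterDecomposition : M →ₗ[R] ⨁ n, wordGrading 𝓜 n :=
  glue 𝓜 (N := ⨁ n, wordGrading 𝓜 n) fun p => DirectSum.lof R ℤ (fun n => wordGrading 𝓜 n) (p + 1) ∘ₗ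
    (TensorAlgebra.ι R ∘ₗ (𝓜 p).subtype).codRestrict _ fun a => ι_mem_wordGrading a.2

theorem letterDecomposition_apply {p : ℤ} {a : M} (ha : a ∈ 𝓜 p) :
    letterDecomposition 𝓜 a =
      DirectSum.of (fun n => wordGrading 𝓜 n) (p + 1) ⟨_, ι_mem_wordGrading ha⟩ :=
  glue_apply 𝓜 (N := ⨁ n, wordGrading 𝓜 n) _ ha

theorem coeAlgHom_comp_lift_letterDecomposition :
    (DirectSum.coeAlgHom (wordGrading 𝓜)).comp (TensorAlgebra.lift R (letterDecomposition 𝓜)) =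
      AlgHom.id R (TensorAlgebra R M) := by
  refine TensorAlgebra.hom_ext (linearMap_ext_of_iSup_eq_top (iSup_eq_top_of_decomposition 𝓜)
    fun p a ha => ?_)
  simp only [LinearMap.comp_apply, AlgHom.toLinearMap_apply, AlgHom.comp_apply,
    TensorAlgebra.lift_ι_apply, letterDecomposition_apply 𝓜 ha, AlgHom.id_apply,
    DirectSum.coeAlgHom_of]

theorem lift_letterDecomposition_apply {n : ℤ} (x : wordGrading 𝓜 n) :
    TensorAlgebra.lift R (letterDecomposition 𝓜) (x : TensorAlgebra R M) =
      DirectSum.of (fun n => wordGrading 𝓜 n) n x := by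
  have hle : wordGrading 𝓜 n ≤ (LinearMap.range (DirectSum.lof R ℤ
      (fun n => wordGrading 𝓜 n) n)).comap
      (TensorAlgebra.lift R (letterDecomposition 𝓜)).toLinearMap := by
    refine wordGrading_le fun l hl => ?_
    rw [Submodule.mem_comap, AlgHom.toLinearMap_apply]
    clear x
    induction hl with
    | nil => exact ⟨⟨1, one_mem_wordGrading⟩, (map_one _).symm⟩
    | @cons a l p n ha hl ih =>
      obtain ⟨y, hy⟩ := ih
      rw [word_cons, map_mul, ← hy, TensorAlgebra.lift_ι_apply, letterDecomposition_apply 𝓜 ha]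
      exact ⟨_, (DirectSum.of_mul_of _ _).symm⟩
  obtain ⟨y, hy⟩ := hle x.2
  have h1 := AlgHom.congr_fun (coeAlgHom_comp_lift_letterDecomposition 𝓜) (x : TensorAlgebra R M)
  rw [AlgHom.comp_apply, AlgHom.id_apply] at h1
  rw [AlgHom.toLinearMap_apply] at hy
  rw [← hy] at h1 ⊢
  have h2 : (y : TensorAlgebra R M) = x := by
    rw [← h1]
    exact (DirectSum.coeAlgHom_of (wordGrading 𝓜) n y).symm
  rw [Subtype.ext h2]
  rfl

noncomputable instance gradedAlgebra_wordGrading : GradedAlgebra (wordGrading 𝓜) :=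
  GradedAlgebra.ofAlgHom _ (TensorAlgebra.lift R (letterDecomposition 𝓜))
    (coeAlgHom_comp_lift_letterDecomposition 𝓜) fun _ => lift_letterDecomposition_apply 𝓜

end WordDecomposition

/-! ### Flatness of tensor algebras -/

section Flat

variable (R M : Type*) [CommRing R] [AddCommGroup M] [Module R M]

theorem flat_of_decomposition {R M : Type*} [CommRing R] [AddCommGroup M] [Module R M]
    (𝓜 : ℤ → Submodule R M) [DirectSum.Decomposition 𝓜] [∀ n, Module.Flat R (𝓜 n)] :
    Module.Flat R M := Module.Flat.of_linearEquiv (DirectSum.decomposeLinearEquiv 𝓜)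

instance flat_tensorPower [Module.Flat R M] (n : ℕ) : Module.Flat R (⨂[R]^n M) := by
  induction n with
  | zero => exact Module.Flat.of_linearEquiv (PiTensorProduct.isEmptyEquiv (Fin 0))
  | succ n ih =>
    have : Module.Flat R (⨂[R]^1 M) := Module.Flat.of_linearEquiv
      (PiTensorProduct.subsingletonEquiv (R := R) (s := fun _ : Fin 1 => M) 0)
    exact Module.Flat.of_linearEquiv (TensorPower.mulEquiv (R := R) (M := M) (n := n) (m := 1)).symm

instance flat_tensorAlgebra [Module.Flat R M] : Module.Flat R (TensorAlgebra R M) :=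
  Module.Flat.of_linearEquiv (TensorAlgebra.equivDirectSum (R := R) (M := M)).toLinearEquiv

end Flat

/-! ### Linear differentials on tensor algebras -/

section LinearPart

variable {R M M' : Type*} [CommRing R] [AddCommGroup M] [Module R M] [AddCommGroup M'] [Module R M']

/-- The operators `(t, t') ↦ (a t, (δ a) t + (s a) t')`. -/
noncomputable def linStep (δ s : M →ₗ[R] M) :
    M →ₗ[R] Module.End R (TensorAlgebra R M × TensorAlgebra R M) where
  toFun a := (LinearMap.mulLeft R (TensorAlgebra.ι R a) ∘ₗ LinearMap.fst R _ _).prod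
    (LinearMap.mulLeft R (TensorAlgebra.ι R (δ a)) ∘ₗ LinearMap.fst R _ _ +
      LinearMap.mulLeft R (TensorAlgebra.ι R (s a)) ∘ₗ LinearMap.snd R _ _)
  map_add' a b := by
    refine LinearMap.ext fun x => Prod.ext ?_ ?_
    · simp [add_mul]
    · simp [add_mul]
      abel
  map_smul' r a := by
    refine LinearMap.ext fun x => Prod.ext ?_ ?_ <;> simp

theorem linStep_apply (δ s : M →ₗ[R] M) (a : M) (x : TensorAlgebra R M × TensorAlgebra R M) :
    linStep δ s a x = (TensorAlgebra.ι R a * x.1,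
      TensorAlgebra.ι R (δ a) * x.1 + TensorAlgebra.ι R (s a) * x.2) := rfl

/-- The map on the tensor algebra applying `δ` to one letter and `s` to the letters before. -/
noncomputable def linDiff (δ s : M →ₗ[R] M) : TensorAlgebra R M →ₗ[R] TensorAlgebra R M :=
  LinearMap.snd R _ _ ∘ₗ LinearMap.applyₗ (1, 0) ∘ₗ
    (TensorAlgebra.lift R (linStep δ s)).toLinearMap

@[simp] theorem linDiff_one (δ s : M →ₗ[R] M) : linDiff δ s 1 = 0 := by simp [linDiff]

theorem linDiff_ι_mul (δ s : M →ₗ[R] M) (a : M) (t : TensorAlgebra R M) :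
    linDiff δ s (TensorAlgebra.ι R a * t) =
      TensorAlgebra.ι R (δ a) * t + TensorAlgebra.ι R (s a) * linDiff δ s t := by
  have : LinearMap.fst R _ _ ∘ₗ LinearMap.applyₗ (1, 0) ∘ₗ
      (TensorAlgebra.lift R (linStep δ s)).toLinearMap = LinearMap.id := by
    refine word_induction (by simp) fun b w hw => ?_
    simp only [LinearMap.comp_apply, LinearMap.id_apply, AlgHom.toLinearMap_apply,
      LinearMap.applyₗ_apply_apply, LinearMap.fst_apply] at hw
    simp [linStep_apply, hw]
  have ht := LinearMap.congr_fun this t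
  simp only [LinearMap.comp_apply, LinearMap.id_apply, AlgHom.toLinearMap_apply,
    LinearMap.applyₗ_apply_apply, LinearMap.fst_apply] at ht
  simp [linDiff, linStep_apply, ht]

theorem linDiff_linDiff {δ s : M →ₗ[R] M} (h1 : ∀ a, δ (δ a) = 0) (h2 : ∀ a, δ (s a) = -s (δ a))
    (t : TensorAlgebra R M) : linDiff δ s (linDiff δ s t) = 0 := by
  suffices h : linDiff δ s ∘ₗ linDiff δ s = 0 from LinearMap.congr_fun h t
  refine word_induction (by simp) fun a w hw => ?_
  rw [LinearMap.comp_apply, LinearMap.zero_apply] at hw ⊢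
  rw [linDiff_ι_mul, map_add, linDiff_ι_mul, linDiff_ι_mul, h1, h2, hw]
  simp

theorem letterwise_linDiff {δ s : M →ₗ[R] M} {δ' s' : M' →ₗ[R] M'} {f : M →ₗ[R] M'}
    (h1 : ∀ a, f (δ a) = δ' (f a)) (h2 : ∀ a, f (s a) = s' (f a)) (t : TensorAlgebra R M) :
    letterwise f (linDiff δ s t) = linDiff δ' s' (letterwise f t) := by
  suffices h : (letterwise f).toLinearMap ∘ₗ linDiff δ s =
    linDiff δ' s' ∘ₗ (letterwise f).toLinearMap from LinearMap.congr_fun h t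
  refine word_induction (by simp) fun a w hw => ?_
  simp only [LinearMap.comp_apply, AlgHom.toLinearMap_apply] at hw ⊢
  rw [linDiff_ι_mul, map_add, map_mul, map_mul, map_mul, hw, letterwise_ι,
    letterwise_ι, letterwise_ι, linDiff_ι_mul, h1, h2]

variable {𝓜 : ℤ → Submodule R M} {𝓜' : ℤ → Submodule R M'}

theorem hasDeg_linDiff {δ s : M →ₗ[R] M} {k : ℤ} (hδ : HasDeg 𝓜 𝓜 k δ) (hs : HasDeg 𝓜 𝓜 0 s) :
    HasDeg (wordGrading 𝓜) (wordGrading 𝓜) k (linDiff δ s) := by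
  intro n
  suffices h : wordGrading 𝓜 n ≤ (wordGrading 𝓜 (n + k)).comap (linDiff δ s) from fun x hx => h hx
  refine wordGrading_le fun l hl => ?_
  rw [Submodule.mem_comap]
  induction hl with
  | nil => simp
  | @cons a l p n ha hl ih =>
    rw [word_cons, linDiff_ι_mul]
    refine add_mem ?_ ?_
    · have := mul_mem_wordGrading _ _ _ (ι_mem_wordGrading (hδ p a ha)) _ hl.word_mem
      convert this using 2
      ring
    · have := mul_mem_wordGrading _ _ _ (ι_mem_wordGrading (hs p a ha)) _ ih
      convert this using 2
      ring

theorem hasDeg_letterwise {f : M →ₗ[R] M'} (hf : HasDeg 𝓜 𝓜' 0 f) :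
    HasDeg (wordGrading 𝓜) (wordGrading 𝓜') 0 (letterwise f).toLinearMap := by
  intro n
  suffices h : wordGrading 𝓜 n ≤ (wordGrading 𝓜' (n + 0)).comap (letterwise f).toLinearMap from
    fun x hx => h hx
  refine wordGrading_le fun l hl => ?_
  rw [Submodule.mem_comap, AlgHom.toLinearMap_apply, add_zero]
  induction hl with
  | nil => simpa using one_mem_wordGrading
  | @cons a l p n ha hl ih =>
    rw [word_cons, map_mul, letterwise_ι]
    have := hf p a ha
    rw [add_zero] at this
    exact mul_mem_wordGrading _ _ _ (ι_mem_wordGrading this) _ ih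

end LinearPart

/-! ### The grading by word length -/

section Length

variable (R M : Type*) [CommRing R] [AddCommGroup M] [Module R M]

/-- The grading of a module with all elements in degree zero. -/
def concentrated (n : ℤ) : Submodule R M := if n = 0 then ⊤ else ⊥

variable {R M} in
theorem mem_concentrated_zero (x : M) : x ∈ concentrated R M 0 := by simp [concentrated]

/-- With all letters in degree zero, a word has suspended degree equal to its length. The length
grading is thereby an instance of `wordGrading`. -/
noncomputable instance decomposition_concentrated :
    DirectSum.Decomposition (concentrated R M) :=
  DirectSum.Decomposition.ofLinearMap _
    (DirectSum.lof R ℤ (fun n => concentrated R M n) 0 ∘ₗ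
      LinearMap.id.codRestrict _ mem_concentrated_zero)
    (LinearMap.ext fun x => by simp)
    (by
      refine DirectSum.linearMap_ext R fun n => LinearMap.ext fun x => ?_
      obtain ⟨x, hx⟩ := x
      by_cases hn : n = 0
      · subst hn
        simp
        rfl
      · have : x = 0 := by simpa [concentrated, hn] using hx
        subst this
        have h0 : (⟨0, hx⟩ : concentrated R M n) = 0 := rfl
        rw [h0, map_zero, map_zero])

variable {R M} {M' : Type*} [AddCommGroup M'] [Module R M']

theorem hasDeg_concentrated (f : M →ₗ[R] M') :
    HasDeg (concentrated R M) (concentrated R M') 0 f := by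
  intro n x hx
  by_cases hn : n = 0
  · subst hn
    exact mem_concentrated_zero _
  · have : x = 0 := by simpa [concentrated, hn] using hx
    rw [this, map_zero]
    exact zero_mem _

/-- The projection of the tensor algebra to words of length `n`. -/
noncomputable def lenProj (n : ℤ) : TensorAlgebra R M →ₗ[R] TensorAlgebra R M :=
  gradeProj (wordGrading (concentrated R M)) n

theorem isProjSystem_lenProj : IsProjSystem (lenProj (R := R) (M := M)) := isProjSystem_gradeProj _

theorem word_mem_wordGrading_concentrated (l : List M) :
    word R l ∈ wordGrading (concentrated R M) l.length := by
  induction l with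
  | nil => exact one_mem_wordGrading
  | cons a l ih =>
    have := mul_mem_wordGrading _ _ _ (ι_mem_wordGrading (mem_concentrated_zero (R := R) a)) _ ih
    rw [word_cons]
    convert this using 2
    rw [List.length_cons]
    push_cast
    ring

theorem lenProj_word (l : List M) (n : ℤ) :
    lenProj n (word R l) = if (l.length : ℤ) = n then word R l else 0 := by
  split_ifs with h
  · subst h
    exact gradeProj_of_mem (word_mem_wordGrading_concentrated l)
  · exact gradeProj_of_mem_ne h (word_mem_wordGrading_concentrated l)

theorem lenProj_ι_mul (a : M) (t : TensorAlgebra R M) (n : ℤ) :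
    lenProj (n + 1) (TensorAlgebra.ι R a * t) = TensorAlgebra.ι R a * lenProj n t := by
  have h : HasDeg (wordGrading (concentrated R M)) (wordGrading (concentrated R M)) 1
      (LinearMap.mulLeft R (TensorAlgebra.ι R a)) := fun n x hx => by
    have := mul_mem_wordGrading _ _ _ (ι_mem_wordGrading (mem_concentrated_zero (R := R) a)) _ hx
    rw [LinearMap.mulLeft_apply]
    convert this using 2
    ring
  exact h.gradeProj_apply rfl t

theorem lenProj_linDiff (δ s : M →ₗ[R] M) (t : TensorAlgebra R M) (n : ℤ) :
    lenProj n (linDiff δ s t) = linDiff δ s (lenProj n t) :=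
  (hasDeg_linDiff (hasDeg_concentrated δ) (hasDeg_concentrated s)).gradeProj_apply (add_zero n) t

theorem lenProj_letterwise (f : M →ₗ[R] M') (t : TensorAlgebra R M) (n : ℤ) :
    lenProj n (letterwise f t) = letterwise f (lenProj n t) :=
  (hasDeg_letterwise (hasDeg_concentrated f)).gradeProj_apply (add_zero n) t

/-- Sums of words of length at most `n`. -/
def lenLE (n : ℤ) : Submodule R (TensorAlgebra R M) where
  carrier := {x | ∀ q > n, lenProj q x = 0}
  add_mem' hx hy q hq := by rw [map_add, hx q hq, hy q hq, add_zero]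
  zero_mem' q _ := map_zero _
  smul_mem' r x hx q hq := by rw [map_smul, hx q hq, smul_zero]

theorem lenLE_mono {m n : ℤ} (h : m ≤ n) : lenLE (R := R) (M := M) m ≤ lenLE n :=
  fun _ hx q hq => hx q (by linarith)

theorem word_mem_lenLE (l : List M) : word R l ∈ lenLE (l.length : ℤ) := fun q hq => by
  rw [lenProj_word, if_neg hq.ne]

theorem ι_mul_mem_lenLE (a : M) {t : TensorAlgebra R M} {n : ℤ} (ht : t ∈ lenLE n) :
    TensorAlgebra.ι R a * t ∈ lenLE (n + 1) := fun q hq => by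
  obtain ⟨q, rfl⟩ : ∃ q', q = q' + 1 := ⟨q - 1, by ring⟩
  rw [lenProj_ι_mul, ht q (by linarith), mul_zero]

/-- It suffices to test how a map changes lengths on words. -/
theorem map_mem_lenLE {L : TensorAlgebra R M →ₗ[R] TensorAlgebra R M'} {k : ℤ}
    (h : ∀ l : List M, L (word R l) ∈ lenLE (l.length + k)) {n : ℤ} {x : TensorAlgebra R M}
    (hx : x ∈ lenLE n) : L x ∈ lenLE (n + k) := by
  obtain ⟨s, hs⟩ := isProjSystem_lenProj.exists_sum x
  have hq : ∀ q, wordGrading (concentrated R M) q ≤ (lenLE (q + k)).comap L := by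
    intro q
    refine wordGrading_le fun l hl => ?_
    have h1 : (l.length : ℤ) = q ∨ word R l = 0 := by
      by_cases h2 : (l.length : ℤ) = q
      · exact Or.inl h2
      · refine Or.inr ?_
        have h3 := gradeProj_of_mem hl.word_mem
        change lenProj q (word R l) = _ at h3
        rw [← h3, lenProj_word, if_neg h2]
    rcases h1 with rfl | h1
    · exact h l
    · rw [h1]
      exact zero_mem _
  rw [hs, map_sum]
  refine Submodule.sum_mem _ fun q _ => ?_
  by_cases hqn : q ≤ n
  · exact lenLE_mono (by linarith) (hq q (gradeProj_mem x))
  · rw [hx q (by linarith), map_zero]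
    exact zero_mem _

end Length

/-! ### Leading terms of the bar differential and of B(f) in word length -/

section LeadingTerm

variable {R M M' N : Type*} [CommRing R] [AddCommGroup M] [Module R M] [AddCommGroup M']
  [Module R M'] {𝓜 : ℤ → Submodule R M} [DirectSum.Decomposition 𝓜]
  {𝓜' : ℤ → Submodule R M'} [DirectSum.Decomposition 𝓜']

theorem coderiv_word_cons (s : M →ₗ[R] M) (m : (n : ℕ) → MultilinearMap R (fun _ : Fin n => M) M)
    (hm : m 0 = 0) (a : M) (l : List M) :
    coderiv s m (word R (a :: l)) = ∑ j ∈ Finset.range (l.length + 1),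
      TensorAlgebra.ι R (tensorLift m (word R (a :: l.take j))) * word R (l.drop j) +
        TensorAlgebra.ι R (s a) * coderiv s m (word R l) := by
  have h0 : tensorLift m (1 : TensorAlgebra R M) = 0 := tensorLift_one m hm
  rw [coderiv_word, List.length_cons, Finset.sum_range_succ', coderiv_word, add_comm]
  congr 1
  · rw [Nat.sub_zero, Finset.sum_range_succ']
    simp [h0]
  · rw [Finset.mul_sum]
    refine Finset.sum_congr rfl fun i _ => ?_
    rw [Nat.add_sub_add_right, Finset.mul_sum]
    refine Finset.sum_congr rfl fun j _ => ?_
    simp [mul_assoc]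

variable {A : AInfAlgebra 𝓜} {A' : AInfAlgebra 𝓜'} (F : AInfHom A A') (hM' : IsConnected 𝓜')

include hM' in
theorem AInfHom.barMap_word_cons (a : M) (l : List M) :
    F.barMap (word R (a :: l)) = ∑ j ∈ Finset.range (l.length + 1),
      TensorAlgebra.ι R (F.total (word R (a :: l.take j))) * F.barMap (word R (l.drop j)) := by
  have h0 : F.total (1 : TensorAlgebra R M) = 0 := tensorLift_one F.f F.f_zero
  have h1 := congrArg (fun g => g.ofConv (word R (a :: l))) (geom_eq (F.isUnit hM'))
  rw [ofConv_add, LinearMap.add_apply, mul_apply_word, List.length_cons,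
    Finset.sum_range_succ'] at h1
  have h2 : (1 : WithConv (TensorAlgebra R M →ₗ[R] TensorAlgebra R M')) (word R (a :: l)) = 0 := by
    rw [LinearMap.convOne_apply, word_cons, counit_ι_mul, map_zero]
  rw [h2, zero_add] at h1
  refine h1.trans ?_
  simp [h0]
  rfl

include hM' in
theorem AInfHom.barMap_one : F.barMap 1 = 1 := by
  have h0 : F.total (1 : TensorAlgebra R M) = 0 := tensorLift_one F.f F.f_zero
  change (geom F.total).ofConv 1 = 1
  have := congrArg (fun g => g.ofConv (1 : TensorAlgebra R M)) (geom_eq (F.isUnit hM'))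
  simpa [comul_tensorAlgebra, h0] using this

theorem AInfAlgebra.barDiff_one (A : AInfAlgebra 𝓜) : A.barDiff 1 = 0 := by
  have := A.barDiff_tprod (n := 0) Fin.elim0
  simpa using this

theorem ι_mul_word_mem_lenLE (x : M) (l : List M) :
    TensorAlgebra.ι R x * word R l ∈ lenLE (l.length + 1 : ℤ) :=
  ι_mul_mem_lenLE x (word_mem_lenLE l)

/-- The linear part of the differential of the bar construction. -/
noncomputable def AInfAlgebra.linBar (A : AInfAlgebra 𝓜) :
    TensorAlgebra R M →ₗ[R] TensorAlgebra R M := linDiff A.m₁ (suspSign 𝓜)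

/-- The unary operation preserves length and makes up the linear part; every operation with at least
two arguments shortens the word. -/
theorem AInfAlgebra.barDiff_word_sub_mem (A : AInfAlgebra 𝓜) (l : List M) :
    (A.barDiff - A.linBar) (word R l) ∈ lenLE (l.length + -1 : ℤ) := by
  induction l with
  | nil =>
    rw [LinearMap.sub_apply, word_nil, A.barDiff_one, linBar, linDiff_one, sub_zero]
    exact zero_mem _
  | cons a l ih =>
    have h1 : tensorLift A.m (TensorAlgebra.ι R a) = A.m₁ a := A.total_ι a
    have h2 : (A.barDiff - A.linBar) (word R (a :: l)) = ∑ j ∈ Finset.range l.length,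
        TensorAlgebra.ι R (tensorLift A.m (word R (a :: l.take (j + 1)))) *
          word R (l.drop (j + 1)) +
        TensorAlgebra.ι R (suspSign 𝓜 a) * (A.barDiff - A.linBar) (word R l) := by
      rw [LinearMap.sub_apply, barDiff, coderiv_word_cons _ _ A.m_zero, Finset.sum_range_succ',
        linBar, word_cons R a l, linDiff_ι_mul, LinearMap.sub_apply, mul_sub]
      simp only [List.take_zero, List.drop_zero, word_cons, word_nil, mul_one, h1]
      abel
    rw [h2, List.length_cons]
    refine add_mem (Submodule.sum_mem _ fun j hj => ?_) (lenLE_mono (by push_cast; linarith)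
      (ι_mul_mem_lenLE _ ih))
    refine lenLE_mono ?_ (ι_mul_word_mem_lenLE _ _)
    rw [List.length_drop]
    have := Finset.mem_range.1 hj
    push_cast
    omega

theorem AInfAlgebra.barDiff_sub_mem (A : AInfAlgebra 𝓜) {n : ℤ} {x : TensorAlgebra R M}
    (hx : x ∈ lenLE n) : A.barDiff x - A.linBar x ∈ lenLE (n - 1) :=
  map_mem_lenLE (L := A.barDiff - A.linBar) A.barDiff_word_sub_mem hx

include hM' in
-- Only the composition into blocks of length one preserves the number of letters. Strong induction
-- is needed, as the tail after a longer first block must itself be bounded.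
theorem AInfHom.barMap_word_sub_mem (l : List M) :
    F.barMap (word R l) - letterwise F.f₁ (word R l) ∈ lenLE (l.length + -1 : ℤ) := by
  suffices h : ∀ (n : ℕ) (l : List M), l.length ≤ n →
      F.barMap (word R l) - letterwise F.f₁ (word R l) ∈ lenLE (l.length + -1 : ℤ) from h _ l le_rfl
  intro n
  induction n with
  | zero =>
    intro l hl
    rw [List.length_eq_zero_iff.1 (Nat.le_zero.1 hl), word_nil, F.barMap_one hM', map_one, sub_self]
    exact zero_mem _
  | succ n ih =>
    intro l hl
    cases l with
    | nil =>
      rw [word_nil, F.barMap_one hM', map_one, sub_self]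
      exact zero_mem _
    | cons a l =>
      rw [List.length_cons] at hl
      have h2 : F.barMap (word R (a :: l)) - letterwise F.f₁ (word R (a :: l)) =
          ∑ j ∈ Finset.range l.length,
            TensorAlgebra.ι R (F.total (word R (a :: l.take (j + 1)))) *
              F.barMap (word R (l.drop (j + 1))) +
          TensorAlgebra.ι R (F.f₁ a) * (F.barMap (word R l) - letterwise F.f₁ (word R l)) := by
        rw [F.barMap_word_cons hM', Finset.sum_range_succ', word_cons R a l, map_mul, letterwise_ι,
          mul_sub]
        simp only [List.take_zero, List.drop_zero, word_cons, word_nil, mul_one, F.total_ι]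
        abel
      have hmem : ∀ l' : List M, l'.length ≤ n → F.barMap (word R l') ∈ lenLE (l'.length : ℤ) := by
        intro l' hl'
        rw [← sub_add_cancel (F.barMap (word R l')) (letterwise F.f₁ (word R l'))]
        refine add_mem (lenLE_mono (by linarith) (ih l' hl')) ?_
        rw [letterwise_word]
        simpa using word_mem_lenLE (R := R) (l'.map F.f₁)
      rw [h2, List.length_cons]
      refine add_mem (Submodule.sum_mem _ fun j hj => ?_) (lenLE_mono (by push_cast; linarith)
        (ι_mul_mem_lenLE _ (ih l (by omega))))
      have hj' := Finset.mem_range.1 hj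
      have hle : (l.drop (j + 1)).length ≤ n := by rw [List.length_drop]; omega
      refine lenLE_mono ?_ (ι_mul_mem_lenLE _ (hmem _ hle))
      rw [List.length_drop]
      push_cast
      omega

include hM' in
theorem AInfHom.barMap_sub_mem {n : ℤ} {x : TensorAlgebra R M} (hx : x ∈ lenLE n) :
    F.barMap x - letterwise F.f₁ x ∈ lenLE (n - 1) :=
  map_mem_lenLE (L := F.barMap - (letterwise F.f₁).toLinearMap) (F.barMap_word_sub_mem hM') hx

theorem counit_word (l : List M) : counit (R := R) (word R l) = if l = [] then 1 else 0 := by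
  cases l <;> simp

/-- A single letter arises only if the operation consumes the whole word. -/
theorem AInfAlgebra.letter_comp_barDiff (A : AInfAlgebra 𝓜) : letter ∘ₗ A.barDiff = A.total := by
  refine linearMap_ext_word fun l => ?_
  cases l with
  | nil =>
    have h : A.total 1 = 0 := tensorLift_one A.m A.m_zero
    rw [LinearMap.comp_apply, word_nil, A.barDiff_one, map_zero, h]
  | cons a l =>
    have h : counit (R := R) (coderiv (suspSign 𝓜) A.m (word R l)) = 0 :=
      LinearMap.congr_fun A.isDGCoalgebra.counit_d _
    rw [LinearMap.comp_apply, barDiff, coderiv_word_cons _ _ A.m_zero, map_add, letter_ι_mul, h,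
      zero_smul, add_zero, map_sum, Finset.sum_range_succ, Finset.sum_eq_zero, zero_add]
    · simp [total]
    · intro j hj
      have hj' := Finset.mem_range.1 hj
      rw [letter_ι_mul, counit_word, if_neg, zero_smul]
      intro h
      have := congrArg List.length h
      simp at this
      omega

/-- Apply the Leibniz rule twice to the fixed point equation of the identity. The mixed terms cancel
and `A.total` after `barDiff` vanishes, so the square commutes with putting a letter in front; it
kills 1, hence every word. -/
theorem AInfAlgebra.barDiff_barDiff (A : AInfAlgebra 𝓜) (x : TensorAlgebra R M) :
    A.barDiff (A.barDiff x) = 0 := by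
  have h𝒞 := A.isDGCoalgebra
  set i : WithConv (TensorAlgebra R M →ₗ[R] TensorAlgebra R M) := toConv LinearMap.id with hi
  set σ := (letterwise (suspSign 𝓜)).toLinearMap with hσ
  have h1 : precomp A.barDiff i = letterMap A.total * i +
      precomp σ (letterMap letter) * precomp A.barDiff i := by
    conv_lhs => rw [hi, toConv_id_eq, map_add, h𝒞.precomp_d_one, zero_add, h𝒞.precomp_d_mul, ← hi]
    rw [← A.letter_comp_barDiff]
    rfl
  have h2 : precomp A.barDiff (letterMap A.total) = 0 := by
    have : letterMap (A.total ∘ₗ A.barDiff) = 0 := by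
      rw [A.total_comp_barDiff]
      exact WithConv.ext (LinearMap.ext fun x => by simp)
    exact this
  have h3 : precomp A.barDiff (letterMap letter) = letterMap A.total := by
    rw [← A.letter_comp_barDiff]
    rfl
  have h4 : precomp A.barDiff (precomp A.barDiff i) =
      letterMap letter * precomp A.barDiff (precomp A.barDiff i) := by
    conv_lhs => rw [h1, map_add, h𝒞.precomp_d_mul, h𝒞.precomp_d_mul, h2,
      h𝒞.precomp_d_precomp_invol, h3, h𝒞.precomp_invol_precomp_invol]
    rw [neg_convMul]
    simp
  suffices h : A.barDiff ∘ₗ A.barDiff = 0 from LinearMap.congr_fun h x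
  refine word_induction ?_ fun a w hw => ?_
  · rw [LinearMap.comp_apply, A.barDiff_one, map_zero, LinearMap.zero_apply]
  · have h5 := congrArg (fun g => g.ofConv (TensorAlgebra.ι R a * w)) h4
    have h6 := letterMap_letter_mul_apply (AlgHom.id R (TensorAlgebra R M))
      (precomp A.barDiff (precomp A.barDiff i)) a w
    simp only [convMap, AlgHom.toLinearMap_id, LinearMap.id_comp] at h6
    have h7 : (precomp A.barDiff (precomp A.barDiff i)) w = A.barDiff (A.barDiff w) := rfl
    rw [LinearMap.comp_apply, LinearMap.zero_apply] at hw
    rw [h7, hw, mul_zero] at h6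
    exact h5.trans h6

include hM' in
-- This is the commutator formula for the component `F.total` on the tensor coalgebra, whose defect
-- vanishes by the morphism equations.
theorem AInfHom.barMap_barDiff (x : TensorAlgebra R M) :
    F.barMap (A.barDiff x) = A'.barDiff (F.barMap x) := by
  have h1 := postcomp_barDiff_sub_precomp_d A.isDGCoalgebra hM' A' F.hasDeg_total
  have h2 : A'.total ∘ₗ (geom F.total).ofConv - F.total ∘ₗ A.barDiff = 0 :=
    sub_eq_zero.2 (F.total_comp_barDiff hM').symm
  have h3 : letterMap (0 : TensorAlgebra R M →ₗ[R] M') = 0 :=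
    WithConv.ext (LinearMap.ext fun x => by simp)
  rw [h2, h3, mul_zero, zero_mul, sub_eq_zero] at h1
  exact (congrArg (fun g => g.ofConv x) h1).symm

end LeadingTerm

/-! ### Comparison with the bar construction as a direct sum of tensor powers -/

section BarConstruction

variable {R M M' : Type*} [CommRing R] [AddCommGroup M] [Module R M] [AddCommGroup M']
  [Module R M'] {𝓜 : ℤ → Submodule R M} [DirectSum.Decomposition 𝓜]
  {𝓜' : ℤ → Submodule R M'} [DirectSum.Decomposition 𝓜']
  {A : AInfAlgebra 𝓜} {A' : AInfAlgebra 𝓜'} (F : AInfHom A A') (hM' : IsConnected 𝓜')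

theorem toDirectSum_tprod {n : ℕ} (a : Fin n → M) :
    TensorAlgebra.toDirectSum (TensorAlgebra.tprod R M n a) =
      DirectSum.lof R ℕ (fun n => ⨂[R]^n M) n (PiTensorProduct.tprod R a) :=
  TensorAlgebra.toDirectSum_tensorPower_tprod a

theorem AInfAlgebra.toDirectSum_barDiff (A : AInfAlgebra 𝓜) (x : TensorAlgebra R M) :
    TensorAlgebra.toDirectSum (A.barDiff x) = A.barD (TensorAlgebra.toDirectSum x) := by
  suffices h : TensorAlgebra.toDirectSum.toLinearMap ∘ₗ A.barDiff =
    A.barD ∘ₗ TensorAlgebra.toDirectSum.toLinearMap from LinearMap.congr_fun h x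
  refine linearMap_ext_tprod fun n a => ?_
  rw [LinearMap.comp_apply, LinearMap.comp_apply, AlgHom.toLinearMap_apply,
    AlgHom.toLinearMap_apply, A.barDiff_tprod, toDirectSum_tprod, barD, DirectSum.toModule_lof,
    PiTensorProduct.lift.tprod, sum_apply, map_sum]
  refine Finset.sum_congr rfl fun k _ => ?_
  rw [sum_apply, map_sum]
  refine Finset.sum_congr rfl fun j _ => ?_
  rw [toDirectSum_tprod]
  rfl

include hM' in
theorem AInfHom.toDirectSum_barMap (x : TensorAlgebra R M) :
    TensorAlgebra.toDirectSum (F.barMap x) = F.bar (TensorAlgebra.toDirectSum x) := by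
  suffices h : TensorAlgebra.toDirectSum.toLinearMap ∘ₗ F.barMap =
    F.bar ∘ₗ TensorAlgebra.toDirectSum.toLinearMap from LinearMap.congr_fun h x
  refine linearMap_ext_tprod fun n a => ?_
  rw [LinearMap.comp_apply, LinearMap.comp_apply, AlgHom.toLinearMap_apply,
    AlgHom.toLinearMap_apply, F.barMap_tprod hM', toDirectSum_tprod, bar, DirectSum.toModule_lof,
    PiTensorProduct.lift.tprod, sum_apply, map_sum]
  refine Finset.sum_congr rfl fun c _ => ?_
  rw [toDirectSum_tprod]
  rfl

include hM' in
theorem AInfHom.IsBarEquiv.exists_lift (h : F.IsBarEquiv) {u : TensorAlgebra R M}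
    {v : TensorAlgebra R M'} (hu : A.barDiff u = 0) (huv : F.barMap u = A'.barDiff v) :
    ∃ w y, A.barDiff w = u ∧ F.barMap w + A'.barDiff y = v := by
  obtain ⟨w, y, h1, h2⟩ := IsHomologyIso.exists_lift h (fun t => by
      rw [← TensorAlgebra.toDirectSum_ofDirectSum t, ← A.toDirectSum_barDiff,
        ← F.toDirectSum_barMap hM', ← F.toDirectSum_barMap hM', F.barMap_barDiff hM',
        A'.toDirectSum_barDiff])
    (u := TensorAlgebra.toDirectSum u) (v := TensorAlgebra.toDirectSum v)
    (by rw [← A.toDirectSum_barDiff, hu, map_zero])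
    (by rw [← A'.toDirectSum_barDiff, ← F.toDirectSum_barMap hM', huv])
  have inj : ∀ {s t : TensorAlgebra R M}, TensorAlgebra.toDirectSum s = TensorAlgebra.toDirectSum t →
      s = t := fun hst => (TensorAlgebra.equivDirectSum (R := R) (M := M)).injective hst
  have inj' : ∀ {s t : TensorAlgebra R M'},
      TensorAlgebra.toDirectSum s = TensorAlgebra.toDirectSum t → s = t :=
    fun hst => (TensorAlgebra.equivDirectSum (R := R) (M := M')).injective hst
  refine ⟨TensorAlgebra.ofDirectSum w, TensorAlgebra.ofDirectSum y, inj ?_, inj' ?_⟩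
  · rw [A.toDirectSum_barDiff, TensorAlgebra.toDirectSum_ofDirectSum, h1]
  · rw [map_add, F.toDirectSum_barMap hM', A'.toDirectSum_barDiff,
      TensorAlgebra.toDirectSum_ofDirectSum, TensorAlgebra.toDirectSum_ofDirectSum, h2]

end BarConstruction

/-! ### Filtration of tensor products by total degree -/

section Bilevel

variable {R V W W' W'' : Type*} [CommRing R] [AddCommGroup V] [Module R V] [AddCommGroup W]
  [Module R W] [AddCommGroup W'] [Module R W'] [AddCommGroup W''] [Module R W'']

/-- Elements of a tensor product without components in total degrees up to `n`. -/
def biLev (π : ℤ → V →ₗ[R] V) (ρ : ℤ → W →ₗ[R] W) (n : ℤ) : Submodule R (V ⊗[R] W) where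
  carrier := {x | ∀ p q, p + q ≤ n → TensorProduct.map (π p) (ρ q) x = 0}
  add_mem' hx hy p q h := by rw [map_add, hx p q h, hy p q h, add_zero]
  zero_mem' _ _ _ := map_zero _
  smul_mem' r x hx p q h := by rw [map_smul, hx p q h, smul_zero]

theorem mem_biLev {π : ℤ → V →ₗ[R] V} {ρ : ℤ → W →ₗ[R] W} {n : ℤ} {x : V ⊗[R] W} :
    x ∈ biLev π ρ n ↔ ∀ p q, p + q ≤ n → TensorProduct.map (π p) (ρ q) x = 0 := Iff.rfl

theorem comm_mem_biLev {π : ℤ → V →ₗ[R] V} {ρ : ℤ → W →ₗ[R] W} {n : ℤ} {x : V ⊗[R] W} :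
    TensorProduct.comm R V W x ∈ biLev ρ π n ↔ x ∈ biLev π ρ n := by
  simp only [mem_biLev, TensorProduct.map_comm, EmbeddingLike.map_eq_zero_iff]
  exact ⟨fun h p q hpq => h q p (by linarith), fun h p q hpq => h q p (by linarith)⟩

theorem map_mem_biLev {π : ℤ → V →ₗ[R] V} {ρ : ℤ → W →ₗ[R] W} {V' : Type*} [AddCommGroup V']
    [Module R V'] {π' : ℤ → V' →ₗ[R] V'} {ρ' : ℤ → W' →ₗ[R] W'} {f : V →ₗ[R] V'} {g : W →ₗ[R] W'}
    (hf : ∀ p, π' p ∘ₗ f = f ∘ₗ π p) (hg : ∀ q, ρ' q ∘ₗ g = g ∘ₗ ρ q) {n : ℤ} {x : V ⊗[R] W}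
    (hx : x ∈ biLev π ρ n) : TensorProduct.map f g x ∈ biLev π' ρ' n := fun p q h => by
  rw [map_map_apply, hf, hg, ← map_map_apply, hx p q h, map_zero]

theorem IsProjSystem.exists_sum_tensor {π : ℤ → V →ₗ[R] V} (hπ : IsProjSystem π)
    {ρ : ℤ → W →ₗ[R] W} (hρ : IsProjSystem ρ) (x : V ⊗[R] W) :
    ∃ S : Finset (ℤ × ℤ), x = ∑ i ∈ S, TensorProduct.map (π i.1) (ρ i.2) x := by
  have orth : ∀ i j : ℤ × ℤ, ∀ t : V ⊗[R] W, TensorProduct.map (π i.1) (ρ i.2)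
      (TensorProduct.map (π j.1) (ρ j.2) t) =
      if i = j then TensorProduct.map (π i.1) (ρ i.2) t else 0 := by
    intro i j t
    rw [map_map_apply]
    split_ifs with h
    · subst h
      rw [hπ.self, hρ.self]
    · by_cases h1 : i.1 = j.1
      · rw [hρ.ne i.2 j.2 fun h2 => h (Prod.ext h1 h2)]
        simp
      · rw [hπ.ne _ _ h1]
        simp
  suffices h : ∃ (S : Finset (ℤ × ℤ)) (y : ℤ × ℤ → V ⊗[R] W),
      x = ∑ i ∈ S, TensorProduct.map (π i.1) (ρ i.2) (y i) by
    obtain ⟨S, y, hy⟩ := h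
    refine ⟨S, ?_⟩
    conv_lhs => rw [hy]
    refine Finset.sum_congr rfl fun i hi => ?_
    conv_rhs => rw [hy, map_sum]
    simp only [orth]
    rw [Finset.sum_ite_eq, if_pos hi]
  induction x using TensorProduct.induction_on with
  | zero => exact ⟨∅, 0, by simp⟩
  | tmul v w =>
    obtain ⟨s, hs⟩ := hπ.exists_sum v
    obtain ⟨t, ht⟩ := hρ.exists_sum w
    refine ⟨s ×ˢ t, fun _ => v ⊗ₜ w, ?_⟩
    simp only [TensorProduct.map_tmul]
    rw [Finset.sum_product]
    conv_lhs => rw [hs, ht, TensorProduct.sum_tmul]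
    simp only [TensorProduct.tmul_sum]
  | add x x' hx hx' =>
    classical
    obtain ⟨S, y, hy⟩ := hx
    obtain ⟨S', y', hy'⟩ := hx'
    refine ⟨S ∪ S', fun i => (if i ∈ S then y i else 0) + if i ∈ S' then y' i else 0, ?_⟩
    simp only [map_add, Finset.sum_add_distrib, apply_ite (TensorProduct.map _ _), map_zero,
      Finset.sum_ite_mem, Finset.union_inter_cancel_left, Finset.union_inter_cancel_right]
    conv_lhs => rw [hy, hy']

/-- The quotient form in `lev` is what flatness handles; for the degree filtration, decomposing x
into bihomogeneous parts turns it into a condition on components. -/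
theorem mem_lev_iff {π : ℤ → V →ₗ[R] V} (hπ : IsProjSystem π) {ρ : ℤ → W →ₗ[R] W}
    (hρ : IsProjSystem ρ) {p n : ℤ} {x : V ⊗[R] W} :
    x ∈ lev π (fil ρ) p n ↔ ∀ q, p + q ≤ n → TensorProduct.map (π p) (ρ q) x = 0 := by
  rw [lev, LinearMap.mem_ker]
  constructor
  · intro h q hq
    have h1 : ρ q = (fil ρ (n - p)).liftQ (ρ q) (fun w hw => hw q (by linarith)) ∘ₗ
        (fil ρ (n - p)).mkQ := rfl
    have h2 := congrArg (TensorProduct.map LinearMap.id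
      ((fil ρ (n - p)).liftQ (ρ q) fun w hw => hw q (by linarith))) h
    rwa [map_map_apply, ← h1, map_zero] at h2
  · intro h
    obtain ⟨S, hS⟩ := hπ.exists_sum_tensor hρ x
    rw [hS, map_sum]
    refine Finset.sum_eq_zero fun i _ => ?_
    rw [map_map_apply]
    by_cases h1 : p = i.1
    · subst h1
      by_cases h2 : i.1 + i.2 ≤ n
      · have h3 := congrArg (TensorProduct.map (π i.1) (fil ρ (n - i.1)).mkQ) (h i.2 h2)
        rwa [map_map_apply, map_zero] at h3
      · have h3 : (fil ρ (n - i.1)).mkQ ∘ₗ ρ i.2 = 0 := LinearMap.ext fun w =>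
          (Submodule.Quotient.mk_eq_zero _).2 fun q hq =>
            LinearMap.congr_fun (hρ.ne q i.2 (by omega)) w
        rw [h3, TensorProduct.map_zero_right, LinearMap.zero_apply]
    · rw [hπ.ne _ _ h1, TensorProduct.map_zero_left, LinearMap.zero_apply]

/-- A solution w' for h, paired with u, is a cone cycle for g up to filtration; the two corrections
combine. For h only the instance at hand is assumed, since in the application it is available only
on the image of a projection. -/
theorem exists_comp {d : W →ₗ[R] W} {d' : W' →ₗ[R] W'} {d'' : W'' →ₗ[R] W''} {g : W →ₗ[R] W'}
    {h : W' →ₗ[R] W''} {𝓕 : ℤ → Submodule R W} {𝓕' : ℤ → Submodule R W'}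
    {𝓕'' : ℤ → Submodule R W''} {n : ℤ} (hg : ConnAt d d' g 𝓕 𝓕' n)
    (hd : ∀ x, h (d' x) = d'' (h x)) (hh : ∀ x ∈ 𝓕' n, h x ∈ 𝓕'' n) {u : W} {v : W''}
    (hu : d u ∈ 𝓕 (n - 2))
    (hv : ∃ w' y, g u - d' w' ∈ 𝓕' (n - 1) ∧ v - h w' - d'' y ∈ 𝓕'' n) :
    ∃ w y, u - d w ∈ 𝓕 (n - 1) ∧ v - h (g w) - d'' y ∈ 𝓕'' n := by
  obtain ⟨w', y, h1, h2⟩ := hv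
  obtain ⟨w, y', h3, h4⟩ := hg u w' hu h1
  refine ⟨w, y + h y', h3, ?_⟩
  have h5 := add_mem h2 (hh _ h4)
  rw [map_sub, map_sub, hd] at h5
  convert h5 using 1
  rw [map_add]
  abel

end Bilevel

/-! ### Künneth arguments for either tensor factor -/

section Mixed

variable {R V V' W W' : Type*} [CommRing R] [AddCommGroup V] [Module R V] [AddCommGroup W]
  [Module R W] [AddCommGroup V'] [Module R V'] [AddCommGroup W'] [Module R W']

/-- The differential of a tensor product of complexes. -/
noncomputable def tensorDiff (δ s : V →ₗ[R] V) (d : W →ₗ[R] W) : V ⊗[R] W →ₗ[R] V ⊗[R] W :=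
  TensorProduct.map δ LinearMap.id + TensorProduct.map s d

@[simp] theorem tensorDiff_tmul (δ s : V →ₗ[R] V) (d : W →ₗ[R] W) (v : V) (w : W) :
    tensorDiff δ s d (v ⊗ₜ w) = δ v ⊗ₜ w + s v ⊗ₜ d w := by
  simp [tensorDiff]

theorem tensorDiff_tensorDiff {δ s : V →ₗ[R] V} {d : W →ₗ[R] W} (h1 : ∀ a, δ (δ a) = 0)
    (h2 : ∀ a, δ (s a) = -s (δ a)) (h3 : ∀ w, d (d w) = 0) (x : V ⊗[R] W) :
    tensorDiff δ s d (tensorDiff δ s d x) = 0 := by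
  induction x using TensorProduct.induction_on with
  | zero => simp
  | tmul v w => simp [h1, h2, h3, TensorProduct.neg_tmul]
  | add x y hx hy => rw [map_add, map_add, hx, hy, add_zero]

theorem map_tensorDiff {δ s : V →ₗ[R] V} {d : W →ₗ[R] W} {δ' s' : V' →ₗ[R] V'} {d' : W' →ₗ[R] W'}
    {f : V →ₗ[R] V'} {g : W →ₗ[R] W'} (h1 : ∀ a, f (δ a) = δ' (f a))
    (h2 : ∀ a, f (s a) = s' (f a)) (h3 : ∀ w, g (d w) = d' (g w)) (x : V ⊗[R] W) :
    TensorProduct.map f g (tensorDiff δ s d x) = tensorDiff δ' s' d' (TensorProduct.map f g x) := by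
  induction x using TensorProduct.induction_on with
  | zero => simp
  | tmul v w => simp [h1, h2, h3]
  | add x y hx hy => simp only [map_add, hx, hy]

theorem map_id_tensorDiff {δ s : V →ₗ[R] V} {d : W →ₗ[R] W} {d' : W' →ₗ[R] W'} {g : W →ₗ[R] W'}
    (h : ∀ w, g (d w) = d' (g w)) (x : V ⊗[R] W) :
    TensorProduct.map LinearMap.id g (tensorDiff δ s d x) =
      tensorDiff δ s d' (TensorProduct.map LinearMap.id g x) :=
  map_tensorDiff (δ' := δ) (s' := s) (f := LinearMap.id) (fun _ => rfl) (fun _ => rfl) h x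

variable {π : ℤ → V →ₗ[R] V} (hπ : IsProjSystem π) {ρ : ℤ → W →ₗ[R] W} (hρ : IsProjSystem ρ)
  {ρ' : ℤ → W' →ₗ[R] W'} (hρ' : IsProjSystem ρ')
  {δ s : V →ₗ[R] V} (hδδ : ∀ a, δ (δ a) = 0) (hδs : ∀ a, δ (s a) = -s (δ a))
  (hδ : ∀ p, π p ∘ₗ δ = δ ∘ₗ π (p + 1)) {e : ℤ → R} (he : ∀ p, e p * e p = 1)
  (hs : ∀ p, π p ∘ₗ s = e p • π p)

include hπ hρ hρ' hδδ hδs hδ he hs in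
/-- Tensoring with a flat complex on the left. -/
theorem connAt_lTensor [Module.Flat R V] {d : W →ₗ[R] W} {d' : W' →ₗ[R] W'} {g : W →ₗ[R] W'}
    (hdd : ∀ w, d (d w) = 0) (hdd' : ∀ w, d' (d' w) = 0) (hg : ∀ w, g (d w) = d' (g w)) {n P : ℤ}
    (hP : ∀ p < P, π p = 0)
    (hrow : ∀ p ≥ P, ConnAt d d' g (fil ρ) (fil ρ') (n - p)) :
    ConnAt (tensorDiff δ s d) (tensorDiff δ s d') (TensorProduct.map LinearMap.id g)
      (biLev π ρ) (biLev π ρ') n := by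
  intro x z hx hz
  obtain ⟨w, y, h⟩ := exists_of_rows (𝓕 := fil ρ) (𝓕' := fil ρ') (α := LinearMap.id)
    (α' := LinearMap.id) (D := tensorDiff δ s d) (D' := tensorDiff δ s d') hπ hδ he hs
    (fun _ => le_rfl) (fun _ => le_rfl) rfl rfl
    (LinearMap.ext (tensorDiff_tensorDiff hδδ hδs hdd))
    (LinearMap.ext (tensorDiff_tensorDiff hδδ hδs hdd'))
    (LinearMap.ext (map_tensorDiff (f := LinearMap.id) (fun _ => rfl) (fun _ => rfl) hg)) hrow
    (fun p _ => (mem_lev_iff hπ hρ).2 fun q hq => hx p q hq)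
    (fun p _ => (mem_lev_iff hπ hρ').2 fun q hq => hz p q hq)
  refine ⟨w, y, fun p q hpq => ?_, fun p q hpq => ?_⟩
  · by_cases hp : p ≥ P
    · exact (mem_lev_iff hπ hρ).1 (h p hp).1 q hpq
    · rw [hP p (not_le.1 hp), TensorProduct.map_zero_left, LinearMap.zero_apply]
  · by_cases hp : p ≥ P
    · exact (mem_lev_iff hπ hρ').1 (h p hp).2 q hpq
    · rw [hP p (not_le.1 hp), TensorProduct.map_zero_left, LinearMap.zero_apply]

theorem fil_le_comap {σ : ℤ → V →ₗ[R] V} {r : V →ₗ[R] V} (h : ∀ p, σ p ∘ₗ r = r ∘ₗ σ p) (n : ℤ) :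
    fil σ n ≤ (fil σ n).comap r := fun x hx q hq => by
  have h1 := LinearMap.congr_fun (h q) x
  rw [LinearMap.comp_apply, LinearMap.comp_apply, hx q hq, map_zero] at h1
  exact h1

/-- Tensoring with a flat complex on the right. -/
theorem exists_rTensor {W : Type*} [AddCommGroup W] [Module R W] [Module.Flat R W]
    {ρ : ℤ → W →ₗ[R] W} (hρ : IsProjSystem ρ) {d : W →ₗ[R] W} (hdd : ∀ w, d (d w) = 0)
    (hd : ∀ p, ρ p ∘ₗ d = d ∘ₗ ρ (p + 1)) {π : ℤ → V →ₗ[R] V} (hπ : IsProjSystem π)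
    {π' : ℤ → V' →ₗ[R] V'} (hπ' : IsProjSystem π') {δ s : V →ₗ[R] V} {δ' s' : V' →ₗ[R] V'}
    {f : V →ₗ[R] V'} (hδδ : ∀ a, δ (δ a) = 0) (hδs : ∀ a, δ (s a) = -s (δ a))
    (hδδ' : ∀ a, δ' (δ' a) = 0) (hδs' : ∀ a, δ' (s' a) = -s' (δ' a))
    (h1 : ∀ a, f (δ a) = δ' (f a)) (h2 : ∀ a, f (s a) = s' (f a))
    (hs : ∀ p, π p ∘ₗ s = s ∘ₗ π p) (hs' : ∀ p, π' p ∘ₗ s' = s' ∘ₗ π' p) {n Q : ℤ}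
    (hrow : ∀ q ≥ Q, ConnAt δ δ' f (fil π) (fil π') (n - q)) {x : V ⊗[R] W} {z : V' ⊗[R] W}
    (hx : tensorDiff δ s d x ∈ biLev π ρ (n - 2))
    (hz : TensorProduct.map f LinearMap.id x - tensorDiff δ' s' d z ∈ biLev π' ρ (n - 1)) :
    ∃ w y, ∀ q ≥ Q, ∀ p,
      (p + q ≤ n - 1 → TensorProduct.map (π p) (ρ q) (x - tensorDiff δ s d w) = 0) ∧
      (p + q ≤ n → TensorProduct.map (π' p) (ρ q)
        (z - TensorProduct.map f LinearMap.id w - tensorDiff δ' s' d y) = 0) := by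
  let c := TensorProduct.comm R V W
  let c' := TensorProduct.comm R V' W
  -- After the swap the rows are indexed by W. The sign s accompanies d, so it plays the role of α,
  -- while ε is the identity and all signs e are 1.
  let D : W ⊗[R] V →ₗ[R] W ⊗[R] V := TensorProduct.map d s + TensorProduct.map LinearMap.id δ
  let D' : W ⊗[R] V' →ₗ[R] W ⊗[R] V' := TensorProduct.map d s' + TensorProduct.map LinearMap.id δ'
  have hD : ∀ t, D (c t) = c (tensorDiff δ s d t) := fun t => by
    simp only [D, c, tensorDiff, LinearMap.add_apply, TensorProduct.map_comm, map_add]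
    rw [add_comm]
  have hD' : ∀ t, D' (c' t) = c' (tensorDiff δ' s' d t) := fun t => by
    simp only [D', c', tensorDiff, LinearMap.add_apply, TensorProduct.map_comm, map_add]
    rw [add_comm]
  have hc : ∀ t, f.lTensor W (c t) = c' (TensorProduct.map f LinearMap.id t) := fun t => by
    simp only [c, c', LinearMap.lTensor, TensorProduct.map_comm]
  have hsurj : ∀ t, ∃ t', c t' = t := c.surjective
  have hsurj' : ∀ t, ∃ t', c' t' = t := c'.surjective
  obtain ⟨w, y, h⟩ := exists_of_rows (𝓕 := fil π) (𝓕' := fil π') (α := s) (α' := s')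
    (D := D) (D' := D') (e := fun _ => 1) (ε := LinearMap.id) hρ hd (fun _ => one_mul 1)
    (fun p => by rw [one_smul, LinearMap.comp_id]) (fil_le_comap hs)
    (fil_le_comap hs') rfl rfl
    (LinearMap.ext fun t => by
      obtain ⟨t, rfl⟩ := hsurj t
      rw [LinearMap.comp_apply, hD, hD, tensorDiff_tensorDiff hδδ hδs hdd, map_zero]
      rfl)
    (LinearMap.ext fun t => by
      obtain ⟨t, rfl⟩ := hsurj' t
      rw [LinearMap.comp_apply, hD', hD', tensorDiff_tensorDiff hδδ' hδs' hdd, map_zero]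
      rfl)
    (LinearMap.ext fun t => by
      obtain ⟨t, rfl⟩ := hsurj t
      rw [LinearMap.comp_apply, LinearMap.comp_apply, hD, hc, hc, hD',
        map_tensorDiff (g := LinearMap.id) (d := d) (d' := d) h1 h2 fun _ => rfl]) hrow (x := c x) (z := c' z)
    (fun q _ => (mem_lev_iff hρ hπ).2 fun p hp => by
      rw [hD]
      exact comm_mem_biLev.2 hx q p hp)
    (fun q _ => (mem_lev_iff hρ hπ').2 fun p hp => by
      rw [hD', hc, ← map_sub]
      exact comm_mem_biLev.2 hz q p hp)
  obtain ⟨w, rfl⟩ := hsurj w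
  obtain ⟨y, rfl⟩ := hsurj' y
  refine ⟨w, y, fun q hq p => ⟨fun hpq => ?_, fun hpq => ?_⟩⟩
  · have h3 := (mem_lev_iff hρ hπ).1 (h q hq).1 p (by linarith)
    rw [hD, ← map_sub] at h3
    simp only [c, TensorProduct.map_comm, EmbeddingLike.map_eq_zero_iff] at h3
    exact h3
  · have h3 := (mem_lev_iff hρ hπ').1 (h q hq).2 p (by linarith)
    rw [hD', hc, ← map_sub, ← map_sub] at h3
    simp only [c', TensorProduct.map_comm, EmbeddingLike.map_eq_zero_iff] at h3
    exact h3

theorem map_map_proj_eq_zero {r : W →ₗ[R] W} {ρ : ℤ → W →ₗ[R] W} {Q : ℤ}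
    (hrρ : ∀ q, ρ q ∘ₗ r = r ∘ₗ ρ q) (hrQ : ∀ q < Q, ρ q ∘ₗ r = 0) {σ : V →ₗ[R] V} {q : ℤ}
    {t : V ⊗[R] W} (ht : q ≥ Q → TensorProduct.map σ (ρ q) t = 0) :
    TensorProduct.map σ (ρ q) (TensorProduct.map LinearMap.id r t) = 0 := by
  by_cases hq : q ≥ Q
  · have h3 := congrArg (TensorProduct.map LinearMap.id r) (ht hq)
    rw [map_map_apply, map_zero, ← hrρ] at h3
    rw [map_map_apply]
    exact h3
  · rw [map_map_apply, hrQ q (not_le.1 hq), TensorProduct.map_zero_right, LinearMap.zero_apply]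

/-- Tensoring with the image of a projection of a flat complex on the right. -/
theorem exists_rTensor_of_proj {W : Type*} [AddCommGroup W] [Module R W] [Module.Flat R W]
    {ρ : ℤ → W →ₗ[R] W} (hρ : IsProjSystem ρ) {d : W →ₗ[R] W} (hdd : ∀ w, d (d w) = 0)
    (hd : ∀ p, ρ p ∘ₗ d = d ∘ₗ ρ (p + 1)) {π : ℤ → V →ₗ[R] V} (hπ : IsProjSystem π)
    {π' : ℤ → V' →ₗ[R] V'} (hπ' : IsProjSystem π') {δ s : V →ₗ[R] V} {δ' s' : V' →ₗ[R] V'}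
    {f : V →ₗ[R] V'} (hδδ : ∀ a, δ (δ a) = 0) (hδs : ∀ a, δ (s a) = -s (δ a))
    (hδδ' : ∀ a, δ' (δ' a) = 0) (hδs' : ∀ a, δ' (s' a) = -s' (δ' a))
    (h1 : ∀ a, f (δ a) = δ' (f a)) (h2 : ∀ a, f (s a) = s' (f a))
    (hs : ∀ p, π p ∘ₗ s = s ∘ₗ π p) (hs' : ∀ p, π' p ∘ₗ s' = s' ∘ₗ π' p) {n Q : ℤ}
    (hrow : ∀ q ≥ Q, ConnAt δ δ' f (fil π) (fil π') (n - q)) {r : W →ₗ[R] W}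
    (hrd : ∀ w, r (d w) = d (r w)) (hrρ : ∀ q, ρ q ∘ₗ r = r ∘ₗ ρ q) (hrQ : ∀ q < Q, ρ q ∘ₗ r = 0)
    {x : V ⊗[R] W} {z : V' ⊗[R] W} (hrx : TensorProduct.map LinearMap.id r x = x)
    (hrz : TensorProduct.map LinearMap.id r z = z)
    (hx : tensorDiff δ s d x ∈ biLev π ρ (n - 2))
    (hz : TensorProduct.map f LinearMap.id x - tensorDiff δ' s' d z ∈ biLev π' ρ (n - 1)) :
    ∃ w y, x - tensorDiff δ s d w ∈ biLev π ρ (n - 1) ∧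
      z - TensorProduct.map f LinearMap.id w - tensorDiff δ' s' d y ∈ biLev π' ρ n := by
  obtain ⟨w, y, h⟩ := exists_rTensor hρ hdd hd hπ hπ' hδδ hδs hδδ' hδs' h1 h2 hs hs' hrow hx hz
  -- The projection r commutes with all maps and fixes x and z, so it may be applied to the
  -- corrections. It leaves nothing in the rows below Q, where no acyclicity is assumed.
  have hw : x - tensorDiff δ s d (TensorProduct.map LinearMap.id r w) =
      TensorProduct.map LinearMap.id r (x - tensorDiff δ s d w) := by
    rw [map_sub, hrx, map_id_tensorDiff hrd]
  have hy : z - TensorProduct.map f LinearMap.id (TensorProduct.map LinearMap.id r w) -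
      tensorDiff δ' s' d (TensorProduct.map LinearMap.id r y) =
      TensorProduct.map LinearMap.id r (z - TensorProduct.map f LinearMap.id w -
        tensorDiff δ' s' d y) := by
    rw [map_sub, map_sub, hrz, map_id_tensorDiff hrd, map_map_apply, map_map_apply]
    rfl
  refine ⟨TensorProduct.map LinearMap.id r w, TensorProduct.map LinearMap.id r y, ?_, ?_⟩
  · rw [hw]
    exact fun p q hpq => map_map_proj_eq_zero hrρ hrQ fun hq => (h q hq p).1 hpq
  · rw [hy]
    exact fun p q hpq => map_map_proj_eq_zero hrρ hrQ fun hq => (h q hq p).2 hpq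

end Mixed

/-! ### Splitting off the first letter -/

section Peel

variable {R M M' : Type*} [CommRing R] [AddCommGroup M] [Module R M] [AddCommGroup M'] [Module R M']

/-- Splitting off the first letter of a word. -/
noncomputable def peel : TensorAlgebra R M →ₗ[R] M ⊗[R] TensorAlgebra R M :=
  TensorProduct.map letter LinearMap.id ∘ₗ deconcat

/-- Multiplication by a letter. -/
noncomputable def unpeel : M ⊗[R] TensorAlgebra R M →ₗ[R] TensorAlgebra R M :=
  LinearMap.mul' R _ ∘ₗ TensorProduct.map (TensorAlgebra.ι R) LinearMap.id

@[simp] theorem unpeel_tmul (a : M) (t : TensorAlgebra R M) :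
    unpeel (a ⊗ₜ t) = TensorAlgebra.ι R a * t := by simp [unpeel]

@[simp] theorem peel_one : peel (1 : TensorAlgebra R M) = 0 := by simp [peel]

@[simp] theorem peel_ι_mul (a : M) (t : TensorAlgebra R M) :
    peel (TensorAlgebra.ι R a * t) = a ⊗ₜ t := by
  have h1 : TensorProduct.map letter LinearMap.id ∘ₗ
      LinearMap.mulLeft R (TensorAlgebra.ι R a ⊗ₜ[R] (1 : TensorAlgebra R M)) =
      TensorProduct.map (LinearMap.toSpanSingleton R M a) LinearMap.id ∘ₗ
        (counit (R := R) (A := TensorAlgebra R M)).rTensor (TensorAlgebra R M) := by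
    refine TensorProduct.ext' fun x y => ?_
    simp [letter_ι_mul]
  have h2 := LinearMap.congr_fun h1 (deconcat t)
  have h3 : (counit (R := R) (A := TensorAlgebra R M)).rTensor _ (deconcat t) = 1 ⊗ₜ t :=
    Coalgebra.rTensor_counit_comul t
  rw [LinearMap.comp_apply, LinearMap.comp_apply, h3, LinearMap.mulLeft_apply] at h2
  rw [peel, LinearMap.comp_apply, deconcat_ι_mul, map_add, h2]
  simp

/-- The tensor algebra T is R ⊕ (M ⊗ T); peeling loses exactly the constant term. -/
theorem unpeel_peel (t : TensorAlgebra R M) :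
    unpeel (peel t) = t - counit (R := R) t • 1 := by
  suffices h : unpeel ∘ₗ peel = LinearMap.id -
    (LinearMap.toSpanSingleton R _ (1 : TensorAlgebra R M)) ∘ₗ counit from LinearMap.congr_fun h t
  refine word_induction (by simp) fun a w _ => ?_
  simp

/-- Under this splitting the linear differential is that of a tensor product of complexes. This
makes Künneth arguments by induction possible. -/
theorem peel_linDiff (δ s : M →ₗ[R] M) (t : TensorAlgebra R M) :
    peel (linDiff δ s t) = tensorDiff δ s (linDiff δ s) (peel t) := by
  suffices h : peel ∘ₗ linDiff δ s = tensorDiff δ s (linDiff δ s) ∘ₗ peel from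
    LinearMap.congr_fun h t
  refine word_induction (by simp) fun a w _ => ?_
  simp [linDiff_ι_mul]

theorem unpeel_tensorDiff (δ s : M →ₗ[R] M) (x : M ⊗[R] TensorAlgebra R M) :
    unpeel (tensorDiff δ s (linDiff δ s) x) = linDiff δ s (unpeel x) := by
  induction x using TensorProduct.induction_on with
  | zero => simp
  | tmul a t => simp [linDiff_ι_mul]
  | add x y hx hy => simp only [map_add, hx, hy]

theorem peel_letterwise (f : M →ₗ[R] M') (t : TensorAlgebra R M) :
    peel (letterwise f t) = TensorProduct.map f (letterwise f).toLinearMap (peel t) := by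
  suffices h : peel ∘ₗ (letterwise f).toLinearMap =
    TensorProduct.map f (letterwise f).toLinearMap ∘ₗ peel from LinearMap.congr_fun h t
  refine word_induction (by simp) fun a w _ => ?_
  simp

theorem unpeel_map (f : M →ₗ[R] M') (x : M ⊗[R] TensorAlgebra R M) :
    unpeel (TensorProduct.map f (letterwise f).toLinearMap x) = letterwise f (unpeel x) := by
  induction x using TensorProduct.induction_on with
  | zero => simp
  | tmul a t => simp
  | add x y hx hy => simp only [map_add, hx, hy]

theorem peel_lenProj (n : ℤ) (t : TensorAlgebra R M) :
    peel (lenProj (n + 1) t) = TensorProduct.map LinearMap.id (lenProj n) (peel t) := by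
  suffices h : peel ∘ₗ lenProj (n + 1) = TensorProduct.map LinearMap.id (lenProj n) ∘ₗ peel from
    LinearMap.congr_fun h t
  refine word_induction ?_ fun a w _ => ?_
  · have := lenProj_word (R := R) ([] : List M) (n + 1)
    rw [word_nil] at this
    rw [LinearMap.comp_apply, LinearMap.comp_apply, this, peel_one, map_zero]
    split_ifs <;> simp
  · simp [lenProj_ι_mul]

end Peel

/-! ### Degrees in the suspension and in the bar construction -/

section SuspensionGrading

variable {R M M' : Type*} [CommRing R] [AddCommGroup M] [Module R M] [AddCommGroup M'] [Module R M']
  (𝓜 : ℤ → Submodule R M) [DirectSum.Decomposition 𝓜]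
  {𝓜' : ℤ → Submodule R M'} [DirectSum.Decomposition 𝓜']

/-- The projections to the homogeneous components of the suspension. -/
noncomputable def suspProj (n : ℤ) : M →ₗ[R] M := gradeProj 𝓜 (n - 1)

/-- The projections to the homogeneous components of the bar construction. -/
noncomputable def wordProj (n : ℤ) : TensorAlgebra R M →ₗ[R] TensorAlgebra R M :=
  gradeProj (wordGrading 𝓜) n

theorem isProjSystem_suspProj : IsProjSystem (suspProj 𝓜) := (isProjSystem_gradeProj 𝓜).shift 1

theorem isProjSystem_wordProj : IsProjSystem (wordProj 𝓜) := isProjSystem_gradeProj _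

variable {𝓜}

theorem suspProj_eq_zero (hM : IsConnected 𝓜) {n : ℤ} (hn : n < 2) : suspProj 𝓜 n = 0 :=
  LinearMap.ext fun x => by
    have h := gradeProj_mem (𝓛 := 𝓜) (n := n - 1) x
    rwa [hM (n - 1) (by linarith), Submodule.mem_bot] at h

theorem hasDeg_suspSign : HasDeg 𝓜 𝓜 0 (suspSign 𝓜) := fun n x hx => by
  rw [suspSign, LinearMap.neg_apply, gradeInvol_of_mem 𝓜 hx, add_zero]
  exact neg_mem (zsmul_mem hx _)

theorem suspSign_of_mem {n : ℤ} {x : M} (hx : x ∈ 𝓜 n) :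
    suspSign 𝓜 x = (((n + 1).negOnePow : ℤˣ) : ℤ) • x := by
  rw [suspSign, LinearMap.neg_apply, gradeInvol_of_mem 𝓜 hx, Int.negOnePow_succ]
  simp

theorem apply_suspSign_of_hasDeg {g : M →ₗ[R] M'} {k : ℤ} (hg : HasDeg 𝓜 𝓜' k g) (x : M) :
    g (suspSign 𝓜 x) = ((k.negOnePow : ℤˣ) : ℤ) • suspSign 𝓜' (g x) := by
  suffices h : g ∘ₗ suspSign 𝓜 = ((k.negOnePow : ℤˣ) : ℤ) • (suspSign 𝓜' ∘ₗ g) from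
    LinearMap.congr_fun h x
  refine linearMap_ext_of_iSup_eq_top (iSup_eq_top_of_decomposition 𝓜) fun n x hx => ?_
  rw [LinearMap.comp_apply, suspSign_of_mem hx, map_zsmul, LinearMap.smul_apply,
    LinearMap.comp_apply, suspSign_of_mem (hg n x hx), smul_smul, ← Units.val_mul,
    ← Int.negOnePow_add, show k + (n + k + 1) = (n + 1) + (k + k) by ring,
    Int.negOnePow_add _ (k + k), Int.negOnePow_even _ ⟨k, rfl⟩, mul_one]

theorem suspProj_comp_suspSign (n : ℤ) :
    suspProj 𝓜 n ∘ₗ suspSign 𝓜 = (((n.negOnePow : ℤˣ) : ℤ) : R) • suspProj 𝓜 n := by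
  refine LinearMap.ext fun x => ?_
  rw [LinearMap.comp_apply, suspProj, hasDeg_suspSign.gradeProj_apply (add_zero _),
    suspSign_of_mem (gradeProj_mem x), sub_add_cancel, LinearMap.smul_apply, Int.cast_smul_eq_zsmul]

theorem suspProj_comm {g : M →ₗ[R] M'} (hg : HasDeg 𝓜 𝓜' 0 g) (n : ℤ) :
    suspProj 𝓜' n ∘ₗ g = g ∘ₗ suspProj 𝓜 n :=
  LinearMap.ext fun x => hg.gradeProj_apply (add_zero _) x

theorem suspProj_comp_of_hasDeg {g : M →ₗ[R] M'} (hg : HasDeg 𝓜 𝓜' (-1) g) (n : ℤ) :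
    suspProj 𝓜' n ∘ₗ g = g ∘ₗ suspProj 𝓜 (n + 1) :=
  LinearMap.ext fun x => hg.gradeProj_apply (by ring) x

theorem map_peel_eq_zero {m p q : ℤ} (hm : p + q ≠ m) {t : TensorAlgebra R M}
    (ht : t ∈ wordGrading 𝓜 m) :
    TensorProduct.map (suspProj 𝓜 p) (wordProj 𝓜 q) (peel t) = 0 := by
  suffices h : wordGrading 𝓜 m ≤
    LinearMap.ker (TensorProduct.map (suspProj 𝓜 p) (wordProj 𝓜 q) ∘ₗ peel) from h ht
  refine wordGrading_le fun l hl => ?_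
  rw [LinearMap.mem_ker, LinearMap.comp_apply]
  cases hl with
  | nil => simp
  | @cons a l k n ha hl =>
    rw [word_cons, peel_ι_mul, TensorProduct.map_tmul]
    by_cases hq : n = q
    · rw [suspProj, gradeProj_of_mem_ne (by omega) ha, TensorProduct.zero_tmul]
    · rw [wordProj, gradeProj_of_mem_ne hq hl.word_mem, TensorProduct.tmul_zero]

theorem peel_mem_biLev {n : ℤ} {t : TensorAlgebra R M} (ht : t ∈ fil (wordProj 𝓜) n) :
    peel t ∈ biLev (suspProj 𝓜) (wordProj 𝓜) n := by
  intro p q hpq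
  obtain ⟨S, hS⟩ := (isProjSystem_wordProj 𝓜).exists_sum t
  rw [hS, map_sum, map_sum]
  refine Finset.sum_eq_zero fun m _ => ?_
  by_cases hm : p + q = m
  · rw [ht m (hm ▸ hpq), map_zero, map_zero]
  · exact map_peel_eq_zero hm (gradeProj_mem t)

theorem unpeel_map_mem (p q : ℤ) (x : M ⊗[R] TensorAlgebra R M) :
    unpeel (TensorProduct.map (suspProj 𝓜 p) (wordProj 𝓜 q) x) ∈ wordGrading 𝓜 (p + q) := by
  induction x using TensorProduct.induction_on with
  | zero => simp
  | tmul a t =>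
    rw [TensorProduct.map_tmul, unpeel_tmul]
    have := mul_mem_wordGrading _ _ _ (ι_mem_wordGrading (gradeProj_mem (𝓛 := 𝓜) (n := p - 1) a)) _
      (gradeProj_mem (𝓛 := wordGrading 𝓜) (n := q) t)
    rwa [sub_add_cancel] at this
  | add x y hx hy =>
    rw [map_add, map_add]
    exact add_mem hx hy

theorem unpeel_mem_fil {n : ℤ} {x : M ⊗[R] TensorAlgebra R M}
    (hx : x ∈ biLev (suspProj 𝓜) (wordProj 𝓜) n) : unpeel x ∈ fil (wordProj 𝓜) n := by
  intro m hm
  obtain ⟨S, hS⟩ := (isProjSystem_suspProj 𝓜).exists_sum_tensor (isProjSystem_wordProj 𝓜) x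
  rw [hS, map_sum, map_sum]
  refine Finset.sum_eq_zero fun i _ => ?_
  by_cases hi : i.1 + i.2 ≤ n
  · rw [hx _ _ hi, map_zero, map_zero]
  · exact gradeProj_of_mem_ne (by omega) (unpeel_map_mem _ _ x)

theorem wordProj_comm {g : TensorAlgebra R M →ₗ[R] TensorAlgebra R M'}
    (hg : HasDeg (wordGrading 𝓜) (wordGrading 𝓜') 0 g) (n : ℤ) :
    wordProj 𝓜' n ∘ₗ g = g ∘ₗ wordProj 𝓜 n :=
  LinearMap.ext fun x => hg.gradeProj_apply (add_zero _) x

theorem hasDeg_lenProj (k : ℤ) : HasDeg (wordGrading 𝓜) (wordGrading 𝓜) 0 (lenProj k) := by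
  intro n
  suffices h : wordGrading 𝓜 n ≤ (wordGrading 𝓜 (n + 0)).comap (lenProj k) from fun x hx => h hx
  refine wordGrading_le fun l hl => ?_
  rw [Submodule.mem_comap, lenProj_word, add_zero]
  split_ifs
  · exact hl.word_mem
  · exact zero_mem _

/-- By connectedness a nonzero homogeneous letter has degree at least 2 in the suspension. -/
theorem IsHomogeneousList.word_eq_zero_or (hM : IsConnected 𝓜) {l : List M} {n : ℤ}
    (hl : IsHomogeneousList 𝓜 l n) : word R l = 0 ∨ 2 * (l.length : ℤ) ≤ n := by
  induction hl with
  | nil => right; simp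
  | @cons a l p n ha hl ih =>
    by_cases hp : p ≤ 0
    · rw [hM p hp, Submodule.mem_bot] at ha
      left
      rw [word_cons, ha, map_zero, zero_mul]
    · rcases ih with h | h
      · left
        rw [word_cons, h, mul_zero]
      · right
        rw [List.length_cons]
        push_cast
        linarith

theorem lenProj_eq_zero_of_mem (hM : IsConnected 𝓜) {k n : ℤ} (h : n < 2 * k)
    {t : TensorAlgebra R M} (ht : t ∈ wordGrading 𝓜 n) : lenProj k t = 0 := by
  suffices h : wordGrading 𝓜 n ≤ LinearMap.ker (lenProj k) from h ht
  refine wordGrading_le fun l hl => ?_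
  rw [LinearMap.mem_ker, lenProj_word]
  split_ifs with hk
  · exact (hl.word_eq_zero_or hM).resolve_right (by omega)
  · rfl

theorem wordProj_comp_lenProj (hM : IsConnected 𝓜) {k n : ℤ} (h : n < 2 * k) :
    wordProj 𝓜 n ∘ₗ lenProj k = 0 := by
  rw [wordProj_comm (hasDeg_lenProj k)]
  exact LinearMap.ext fun x => lenProj_eq_zero_of_mem hM h (gradeProj_mem x)

theorem wordProj_eq_zero (hM : IsConnected 𝓜) {n : ℤ} (hn : n < 0) : wordProj 𝓜 n = 0 := by
  suffices h : wordGrading 𝓜 n ≤ ⊥ from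
    LinearMap.ext fun x => (Submodule.mem_bot R).1 (h (gradeProj_mem x))
  refine wordGrading_le fun l hl => ?_
  exact (Submodule.mem_bot R).2 ((hl.word_eq_zero_or hM).resolve_right (by omega))

theorem counit_wordProj_zero (t : TensorAlgebra R M) :
    counit (R := R) (wordProj 𝓜 0 t) = counit (R := R) t := by
  suffices h : counit (R := R) ∘ₗ wordProj 𝓜 0 = counit (R := R) (A := TensorAlgebra R M) from
    LinearMap.congr_fun h t
  refine linearMap_ext_of_iSup_eq_top (iSup_wordGrading 𝓜) fun n x hx => ?_
  by_cases hn : n = 0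
  · subst hn
    rw [LinearMap.comp_apply, wordProj, gradeProj_of_mem hx]
  · rw [LinearMap.comp_apply, wordProj, gradeProj_of_mem_ne hn hx, map_zero,
      (isGradedCoalgebra_tensorAlgebra 𝓜).counit_eq_zero n x hx hn]

end SuspensionGrading

/-! ### Low-degree acyclicity of the cone of f₁ -/

section LetterConnectivity

variable {R M M' : Type*} [CommRing R] [AddCommGroup M] [Module R M] [AddCommGroup M'] [Module R M']

theorem IsProjSystem.exists_support {π : ℤ → M →ₗ[R] M} (hπ : IsProjSystem π) (x : M) :
    ∃ S : Finset ℤ, ∀ p, p ∉ S → π p x = 0 := by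
  obtain ⟨S, hS⟩ := hπ.exists_sum x
  refine ⟨S, fun p hp => ?_⟩
  rw [hS, map_sum]
  exact Finset.sum_eq_zero fun q hq =>
    LinearMap.congr_fun (hπ.ne p q fun h => hp (h ▸ hq)) x

variable {𝓜 : ℤ → Submodule R M} [DirectSum.Decomposition 𝓜]
  {𝓜' : ℤ → Submodule R M'} [DirectSum.Decomposition 𝓜']
  {A : AInfAlgebra 𝓜} {A' : AInfAlgebra 𝓜'} {F : AInfHom A A'}

theorem gradeProj_sum_of_mem {S : Finset ℤ} {k : ℤ} {w : ℤ → M} (hw : ∀ n, w n ∈ 𝓜 (n + k)) (n : ℤ) :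
    gradeProj 𝓜 (n + k) (∑ i ∈ S, w i) = if n ∈ S then w n else 0 := by
  rw [map_sum, ← Finset.sum_ite_eq' S n w]
  refine Finset.sum_congr rfl fun i _ => ?_
  split_ifs with h
  · subst h
    exact gradeProj_of_mem (hw i)
  · exact gradeProj_of_mem_ne (by omega) (hw i)

/-- The first component of a morphism, if cycles lift in low degrees. -/
theorem AInfHom.connAt_f₁ {m : ℤ} (h : ∀ n < m, F.LiftsAt n) :
    ConnAt A.m₁ A'.m₁ F.f₁ (fil (suspProj 𝓜)) (fil (suspProj 𝓜')) m := by
  intro u v hu huv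
  have hm := A.hasDeg_m₁
  have hm' := A'.hasDeg_m₁
  have hf := F.hasDeg_f₁
  -- The lifting problem is solved degree by degree. Zero is used outside the range, so that the
  -- choices form families over all integers.
  have key : ∀ n : ℤ, ∃ w ∈ 𝓜 (n + 0), ∃ y ∈ 𝓜' (n + 1), n < m →
      A.m₁ w = gradeProj 𝓜 (n - 1) u ∧ F.f₁ w + A'.m₁ y = gradeProj 𝓜' n v := by
    intro n
    by_cases hn : n < m
    · have h1 : A.m₁ (gradeProj 𝓜 (n - 1) u) = 0 := by
        rw [← hm.gradeProj_apply rfl]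
        have := hu (n - 1) (by linarith)
        rwa [suspProj] at this
      have h2 : F.f₁ (gradeProj 𝓜 (n - 1) u) = A'.m₁ (gradeProj 𝓜' n v) := by
        rw [← hf.gradeProj_apply (add_zero _), ← hm'.gradeProj_apply (n := n) rfl]
        have := huv n (by linarith)
        rwa [suspProj, map_sub, sub_eq_zero] at this
      obtain ⟨w, hw, y, hy, h3⟩ := h n hn _ (gradeProj_mem u) _ (gradeProj_mem v) h1 h2
      exact ⟨w, by rwa [add_zero], y, hy, fun _ => h3⟩
    · exact ⟨0, zero_mem _, 0, zero_mem _, fun h' => absurd h' hn⟩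
  choose w hw y hy hwy using key
  obtain ⟨S, hS⟩ := (isProjSystem_suspProj 𝓜).exists_support u
  obtain ⟨S', hS'⟩ := (isProjSystem_gradeProj 𝓜').exists_support v
  -- Only the finitely many degrees where u or v has a component need a correction; elsewhere there
  -- is nothing to solve.
  refine ⟨∑ n ∈ S ∪ S', w n, ∑ n ∈ S ∪ S', y n, fun n hn => ?_, fun n hn => ?_⟩
  · have h0 := gradeProj_sum_of_mem (S := S ∪ S') hw n
    rw [add_zero] at h0
    rw [suspProj, map_sub, hm.gradeProj_apply (n := n) (m := n - 1) rfl, h0, sub_eq_zero]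
    split_ifs with hnS
    · exact ((hwy n (by linarith)).1).symm
    · rw [map_zero]
      exact hS n fun h' => hnS (Finset.mem_union_left _ h')
  · obtain ⟨n, rfl⟩ : ∃ n', n = n' + 1 := ⟨n - 1, by ring⟩
    have h0 := gradeProj_sum_of_mem (S := S ∪ S') hw n
    have h1 := gradeProj_sum_of_mem (S := S ∪ S') hy n
    rw [add_zero] at h0
    rw [suspProj, add_sub_cancel_right, map_sub, map_sub, hf.gradeProj_apply (add_zero n),
      hm'.gradeProj_apply (n := n + 1) (by ring), h0, h1]
    split_ifs with hnS
    · rw [← (hwy n (by linarith)).2]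
      abel
    · rw [map_zero, map_zero, hS' n fun h' => hnS (Finset.mem_union_right _ h')]
      simp

end LetterConnectivity

/-! ### Low-degree acyclicity for letterwise application of f₁ -/

section WordConnectivity

theorem comp_id_eq_id_comp {R V : Type*} [CommRing R] [AddCommGroup V] [Module R V]
    (σ : ℤ → V →ₗ[R] V) (p : ℤ) : σ p ∘ₗ LinearMap.id = LinearMap.id ∘ₗ σ p := rfl

theorem map_tensorDiff_id {R V V' W : Type*} [CommRing R] [AddCommGroup V] [Module R V]
    [AddCommGroup V'] [Module R V'] [AddCommGroup W] [Module R W] {δ s : V →ₗ[R] V}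
    {δ' s' : V' →ₗ[R] V'} {d : W →ₗ[R] W} {f : V →ₗ[R] V'} (h1 : ∀ a, f (δ a) = δ' (f a))
    (h2 : ∀ a, f (s a) = s' (f a)) (x : V ⊗[R] W) :
    TensorProduct.map f LinearMap.id (tensorDiff δ s d x) =
      tensorDiff δ' s' d (TensorProduct.map f LinearMap.id x) :=
  map_tensorDiff (g := LinearMap.id) (d := d) (d' := d) h1 h2 (fun _ => rfl) x

variable {R M M' : Type*} [CommRing R] [AddCommGroup M] [Module R M] [AddCommGroup M'] [Module R M']
  {𝓜 : ℤ → Submodule R M} [DirectSum.Decomposition 𝓜]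
  {𝓜' : ℤ → Submodule R M'} [DirectSum.Decomposition 𝓜']
  {A : AInfAlgebra 𝓜} {A' : AInfAlgebra 𝓜'} {F : AInfHom A A'}

theorem AInfAlgebra.m₁_suspSign (A : AInfAlgebra 𝓜) (x : M) :
    A.m₁ (suspSign 𝓜 x) = -suspSign 𝓜 (A.m₁ x) := by
  rw [apply_suspSign_of_hasDeg A.hasDeg_m₁]
  simp

theorem AInfHom.f₁_suspSign (F : AInfHom A A') (x : M) :
    F.f₁ (suspSign 𝓜 x) = suspSign 𝓜' (F.f₁ x) := by
  rw [apply_suspSign_of_hasDeg F.hasDeg_f₁]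
  simp

theorem AInfAlgebra.linBar_linBar (A : AInfAlgebra 𝓜) (x : TensorAlgebra R M) :
    A.linBar (A.linBar x) = 0 := linDiff_linDiff A.m₁_m₁ A.m₁_suspSign x

theorem AInfAlgebra.hasDeg_linBar (A : AInfAlgebra 𝓜) :
    HasDeg (wordGrading 𝓜) (wordGrading 𝓜) (-1) A.linBar :=
  hasDeg_linDiff A.hasDeg_m₁ hasDeg_suspSign

theorem AInfAlgebra.wordProj_comp_linBar (A : AInfAlgebra 𝓜) (n : ℤ) :
    wordProj 𝓜 n ∘ₗ A.linBar = A.linBar ∘ₗ wordProj 𝓜 (n + 1) :=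
  LinearMap.ext fun x => A.hasDeg_linBar.gradeProj_apply (by ring) x

theorem AInfHom.letterwise_linBar (F : AInfHom A A') (hM' : IsConnected 𝓜')
    (x : TensorAlgebra R M) :
    letterwise F.f₁ (A.linBar x) = A'.linBar (letterwise F.f₁ x) :=
  letterwise_linDiff (F.f₁_m₁ hM') F.f₁_suspSign x

theorem AInfAlgebra.peel_linBar (A : AInfAlgebra 𝓜) (t : TensorAlgebra R M) :
    peel (A.linBar t) = tensorDiff A.m₁ (suspSign 𝓜) A.linBar (peel t) := peel_linDiff _ _ t

theorem AInfAlgebra.unpeel_tensorDiff (A : AInfAlgebra 𝓜) (x : M ⊗[R] TensorAlgebra R M) :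
    unpeel (tensorDiff A.m₁ (suspSign 𝓜) A.linBar x) = A.linBar (unpeel x) :=
  AInf.unpeel_tensorDiff _ _ x

theorem AInfAlgebra.counit_linBar (A : AInfAlgebra 𝓜) (t : TensorAlgebra R M) :
    counit (R := R) (A.linBar t) = 0 := by
  suffices h : counit (R := R) ∘ₗ A.linBar = 0 from LinearMap.congr_fun h t
  refine word_induction (by simp [linBar]) fun a w _ => ?_
  simp [linBar, linDiff_ι_mul]

theorem counit_letterwise (f : M →ₗ[R] M') (t : TensorAlgebra R M) :
    counit (R := R) (letterwise f t) = counit (R := R) t := by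
  suffices h : counit (R := R) ∘ₗ (letterwise f).toLinearMap = counit (R := R) from
    LinearMap.congr_fun h t
  refine word_induction (by simp) fun a w _ => ?_
  simp

variable (hM : IsConnected 𝓜) (hM' : IsConnected 𝓜') [Module.Flat R M] [Module.Flat R M']

include hM hM' in
-- After peeling, with G the letterwise map, f₁ ⊗ G is the composite of id ⊗ G and f₁ ⊗ id. The
-- former is handled by tensoring with the flat module M, whose rows start at 2 by connectedness,
-- the latter by tensoring with the flat tensor algebra on M', whose relevant rows start at Q. The
-- projection r restricts to tails of a given length, which raises Q.
theorem AInfHom.exists_peel {n Q : ℤ}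
    (hrow : ∀ p ≥ 2, ConnAt A.linBar A'.linBar (letterwise F.f₁).toLinearMap
      (fil (wordProj 𝓜)) (fil (wordProj 𝓜')) (n - p))
    (hrow' : ∀ q ≥ Q, ConnAt A.m₁ A'.m₁ F.f₁ (fil (suspProj 𝓜)) (fil (suspProj 𝓜')) (n - q))
    {r : TensorAlgebra R M' →ₗ[R] TensorAlgebra R M'} (hrd : ∀ t, r (A'.linBar t) = A'.linBar (r t))
    (hrρ : ∀ q, wordProj 𝓜' q ∘ₗ r = r ∘ₗ wordProj 𝓜' q) (hrQ : ∀ q < Q, wordProj 𝓜' q ∘ₗ r = 0)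
    {u : TensorAlgebra R M} {v : TensorAlgebra R M'}
    (hru : TensorProduct.map LinearMap.id (r ∘ₗ (letterwise F.f₁).toLinearMap) (peel u) =
      TensorProduct.map LinearMap.id (letterwise F.f₁).toLinearMap (peel u))
    (hrv : TensorProduct.map LinearMap.id r (peel v) = peel v)
    (hu : A.linBar u ∈ fil (wordProj 𝓜) (n - 2))
    (huv : letterwise F.f₁ u - A'.linBar v ∈ fil (wordProj 𝓜') (n - 1)) :
    ∃ w y, u - counit (R := R) u • 1 - A.linBar w ∈ fil (wordProj 𝓜) (n - 1) ∧
      v - counit (R := R) v • 1 - letterwise F.f₁ w - A'.linBar y ∈ fil (wordProj 𝓜') n := by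
  set G := (letterwise F.f₁).toLinearMap with hG
  have hGd : ∀ t, G (A.linBar t) = A'.linBar (G t) := F.letterwise_linBar hM'
  have hsplit : ∀ t : M ⊗[R] TensorAlgebra R M, TensorProduct.map F.f₁ LinearMap.id
      (TensorProduct.map LinearMap.id G t) = TensorProduct.map F.f₁ G t := fun t => by
    rw [map_map_apply]
    rfl
  have hc := connAt_lTensor (isProjSystem_suspProj 𝓜) (isProjSystem_wordProj 𝓜)
    (isProjSystem_wordProj 𝓜') A.m₁_m₁ A.m₁_suspSign (suspProj_comp_of_hasDeg A.hasDeg_m₁)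
    (fun p => by rw [← Int.cast_mul, ← Units.val_mul, Int.units_mul_self]; simp)
    suspProj_comp_suspSign A.linBar_linBar A'.linBar_linBar hGd (n := n) (P := 2)
    (fun p hp => suspProj_eq_zero hM hp) hrow
  have hx := peel_mem_biLev hu
  rw [A.peel_linBar] at hx
  have hz := peel_mem_biLev huv
  rw [map_sub, A'.peel_linBar, peel_letterwise, ← hG, ← hsplit] at hz
  have hGx : tensorDiff A.m₁ (suspSign 𝓜) A'.linBar (TensorProduct.map LinearMap.id G (peel u)) ∈
      biLev (suspProj 𝓜) (wordProj 𝓜') (n - 2) := by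
    rw [← map_id_tensorDiff hGd]
    exact map_mem_biLev (comp_id_eq_id_comp _) (wordProj_comm (hasDeg_letterwise F.hasDeg_f₁)) hx
  have hru' : TensorProduct.map LinearMap.id r (TensorProduct.map LinearMap.id G (peel u)) =
      TensorProduct.map LinearMap.id G (peel u) := by
    rw [map_map_apply]
    exact hru
  have hf : ∀ t : M ⊗[R] TensorAlgebra R M',
      TensorProduct.map F.f₁ LinearMap.id (tensorDiff A.m₁ (suspSign 𝓜) A'.linBar t) =
      tensorDiff A'.m₁ (suspSign 𝓜') A'.linBar (TensorProduct.map F.f₁ LinearMap.id t) :=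
    map_tensorDiff_id (F.f₁_m₁ hM') F.f₁_suspSign
  have hfil : ∀ t ∈ biLev (suspProj 𝓜) (wordProj 𝓜') n,
      TensorProduct.map F.f₁ LinearMap.id t ∈ biLev (suspProj 𝓜') (wordProj 𝓜') n := fun t ht =>
    map_mem_biLev (suspProj_comm F.hasDeg_f₁) (comp_id_eq_id_comp _) ht
  have hs := suspProj_comm (hasDeg_suspSign (𝓜 := 𝓜))
  have hs' := suspProj_comm (hasDeg_suspSign (𝓜 := 𝓜'))
  have hr : ∃ w y, TensorProduct.map LinearMap.id G (peel u) -
      tensorDiff A.m₁ (suspSign 𝓜) A'.linBar w ∈ biLev (suspProj 𝓜) (wordProj 𝓜') (n - 1) ∧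
      peel v - TensorProduct.map F.f₁ LinearMap.id w - tensorDiff A'.m₁ (suspSign 𝓜') A'.linBar y ∈
        biLev (suspProj 𝓜') (wordProj 𝓜') n :=
    exists_rTensor_of_proj (isProjSystem_wordProj 𝓜') A'.linBar_linBar A'.wordProj_comp_linBar
      (isProjSystem_suspProj 𝓜) (isProjSystem_suspProj 𝓜') A.m₁_m₁ A.m₁_suspSign A'.m₁_m₁
      A'.m₁_suspSign (F.f₁_m₁ hM') F.f₁_suspSign hs hs' hrow' hrd hrρ hrQ hru' hrv hGx hz
  obtain ⟨w, y, h1, h2⟩ := exists_comp hc hf hfil hx hr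
  refine ⟨unpeel w, unpeel y, ?_, ?_⟩
  · have := unpeel_mem_fil h1
    rwa [map_sub, A.unpeel_tensorDiff, unpeel_peel] at this
  · have := unpeel_mem_fil h2
    rwa [map_sub, map_sub, hsplit, A'.unpeel_tensorDiff, unpeel_peel, unpeel_map] at this

include hM hM' in
/-- The linear part of a morphism of bar constructions, if cycles lift in low degrees. -/
theorem AInfHom.connAt_letterwise {N : ℤ} (h : ∀ n < N, F.LiftsAt n) {m : ℤ} (hm : m ≤ N) :
    ConnAt A.linBar A'.linBar (letterwise F.f₁).toLinearMap
      (fil (wordProj 𝓜)) (fil (wordProj 𝓜')) m := by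
  suffices H : ∀ k : ℕ, ∀ m ≤ N, m < k → ConnAt A.linBar A'.linBar (letterwise F.f₁).toLinearMap
      (fil (wordProj 𝓜)) (fil (wordProj 𝓜')) m from H (m + 1).toNat m hm (by omega)
  clear hm m
  intro k
  induction k with
  | zero =>
    intro m _ hm u v _ _
    refine ⟨0, 0, fun q hq => ?_, fun q hq => ?_⟩
    · rw [wordProj_eq_zero hM (by push_cast at hm; linarith), LinearMap.zero_apply]
    · rw [wordProj_eq_zero hM' (by push_cast at hm; linarith), LinearMap.zero_apply]
  | succ k ih =>
    intro m hmN hmk u v hu huv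
    -- A first letter has degree p ≥ 2, so for the tails only the case m - p, already known, is
    -- needed.
    obtain ⟨w, y, h1, h2⟩ := F.exists_peel hM hM' (n := m) (Q := 0) (r := LinearMap.id)
      (fun p hp => ih (m - p) (by linarith) (by push_cast at hmk; linarith))
      (fun q hq => F.connAt_f₁ fun n hn => h n (by linarith)) (fun _ => rfl) (fun _ => rfl)
      (fun q hq => by rw [wordProj_eq_zero hM' hq]; rfl) rfl (by simp) hu huv
    have hG1 : (letterwise F.f₁).toLinearMap (1 : TensorAlgebra R M) = 1 :=
      map_one (letterwise F.f₁)
    have hd1 : A.linBar 1 = 0 := linDiff_one _ _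
    -- Peeling ignores constants. If degree 0 lies in the range under consideration, then the
    -- component of `huv` there forces the constant term of u to vanish.
    have hc : counit (R := R) u • (1 : TensorAlgebra R M) ∈ fil (wordProj 𝓜) (m - 1) := by
      intro q hq
      by_cases hq0 : q = 0
      · have h3 := huv 0 (hq0 ▸ hq)
        have h4 := congrArg (counit (R := R)) h3
        rw [counit_wordProj_zero, map_zero, map_sub, A'.counit_linBar, sub_zero,
          AlgHom.toLinearMap_apply, counit_letterwise] at h4
        rw [h4, zero_smul, map_zero]
      · rw [map_smul, wordProj, gradeProj_of_mem_ne (Ne.symm hq0) one_mem_wordGrading, smul_zero]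
    -- The constant term of v is matched by one of w, which the linear differential kills and the
    -- letterwise map fixes.
    refine ⟨w + counit (R := R) v • 1, y, ?_, ?_⟩
    · have := add_mem h1 hc
      rw [map_add, map_smul, hd1, smul_zero, add_zero]
      convert this using 1
      abel
    · rw [map_add, map_smul, hG1]
      convert h2 using 1
      rw [AlgHom.toLinearMap_apply]
      abel

end WordConnectivity

/-! ### Words of length zero and one, and maximal length -/

section Length

variable {R M M' : Type*} [CommRing R] [AddCommGroup M] [Module R M] [AddCommGroup M'] [Module R M']

theorem lenProj_zero (t : TensorAlgebra R M) : lenProj 0 t = counit (R := R) t • 1 := by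
  suffices h : lenProj 0 = LinearMap.toSpanSingleton R _ (1 : TensorAlgebra R M) ∘ₗ counit from
    LinearMap.congr_fun h t
  refine linearMap_ext_word fun l => ?_
  rw [lenProj_word, LinearMap.comp_apply, counit_word]
  cases l with
  | nil => simp
  | cons a l =>
    rw [if_neg (by rw [List.length_cons]; push_cast; omega), if_neg (by simp), map_zero]

theorem lenProj_one (t : TensorAlgebra R M) : lenProj 1 t = TensorAlgebra.ι R (letter t) := by
  suffices h : lenProj 1 = TensorAlgebra.ι R ∘ₗ letter from LinearMap.congr_fun h t
  refine linearMap_ext_word fun l => ?_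
  rw [lenProj_word, LinearMap.comp_apply]
  cases l with
  | nil => simp
  | cons a l =>
    rw [word_cons, letter_ι_mul, counit_word]
    cases l <;> simp
    omega

theorem lenProj_of_neg {q : ℤ} (hq : q < 0) (t : TensorAlgebra R M) : lenProj q t = 0 := by
  suffices h : lenProj q = (0 : TensorAlgebra R M →ₗ[R] TensorAlgebra R M) from
    LinearMap.congr_fun h t
  refine linearMap_ext_word fun l => ?_
  rw [lenProj_word, if_neg (by omega), LinearMap.zero_apply]

theorem counit_lenProj {p : ℤ} (hp : p ≠ 0) (t : TensorAlgebra R M) :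
    counit (R := R) (lenProj p t) = 0 := by
  suffices h : counit (R := R) ∘ₗ lenProj p = (0 : TensorAlgebra R M →ₗ[R] R) from
    LinearMap.congr_fun h t
  refine linearMap_ext_word fun l => ?_
  rw [LinearMap.comp_apply, lenProj_word, LinearMap.zero_apply]
  split_ifs with h
  · rw [counit_word, if_neg]
    rintro rfl
    exact hp h.symm
  · exact map_zero _

theorem lenProj_lenProj (p : ℤ) (t : TensorAlgebra R M) : lenProj p (lenProj p t) = lenProj p t :=
  LinearMap.congr_fun (isProjSystem_lenProj.self p) t

theorem eq_of_mem_lenLE_one {t : TensorAlgebra R M} (ht : t ∈ lenLE 1) :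
    t = counit (R := R) t • 1 + TensorAlgebra.ι R (letter t) := by
  obtain ⟨S, hS⟩ := isProjSystem_lenProj.exists_sum
    (t - (counit (R := R) t • 1 + TensorAlgebra.ι R (letter t)))
  rw [← sub_eq_zero, hS]
  refine Finset.sum_eq_zero fun q _ => ?_
  rw [← lenProj_zero, ← lenProj_one, map_sub, map_add]
  by_cases h0 : q = 0
  · subst h0
    have h1 := LinearMap.congr_fun (isProjSystem_lenProj.ne 0 1 (by norm_num)) t
    rw [LinearMap.comp_apply] at h1
    rw [lenProj_lenProj, h1]
    simp
  · by_cases h1 : q = 1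
    · subst h1
      have h1 := LinearMap.congr_fun (isProjSystem_lenProj.ne 1 0 (by norm_num)) t
      rw [LinearMap.comp_apply] at h1
      rw [lenProj_lenProj, h1]
      simp
    · have h2 := LinearMap.congr_fun (isProjSystem_lenProj.ne q 0 h0) t
      have h3 := LinearMap.congr_fun (isProjSystem_lenProj.ne q 1 h1) t
      rw [LinearMap.comp_apply] at h2 h3
      rw [h2, h3]
      by_cases hq : q < 0
      · rw [lenProj_of_neg hq]
        simp
      · rw [ht q (by omega)]
        simp

theorem mem_lenLE_of_lenProj_eq {p : ℤ} {t : TensorAlgebra R M} (h : lenProj p t = t) :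
    t ∈ lenLE p := fun q hq => by
  rw [← h]
  exact LinearMap.congr_fun (isProjSystem_lenProj.ne q p (by omega)) t

theorem sub_lenProj_mem_lenLE {p : ℤ} {t : TensorAlgebra R M} (h : t ∈ lenLE p) :
    t - lenProj p t ∈ lenLE (p - 1) := fun q hq => by
  by_cases hqp : q = p
  · subst hqp
    rw [map_sub, lenProj_lenProj, sub_self]
  · rw [map_sub, h q (by omega)]
    have := LinearMap.congr_fun (isProjSystem_lenProj.ne q p hqp) t
    rw [LinearMap.comp_apply] at this
    rw [this]
    simp

theorem lenProj_ι {p : ℤ} (hp : 2 ≤ p) (a : M) : lenProj p (TensorAlgebra.ι R a) = 0 := by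
  have := lenProj_word (R := R) [a] p
  rwa [if_neg (by simp; omega), word_cons, word_nil, mul_one] at this

end Length

/-! ### Gaining two degrees on words of length at least two -/

section Descent

variable {R M M' : Type*} [CommRing R] [AddCommGroup M] [Module R M] [AddCommGroup M'] [Module R M']
  {𝓜 : ℤ → Submodule R M} [DirectSum.Decomposition 𝓜]
  {𝓜' : ℤ → Submodule R M'} [DirectSum.Decomposition 𝓜']
  {A : AInfAlgebra 𝓜} {A' : AInfAlgebra 𝓜'} {F : AInfHom A A'}
  (hM : IsConnected 𝓜) (hM' : IsConnected 𝓜')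

theorem map_mem_fil {g : TensorAlgebra R M →ₗ[R] TensorAlgebra R M'} {k m n : ℤ}
    (hg : HasDeg (wordGrading 𝓜) (wordGrading 𝓜') k g) (hm : n + k = m) {x : TensorAlgebra R M}
    (hx : x ∈ fil (wordProj 𝓜) n) : g x ∈ fil (wordProj 𝓜') m := fun q hq => by
  rw [wordProj, hg.gradeProj_apply (n := q - k) (by ring)]
  have := hx (q - k) (by linarith)
  rw [wordProj] at this
  rw [this, map_zero]

theorem lenProj_mem_fil (p : ℤ) {n : ℤ} {x : TensorAlgebra R M} (hx : x ∈ fil (wordProj 𝓜) n) :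
    lenProj p x ∈ fil (wordProj 𝓜) n := map_mem_fil (hasDeg_lenProj p) (add_zero n) hx

include hM hM' in
/-- The linear part on words of fixed length at least two. -/
theorem AInfHom.exists_of_lenProj_eq [Module.Flat R M] [Module.Flat R M'] {k : ℤ}
    (h : ∀ n < k, F.LiftsAt n) {p : ℤ} (hp : 2 ≤ p) {u : TensorAlgebra R M} {v : TensorAlgebra R M'}
    (hpu : lenProj p u = u) (hpv : lenProj p v = v) (hu : A.linBar u ∈ fil (wordProj 𝓜) k)
    (huv : letterwise F.f₁ u - A'.linBar v ∈ fil (wordProj 𝓜') (k + 1)) :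
    ∃ w y, lenProj p w = w ∧ lenProj p y = y ∧ u - A.linBar w ∈ fil (wordProj 𝓜) (k + 1) ∧
      v - letterwise F.f₁ w - A'.linBar y ∈ fil (wordProj 𝓜') (k + 2) := by
  have hpp : p - 1 + 1 = p := by ring
  have hru : TensorProduct.map LinearMap.id (lenProj (p - 1) ∘ₗ (letterwise F.f₁).toLinearMap)
      (peel u) = TensorProduct.map LinearMap.id (letterwise F.f₁).toLinearMap (peel u) := by
    have h1 : lenProj (p - 1) ∘ₗ (letterwise F.f₁).toLinearMap =
        (letterwise F.f₁).toLinearMap ∘ₗ lenProj (p - 1) :=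
      LinearMap.ext fun t => lenProj_letterwise F.f₁ t _
    have h2 := peel_lenProj (p - 1) u
    rw [hpp, hpu] at h2
    conv_rhs => rw [h2]
    rw [h1, map_map_apply]
    rfl
  have hrv : TensorProduct.map LinearMap.id (lenProj (p - 1)) (peel v) = peel v := by
    rw [← peel_lenProj, hpp, hpv]
  -- Here is the gain: both the first letter and the tail, of length p - 1 ≥ 1, have degree at least
  -- 2, so acyclicity up to k for either factor suffices for total degree k + 2.
  obtain ⟨w, y, h1, h2⟩ := F.exists_peel hM hM' (n := k + 2) (Q := 2)
    (fun q _ => F.connAt_letterwise hM hM' h (by linarith))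
    (fun q _ => F.connAt_f₁ fun n _ => h n (by linarith))
    (fun t => lenProj_linDiff _ _ t (p - 1)) (wordProj_comm (hasDeg_lenProj _))
    (fun q _ => wordProj_comp_lenProj hM' (by linarith)) hru hrv
    (by rwa [add_sub_cancel_right]) (by rwa [show k + 2 - 1 = k + 1 by ring])
  rw [show k + 2 - 1 = k + 1 by ring] at h1
  have hcu : counit (R := R) u = 0 := by rw [← hpu, counit_lenProj (by omega)]
  have hcv : counit (R := R) v = 0 := by rw [← hpv, counit_lenProj (by omega)]
  rw [hcu, zero_smul, sub_zero] at h1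
  rw [hcv, zero_smul, sub_zero] at h2
  have h3 := lenProj_mem_fil p h1
  have h4 := lenProj_mem_fil p h2
  rw [map_sub, hpu, AInfAlgebra.linBar, lenProj_linDiff] at h3
  rw [map_sub, map_sub, hpv, AInfAlgebra.linBar, lenProj_linDiff, lenProj_letterwise] at h4
  exact ⟨lenProj p w, lenProj p y, lenProj_lenProj p w, lenProj_lenProj p y, h3, h4⟩

end Descent

/-! ### From bar equivalences to acyclic cones -/

section Lifting

variable {R M M' : Type*} [CommRing R] [AddCommGroup M] [Module R M] [AddCommGroup M'] [Module R M']
  {𝓜 : ℤ → Submodule R M} [DirectSum.Decomposition 𝓜]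
  {𝓜' : ℤ → Submodule R M'} [DirectSum.Decomposition 𝓜']
  {A : AInfAlgebra 𝓜} {A' : AInfAlgebra 𝓜'} {F : AInfHom A A'}
  (hM : IsConnected 𝓜) (hM' : IsConnected 𝓜')

include hM' in
theorem AInfHom.hasDeg_barMap (F : AInfHom A A') :
    HasDeg (wordGrading 𝓜) (wordGrading 𝓜') 0 F.barMap :=
  hasDeg_geom (isGradedCoalgebra_tensorAlgebra 𝓜) hM' F.hasDeg_total

theorem wordProj_ι (n : ℤ) (a : M) :
    wordProj 𝓜 n (TensorAlgebra.ι R a) = TensorAlgebra.ι R (suspProj 𝓜 n a) := by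
  have h : HasDeg 𝓜 (wordGrading 𝓜) 1 (TensorAlgebra.ι R) := fun n x hx => ι_mem_wordGrading hx
  exact h.gradeProj_apply (by ring) a

theorem wordProj_one {n : ℤ} (hn : n ≠ 0) : wordProj 𝓜 n (1 : TensorAlgebra R M) = 0 :=
  gradeProj_of_mem_ne hn.symm one_mem_wordGrading

theorem AInfAlgebra.lenProj_barDiff (A : AInfAlgebra 𝓜) {p : ℤ} {x : TensorAlgebra R M}
    (hx : x ∈ lenLE p) : lenProj p (A.barDiff x) = A.linBar (lenProj p x) := by
  have := A.barDiff_sub_mem hx p (by linarith)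
  rwa [map_sub, linBar, lenProj_linDiff, sub_eq_zero] at this

theorem AInfAlgebra.barDiff_mem_lenLE (A : AInfAlgebra 𝓜) {p : ℤ} {x : TensorAlgebra R M}
    (hx : x ∈ lenLE p) : A.barDiff x ∈ lenLE p := fun q hq => by
  rw [A.lenProj_barDiff (lenLE_mono hq.le hx), hx q hq, map_zero]

include hM' in
theorem AInfHom.lenProj_barMap {p : ℤ} {x : TensorAlgebra R M} (hx : x ∈ lenLE p) :
    lenProj p (F.barMap x) = letterwise F.f₁ (lenProj p x) := by
  have := F.barMap_sub_mem hM' hx p (by linarith)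
  rwa [map_sub, lenProj_letterwise, sub_eq_zero] at this

include hM' in
theorem AInfHom.barMap_mem_lenLE {p : ℤ} {x : TensorAlgebra R M} (hx : x ∈ lenLE p) :
    F.barMap x ∈ lenLE p := fun q hq => by
  rw [F.lenProj_barMap hM' (lenLE_mono hq.le hx), hx q hq, map_zero]

include hM hM' in
/-- Words of maximal length are removed from a lift of cycles in bar constructions. -/
theorem AInfHom.exists_shorter [Module.Flat R M] [Module.Flat R M'] {k : ℤ}
    (h : ∀ n < k, F.LiftsAt n) {p : ℤ} (hp : 2 ≤ p) {u : M} {v : M'} {w : TensorAlgebra R M}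
    {y : TensorAlgebra R M'} (hw : w ∈ lenLE p) (hy : y ∈ lenLE p)
    (h1 : A.barDiff w - TensorAlgebra.ι R u ∈ fil (wordProj 𝓜) k)
    (h2 : F.barMap w + A'.barDiff y - TensorAlgebra.ι R v ∈ fil (wordProj 𝓜') (k + 1)) :
    ∃ w ∈ lenLE (p - 1), ∃ y ∈ lenLE (p - 1),
      A.barDiff w - TensorAlgebra.ι R u ∈ fil (wordProj 𝓜) k ∧
      F.barMap w + A'.barDiff y - TensorAlgebra.ι R v ∈ fil (wordProj 𝓜') (k + 1) := by
  have h3 := lenProj_mem_fil p h1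
  have h4 := lenProj_mem_fil p h2
  rw [map_sub, A.lenProj_barDiff hw, lenProj_ι hp, sub_zero] at h3
  rw [map_sub, map_add, F.lenProj_barMap hM' hw, A'.lenProj_barDiff hy, lenProj_ι hp, sub_zero] at h4
  obtain ⟨w', y', hw', hy', h5, h6⟩ := F.exists_of_lenProj_eq hM hM' h hp (v := -lenProj p y)
    (lenProj_lenProj p w) (by rw [map_neg, lenProj_lenProj]) h3 (by rwa [map_neg, sub_neg_eq_add])
  have hlw := mem_lenLE_of_lenProj_eq hw'
  have hly := mem_lenLE_of_lenProj_eq hy'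
  -- The pair (w, y) changes by a boundary in the cone of B(f), so the equations satisfied by it are
  -- unaffected; but its parts of length p now lie in high degrees.
  set w₂ := w - A.barDiff w' with hw₂
  set y₂ := y + F.barMap w' + A'.barDiff y' with hy₂
  have hlw₂ : w₂ ∈ lenLE p := sub_mem hw (A.barDiff_mem_lenLE hlw)
  have hly₂ : y₂ ∈ lenLE p := add_mem (add_mem hy (F.barMap_mem_lenLE hM' hlw)) (A'.barDiff_mem_lenLE hly)
  have e1 : lenProj p w₂ ∈ fil (wordProj 𝓜) (k + 1) := by
    rwa [hw₂, map_sub, A.lenProj_barDiff hlw, hw']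
  have e2 : lenProj p y₂ ∈ fil (wordProj 𝓜') (k + 2) := by
    rw [hy₂, map_add, map_add, F.lenProj_barMap hM' hlw, A'.lenProj_barDiff hly, hw', hy']
    convert neg_mem h6 using 1
    abel
  have b1 : A.barDiff w₂ = A.barDiff w := by rw [hw₂, map_sub, A.barDiff_barDiff, sub_zero]
  have b2 : F.barMap w₂ + A'.barDiff y₂ = F.barMap w + A'.barDiff y := by
    rw [hw₂, hy₂, map_sub, map_add, map_add, F.barMap_barDiff hM', A'.barDiff_barDiff]
    abel
  -- Discarding the parts of length p changes the two equations only in degrees above k and k + 1.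
  refine ⟨w₂ - lenProj p w₂, sub_lenProj_mem_lenLE hlw₂, y₂ - lenProj p y₂,
    sub_lenProj_mem_lenLE hly₂, ?_, ?_⟩
  · have h7 := map_mem_fil A.hasDeg_barDiff (m := k) (by ring) e1
    rw [map_sub, b1]
    convert sub_mem h1 h7 using 1
    abel
  · have h7 := map_mem_fil (F.hasDeg_barMap hM') (m := k + 1) (by ring) e1
    have h8 := map_mem_fil A'.hasDeg_barDiff (m := k + 1) (by ring) e2
    have h9 : F.barMap (w₂ - lenProj p w₂) + A'.barDiff (y₂ - lenProj p y₂) -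
        TensorAlgebra.ι R v = F.barMap w + A'.barDiff y - TensorAlgebra.ι R v -
        (F.barMap (lenProj p w₂) + A'.barDiff (lenProj p y₂)) := by
      rw [← b2, map_sub F.barMap, map_sub A'.barDiff]
      abel
    rw [h9]
    exact sub_mem h2 (add_mem h7 h8)

include hM hM' in
-- A cone cycle of f₁ is one of B(f) in words of length one, hence a boundary there. Shortening the
-- bounding words to length at most one and taking the components of the right degree gives a
-- boundary in the cone of f₁.
theorem AInfHom.IsBarEquiv.liftsAt_of_lt [Module.Flat R M] [Module.Flat R M'] (hF : F.IsBarEquiv)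
    {k : ℤ} (h : ∀ n < k, F.LiftsAt n) : F.LiftsAt k := by
  intro u hu v hv hu0 huv
  by_cases hk : k ≤ 0
  · rw [hM _ (by linarith), Submodule.mem_bot] at hu
    rw [hM' k hk, Submodule.mem_bot] at hv
    exact ⟨0, zero_mem _, 0, zero_mem _, by rw [hu, map_zero], by rw [hv]; simp⟩
  obtain ⟨w, y, h1, h2⟩ := IsBarEquiv.exists_lift F hM' hF (u := TensorAlgebra.ι R u)
    (v := TensorAlgebra.ι R v) (by rw [A.barDiff_ι, hu0, map_zero])
    (by rw [F.barMap_ι hM', huv, A'.barDiff_ι])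
  have key : ∀ j : ℕ, ∀ w ∈ lenLE (j + 1 : ℤ), ∀ y ∈ lenLE (j + 1 : ℤ),
      A.barDiff w - TensorAlgebra.ι R u ∈ fil (wordProj 𝓜) k →
      F.barMap w + A'.barDiff y - TensorAlgebra.ι R v ∈ fil (wordProj 𝓜') (k + 1) →
      ∃ w ∈ lenLE 1, ∃ y ∈ lenLE 1,
        A.barDiff w - TensorAlgebra.ι R u ∈ fil (wordProj 𝓜) k ∧
        F.barMap w + A'.barDiff y - TensorAlgebra.ι R v ∈ fil (wordProj 𝓜') (k + 1) := by
    intro j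
    induction j with
    | zero =>
      intro w hw y hy h1 h2
      rw [Nat.cast_zero, zero_add] at hw hy
      exact ⟨w, hw, y, hy, h1, h2⟩
    | succ j ih =>
      intro w hw y hy h1 h2
      obtain ⟨w, hw, y, hy, h1, h2⟩ := F.exists_shorter hM hM' h (by push_cast; omega) hw hy h1 h2
      rw [Nat.cast_succ, add_sub_cancel_right] at hw hy
      exact ih w hw y hy h1 h2
  -- Only finitely many lengths occur in w and y, which bounds the number of shortenings.
  obtain ⟨B, hB⟩ := isProjSystem_lenProj.exists_bound w
  obtain ⟨B', hB'⟩ := isProjSystem_lenProj.exists_bound y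
  obtain ⟨w, hw, y, hy, h3, h4⟩ := key (max B B').toNat w (fun q hq => hB q (by omega)) y
    (fun q hq => hB' q (by omega)) (by rw [h1, sub_self]; exact zero_mem _)
    (by rw [h2, sub_self]; exact zero_mem _)
  have inj : ∀ {x : M}, TensorAlgebra.ι R x = 0 → x = 0 := fun {x} hx => by
    simpa using congrArg letter hx
  have inj' : ∀ {x : M'}, TensorAlgebra.ι R x = 0 → x = 0 := fun {x} hx => by
    simpa using congrArg letter hx
  -- Suspension shifts degrees by one: u and v sit in word degrees k and k + 1, where the error
  -- terms have no component. Constants contribute nothing, as `barDiff` kills 1 and k + 1 ≠ 0.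
  have h5 := h3 k le_rfl
  have h6 := h4 (k + 1) le_rfl
  rw [eq_of_mem_lenLE_one hw, map_add, map_smul, A.barDiff_one, smul_zero, zero_add, A.barDiff_ι,
    ← map_sub, wordProj_ι] at h5
  rw [eq_of_mem_lenLE_one hw, eq_of_mem_lenLE_one hy, map_add, map_smul, map_add, map_smul,
    A'.barDiff_one, smul_zero, zero_add, A'.barDiff_ι, F.barMap_one hM', F.barMap_ι hM', add_assoc,
    add_sub_assoc, ← map_add, ← map_sub, map_add, map_smul, wordProj_one (by omega), smul_zero,
    zero_add, wordProj_ι] at h6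
  have h7 := inj h5
  have h8 := inj' h6
  rw [suspProj, map_sub, A.hasDeg_m₁.gradeProj_apply (n := k) (m := k - 1) rfl, gradeProj_of_mem hu,
    sub_eq_zero] at h7
  rw [suspProj, add_sub_cancel_right, map_sub, map_add, gradeProj_of_mem hv,
    F.hasDeg_f₁.gradeProj_apply (add_zero k),
    A'.hasDeg_m₁.gradeProj_apply (n := k + 1) (by ring), sub_eq_zero] at h8
  exact ⟨_, gradeProj_mem _, _, gradeProj_mem _, h7, h8⟩

include hM hM' in
theorem AInfHom.IsBarEquiv.liftsAt [Module.Flat R M] [Module.Flat R M'] (hF : F.IsBarEquiv)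
    (k : ℤ) : F.LiftsAt k := by
  suffices H : ∀ j : ℕ, ∀ n : ℤ, n < j → F.LiftsAt n from H (k + 1).toNat k (by omega)
  intro j
  induction j with
  | zero =>
    intro n hn u hu v hv _ _
    push_cast at hn
    rw [hM _ (by linarith), Submodule.mem_bot] at hu
    rw [hM' n hn.le, Submodule.mem_bot] at hv
    exact ⟨0, zero_mem _, 0, zero_mem _, by rw [hu, map_zero], by rw [hv]; simp⟩
  | succ j ih =>
    intro n hn
    exact hF.liftsAt_of_lt hM hM' fun i hi => ih i (by push_cast at hn; linarith)

end Lifting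

end AInf

theorem mainTheorem2 {R K M M' : Type*} [CommRing R]
    [AddCommGroup K] [Module R K] [AddCommGroup M] [Module R M] [AddCommGroup M'] [Module R M']
    (𝒦 : ℤ → Submodule R K) [DirectSum.Decomposition 𝒦]
    (𝓜 : ℤ → Submodule R M) [DirectSum.Decomposition 𝓜]
    (𝓜' : ℤ → Submodule R M') [DirectSum.Decomposition 𝓜']
    (C : AInf.DGCoalgebra 𝒦) (hfree : ∀ n, Module.Free R (𝒦 n))
    (A : AInf.AInfAlgebra 𝓜) (A' : AInf.AInfAlgebra 𝓜')
    (hM : AInf.IsConnected 𝓜) (hM' : AInf.IsConnected 𝓜')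
    (F : AInf.AInfHom A A')
    (hF : F.IsQuasiIso ∨
      ((∀ n, Module.Flat R (𝓜 n)) ∧ (∀ n, Module.Flat R (𝓜' n)) ∧ F.IsBarEquiv))
    (φ : K →ₗ[R] M') (hφ : AInf.IsTwistingCochain C A' φ) :
    ∃ ψ : K →ₗ[R] M, AInf.IsTwistingCochain C A ψ ∧
      ∃ χ : K →ₗ[R] M', AInf.IsComposite C F ψ χ ∧ AInf.TwistEquiv C A' φ χ := by
  -- Either form of weak equivalence enters only through acyclicity of the cone of f₁.
  refine AInf.exists_twistEquiv_of_liftsAt hM hM' hfree ?_ hφ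
  rcases hF with h | ⟨h1, h2, h⟩
  · exact h.liftsAt F hM'
  · have := AInf.flat_of_decomposition 𝓜
    have := AInf.flat_of_decomposition 𝓜'
    exact h.liftsAt hM hM'
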